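/- \textbf{Setting.} Let $(V,d)$ be a finite metric space with $n$ points, partitioned into $m\ge 2$ color classes $V=V_1\cup\dots\cup V_m$, and let $1\le k\le m$ and nonnegative integers $\ell_i,u_i$ ($i\in[m]$) be given. A set $S\subseteq V$ satisfies the constraints if $|S|=k$ and $\ell_i\le|S\cap V_i|\le u_i$ for all $i$. Put $\mathrm{div}(S)=\min_{u,v\in S,\,u\ne v}d(u,v)$ (and $\mathrm{div}(S)=\infty$ if $|S|\le 1$) and $\alpha=\sqrt{\log m}/m$ (natural logarithm). \textbf{Algorithm} $\mathrm{FMMD}(V,d,\gamma_1,\gamma_2,b,T)$, where $T\ge 1$ is an integer. \emph{(1) Pruning.} For each color $i$ start with $U_i=\emptyset$ and all points of $V_i$ unmarked; while $V_i$ has an unmarked point and $|U_i|\le b$, pick any unmarked $v\in V_i$, mark all $u\in V_i$ with $d(u,v)<\gamma_1$, and add $v$ to $U_i$. Let $U=U_1\cup\dots\cup U_m$ and $N=|U|$. Start with $S=\emptyset$ and repeat steps (2) and (3) $T\cdot m$ times or until $S$ satisfies the constraints; then return $S$. \emph{(2) Decomposition.} Let $G$ be the graph on $U$ joining distinct points at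 distance less than $\gamma_2\alpha$, $d_G$ its shortest path distance and $B_G(u,R)=\{v\in U: d_G(u,v)\le R\}$. Choose, independently, a uniformly random ordering $\pi(1),\dots,\pi(N)$ of $U$ and a uniformly random integer $R\in\{\Delta_1,\dots,\Delta_2\}$, where $\Delta_1=\max(\lfloor 1/(4\alpha)\rfloor,1)$ and $\Delta_2=\lfloor 1/(2\alpha)\rfloor$. Let $C_j=B_G(\pi(j),R)\setminus\bigcup_{i<j}B_G(\pi(i),R)$ and $D_j=\{u\in C_j: d_G(\pi(j),u)<R\}$. \emph{(3) Assignment.} Take any maximum integral flow in the network with nodes $s,D_1,\dots,D_N,c_1,\dots,c_m,z,t$ and arcs $s\to D_i$ of capacity $1$; $D_i\to c_j$ of capacity $1$ whenever $D_i$ contains a point of color $j$; $c_j\to t$ of capacity $\ell_j$; $c_j\to z$ of capacity $u_j-\ell_j$; $z\to t$ of capacity $k-\sum_j\ell_j$. Let $S$ consist of one arbitrary point of color $j$ of $D_i$ for every pair $(i,j)$ such that $D_i$ flows to $c_j$. \textbf{Proposition.} There is a universal constant $c>0$ such that the following holds. Let $\tau>0$ and assume that some $O\subseteq V$ satisfies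 the constraints and has $\mathrm{div}(O)\ge\tau$. Then, however the arbitrary choices of the algorithm are made, $\mathrm{FMMD}(V,d,2\tau/5,\tau/5,k,T)$ returns, with probability at least $1-2^{-cT}$, a set $S$ that satisfies the constraints and has \[\mathrm{div}(S)\ \ge\ \frac{\sqrt{\log m}}{5m}\,\tau .\] Moreover, under the same assumptions, the algorithm can be implemented, by one program for a random access machine with unit-cost distance queries, unit-cost real arithmetic (including square roots and logarithms) within comparisons and unit-cost uniform random draws, so that its running time on every such input is always $O(kmn+Tm^3k^2)$. -/

import Mathlib

/-! # Fair max-min diversification: the problem, the randomized algorithm, and a machine model -/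

namespace FMMD

noncomputable section

/-! ## The problem -/

section Problem

variable {V : Type*} [Fintype V] {m : ℕ}

open Classical in
/-- The points of `S` that have color `i`. -/
def colorClass (color : V → Fin m) (S : Finset V) (i : Fin m) : Finset V :=
  S.filter fun v => color v = i

/-- `S` has size `k` and contains between `ℓ i` and `u i` points of every color `i`. -/
def Fair (color : V → Fin m) (ℓ u : Fin m → ℕ) (k : ℕ) (S : Finset V) : Prop :=
  S.card = k ∧ ∀ i, ℓ i ≤ (colorClass color S i).card ∧ (colorClass color S i).card ≤ u i

/-- The diversity score: the smallest distance between two distinct points of `S`, which is the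
minimum over the empty set, that is `⊤`, if `S` has at most one point. -/
def diversity [MetricSpace V] (S : Finset V) : ENNReal :=
  (S : Set V).einfsep

end Problem

/-! ## Pruning -/

section Pruning

variable {V : Type*} [Fintype V] [MetricSpace V] {m : ℕ}

open Classical in
/-- The selection loop for one color with point set `W`. `PruneLoop W γ b M X Y` says that the
loop, started with the marked points `M` and the selected points `X`, can end with the selected
points `Y`. As long as there is an unmarked point in `W` and at most `b` points are selected, it
selects any unmarked point `v` of `W` and marks all points of `W` at distance less than `γ`
from `v`. -/
inductive PruneLoop (W : Finset V) (γ : ℝ) (b : ℕ) : Finset V → Finset V → Finset V → Prop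
  | done (M X : Finset V) (h : ¬((∃ v ∈ W, v ∉ M) ∧ X.card ≤ b)) : PruneLoop W γ b M X X
  | step (M X Y : Finset V) (v : V) (hv : v ∈ W) (hM : v ∉ M) (hX : X.card ≤ b)
      (h : PruneLoop W γ b (M ∪ W.filter fun w => dist w v < γ) (insert v X) Y) :
      PruneLoop W γ b M X Y

open Classical in
/-- `U` is a possible result of pruning the whole space, color by color, with threshold `γ` and
budget `b`. -/
def IsPruning (color : V → Fin m) (γ : ℝ) (b : ℕ) (U : Finset V) : Prop :=
  ∃ Y : Fin m → Finset V,
    (∀ i, PruneLoop (colorClass color Finset.univ i) γ b ∅ ∅ (Y i)) ∧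
      U = Finset.univ.biUnion Y

end Pruning

/-! ## Random decomposition -/

section Decomposition

variable {V : Type*} [MetricSpace V]

/-- `α = √(log m) / m`. -/
def alpha (m : ℕ) : ℝ := Real.sqrt (Real.log m) / m

/-- `Δ₁ = max(⌊1 / (4α)⌋, 1)`. -/
def radiusMin (m : ℕ) : ℕ := max ⌊1 / (4 * alpha m)⌋₊ 1

/-- `Δ₂ = ⌊1 / (2α)⌋`. -/
def radiusMax (m : ℕ) : ℕ := ⌊1 / (2 * alpha m)⌋₊

/-- The graph on `U` that joins distinct points at distance less than `r`. -/
def nearGraph (U : Finset V) (r : ℝ) : SimpleGraph {x // x ∈ U} where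
  Adj x y := x ≠ y ∧ dist (x : V) (y : V) < r
  symm := ⟨fun x y h => ⟨h.1.symm, by rw [dist_comm]; exact h.2⟩⟩
  loopless := ⟨fun _ h => h.1 rfl⟩

open Classical in
/-- The `j`-th cluster `D_j` for the order `π` and the radius `R`. A point `v` lies in `C_j` if it
is in the ball `B_G(π j, R)` and in no ball `B_G(π i, R)` with `i < j`; it lies in `D_j` if moreover
its distance in `G` to `π j` is less than `R`. -/
def cluster (U : Finset V) (r : ℝ) (π : Fin U.card ≃ {x // x ∈ U}) (R : ℕ) (j : Fin U.card) :
    Finset V :=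
  (Finset.univ.filter fun v : {x // x ∈ U} =>
    ((nearGraph U r).edist (π j) v ≤ R ∧ ∀ i < j, ¬ (nearGraph U r).edist (π i) v ≤ R) ∧
      (nearGraph U r).edist (π j) v < R).map (Function.Embedding.subtype _)

/-- A uniformly random order of the points of `U`. -/
def randomOrder (U : Finset V) : PMF (Fin U.card ≃ {x // x ∈ U}) :=
  haveI : Nonempty (Fin U.card ≃ {x // x ∈ U}) := ⟨U.equivFin.symm⟩
  haveI : Fintype (Fin U.card ≃ {x // x ∈ U}) := Fintype.ofFinite _
  PMF.uniformOfFintype _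

/-- A uniformly random element of `{Δ₁, …, Δ₂}`. This set is non-empty as soon as `2 ≤ m`, so the
second branch is never taken then. -/
def randomRadius (m : ℕ) : PMF ℕ :=
  if h : (Finset.Icc (radiusMin m) (radiusMax m)).Nonempty then PMF.uniformOfFinset _ h
  else PMF.pure (radiusMin m)

/-- The law of the decomposition `(D_1, …, D_N)` of `U`, `N = |U|`, for `m` colors and the
distance parameter `γ`. -/
def decompose (m : ℕ) (U : Finset V) (γ : ℝ) : PMF (Fin U.card → Finset V) :=
  (randomOrder U).bind fun π => (randomRadius m).map fun R => cluster U (γ * alpha m) π R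

end Decomposition

/-! ## Assigning colors to clusters by a maximum flow -/

section Flow

/-- `f` is an integral flow from `s` to `t` for the capacities `cap`. -/
def IsFlow {W : Type*} [Fintype W] (cap : W → W → ℕ) (s t : W) (f : W → W → ℕ) : Prop :=
  (∀ a b, f a b ≤ cap a b) ∧ ∀ a, a ≠ s → a ≠ t → ∑ b, f b a = ∑ b, f a b

/-- The throughput of a flow: what leaves the source minus what enters it. -/
def flowValue {W : Type*} [Fintype W] (s : W) (f : W → W → ℕ) : ℤ :=
  (∑ b, (f s b : ℤ)) - ∑ b, (f b s : ℤ)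

/-- `f` is a maximum integral flow. -/
def IsMaxFlow {W : Type*} [Fintype W] (cap : W → W → ℕ) (s t : W) (f : W → W → ℕ) : Prop :=
  IsFlow cap s t f ∧ ∀ g, IsFlow cap s t g → flowValue s g ≤ flowValue s f

/-- The nodes of the network: a source, the clusters, the colors, the node `z`, and a sink. -/
inductive Node (N m : ℕ) : Type
  | source : Node N m
  | clus (i : Fin N) : Node N m
  | col (j : Fin m) : Node N m
  | slack : Node N m
  | sink : Node N m
  deriving DecidableEq, Fintype

variable {V : Type*} [Fintype V] {m N : ℕ}

open Classical in
/-- The capacities of the network. -/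
def capacity (color : V → Fin m) (ℓ u : Fin m → ℕ) (k : ℕ) (D : Fin N → Finset V) :
    Node N m → Node N m → ℕ
  | .source, .clus _ => 1
  | .clus i, .col j => if ∃ v ∈ D i, color v = j then 1 else 0
  | .col j, .sink => ℓ j
  | .col j, .slack => u j - ℓ j
  | .slack, .sink => k - ∑ j, ℓ j
  | _, _ => 0

open Classical in
/-- `S` is a possible result of the assignment step on the clusters `D`: for some maximum integral
flow, `S` consists of one point of color `j` of `D i`, arbitrarily picked, for all `i` and `j`
such that `D i` flows to color `j`. -/
def IsAssignment (color : V → Fin m) (ℓ u : Fin m → ℕ) (k : ℕ) (D : Fin N → Finset V)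
    (S : Finset V) : Prop :=
  ∃ f : Node N m → Node N m → ℕ, IsMaxFlow (capacity color ℓ u k D) .source .sink f ∧
    ∃ pick : Fin N → Fin m → V,
      (∀ i j, 0 < f (.clus i) (.col j) → pick i j ∈ D i ∧ color (pick i j) = j) ∧
      S = Finset.univ.filter fun v => ∃ i j, 0 < f (.clus i) (.col j) ∧ v = pick i j

end Flow

/-! ## The algorithm -/

section Algorithm

variable {V : Type*} [Fintype V] {m : ℕ}

open Classical in
/-- `repeatUntil good dec solve r S`: at most `r` times, draw `D` from `dec` and replace the current
set `S` by `solve r D`, until `S` is good. The first argument of `solve` is the number of repetitions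
that are left, so the choices in the assignment step may differ between repetitions. -/
def repeatUntil {Δ : Type*} (good : Finset V → Prop) (dec : PMF Δ)
    (solve : ℕ → Δ → Finset V) : ℕ → Finset V → PMF (Finset V)
  | 0, S => PMF.pure S
  | r + 1, _ => dec.bind fun D =>
      if good (solve r D) then PMF.pure (solve r D)
      else repeatUntil good dec solve r (solve r D)

/-- `μ` is a possible law of the output of the algorithm with thresholds `γ₁` and `γ₂`, budget `b`
and repetition parameter `T`: the pruning with `γ₁` and `b` results in some `U`, and then
decomposition with `γ₂` and assignment are repeated `T * m` times or until the result is fair.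
"Possible" refers to the arbitrary choices of the algorithm (the points selected in the pruning, the
maximum flows, the points picked from the clusters); the law is over its random choices. -/
def IsOutputLaw [MetricSpace V] (color : V → Fin m) (ℓ u : Fin m → ℕ) (k : ℕ) (γ₁ γ₂ : ℝ)
    (b T : ℕ) (μ : PMF (Finset V)) : Prop :=
  ∃ U : Finset V, IsPruning color γ₁ b U ∧
    ∃ solve : ℕ → (Fin U.card → Finset V) → Finset V,
      (∀ r D, IsAssignment color ℓ u k D (solve r D)) ∧
      μ = repeatUntil (Fair color ℓ u k) (decompose m U γ₂) solve (T * m) ∅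

end Algorithm

/-! ## A random access machine with unit-cost distances

Programs are written in a small imperative language over a memory of natural numbers, organized in
two-dimensional arrays, all of whose cells are initially `0`. Integers can be added, subtracted and
compared; real numbers occur only inside comparisons; there is a unit-cost access to the input, in
particular to the distance of two points, and a uniform random draw. The only loops are counting
loops, so that every program terminates. Every node of an expression that is evaluated, every command
and every pass through a loop costs one time unit. -/

section Machine

/-- The read-only input of a program. Points are numbered from `0` to `n - 1` and colors from `0`
to `m - 1`. -/
structure Input where
  n : ℕ
  m : ℕ
  k : ℕ
  T : ℕ
  color : ℕ → ℕ
  lower : ℕ → ℕ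
  upper : ℕ → ℕ
  dist : ℕ → ℕ → ℝ
  τ : ℝ

/-- The configuration of the machine: the memory (`mem (a, i, j)` is the entry `(i, j)` of array `a`)
and the time used so far, which programs cannot read. -/
structure Config where
  mem : ℕ × ℕ × ℕ → ℕ
  time : ℕ

/-- Integer expressions. -/
inductive NExpr : Type
  | const (c : ℕ) : NExpr
  | numPoints : NExpr
  | numColors : NExpr
  | solutionSize : NExpr
  | repetitions : NExpr
  | color (v : NExpr) : NExpr
  | lower (i : NExpr) : NExpr
  | upper (i : NExpr) : NExpr
  | load (a : ℕ) (i j : NExpr) : NExpr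
  | plus (x y : NExpr) : NExpr
  | minus (x y : NExpr) : NExpr

/-- Real expressions. -/
inductive RExpr : Type
  | cast (x : NExpr) : RExpr
  | tau : RExpr
  | dist (v w : NExpr) : RExpr
  | plus (x y : RExpr) : RExpr
  | minus (x y : RExpr) : RExpr
  | times (x y : RExpr) : RExpr
  | divide (x y : RExpr) : RExpr
  | sqrt (x : RExpr) : RExpr
  | log (x : RExpr) : RExpr

/-- Tests. -/
inductive BExpr : Type
  | eq (x y : NExpr) : BExpr
  | lt (x y : NExpr) : BExpr
  | rlt (x y : RExpr) : BExpr
  | neg (p : BExpr) : BExpr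
  | conj (p q : BExpr) : BExpr

/-- Commands. `store a i j x` assigns `x` to the cell `(i, j)` of array `a`; `draw a i j x` assigns to
it a uniformly random element of `{0, …, x}`; `loop a x c` evaluates `x` once and then runs `c` that
many times, with the number of the pass, from `0` on, in the cell `(0, 0)` of array `a`. -/
inductive Cmd : Type
  | skip : Cmd
  | store (a : ℕ) (i j x : NExpr) : Cmd
  | draw (a : ℕ) (i j x : NExpr) : Cmd
  | seq (c d : Cmd) : Cmd
  | cond (p : BExpr) (c d : Cmd) : Cmd
  | loop (a : ℕ) (x : NExpr) (c : Cmd) : Cmd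

/-- The value of an integer expression (subtraction is truncated). -/
def NExpr.eval (I : Input) (M : ℕ × ℕ × ℕ → ℕ) : NExpr → ℕ
  | const c => c
  | numPoints => I.n
  | numColors => I.m
  | solutionSize => I.k
  | repetitions => I.T
  | color v => I.color (v.eval I M)
  | lower i => I.lower (i.eval I M)
  | upper i => I.upper (i.eval I M)
  | load a i j => M (a, i.eval I M, j.eval I M)
  | plus x y => x.eval I M + y.eval I M
  | minus x y => x.eval I M - y.eval I M

/-- The number of nodes of an integer expression. -/
def NExpr.cost : NExpr → ℕ
  | const _ => 1
  | numPoints => 1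
  | numColors => 1
  | solutionSize => 1
  | repetitions => 1
  | color v => v.cost + 1
  | lower i => i.cost + 1
  | upper i => i.cost + 1
  | load _ i j => i.cost + j.cost + 1
  | plus x y => x.cost + y.cost + 1
  | minus x y => x.cost + y.cost + 1

/-- The value of a real expression. -/
def RExpr.eval (I : Input) (M : ℕ × ℕ × ℕ → ℕ) : RExpr → ℝ
  | cast x => (x.eval I M : ℝ)
  | tau => I.τ
  | dist v w => I.dist (v.eval I M) (w.eval I M)
  | plus x y => x.eval I M + y.eval I M
  | minus x y => x.eval I M - y.eval I M
  | times x y => x.eval I M * y.eval I M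
  | divide x y => x.eval I M / y.eval I M
  | sqrt x => Real.sqrt (x.eval I M)
  | log x => Real.log (x.eval I M)

/-- The number of nodes of a real expression. -/
def RExpr.cost : RExpr → ℕ
  | cast x => x.cost + 1
  | tau => 1
  | dist v w => v.cost + w.cost + 1
  | plus x y => x.cost + y.cost + 1
  | minus x y => x.cost + y.cost + 1
  | times x y => x.cost + y.cost + 1
  | divide x y => x.cost + y.cost + 1
  | sqrt x => x.cost + 1
  | log x => x.cost + 1

/-- The meaning of a test. -/
def BExpr.holds (I : Input) (M : ℕ × ℕ × ℕ → ℕ) : BExpr → Prop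
  | eq x y => x.eval I M = y.eval I M
  | lt x y => x.eval I M < y.eval I M
  | rlt x y => x.eval I M < y.eval I M
  | neg p => ¬ p.holds I M
  | conj p q => p.holds I M ∧ q.holds I M

/-- The number of nodes of a test. -/
def BExpr.cost : BExpr → ℕ
  | eq x y => x.cost + y.cost + 1
  | lt x y => x.cost + y.cost + 1
  | rlt x y => x.cost + y.cost + 1
  | neg p => p.cost + 1
  | conj p q => p.cost + q.cost + 1

/-- Let `t` time units pass. -/
def Config.tick (s : Config) (t : ℕ) : Config := ⟨s.mem, s.time + t⟩

/-- Write `x` into the cell `(i, j)` of array `a`. -/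
def Config.write (s : Config) (a i j x : ℕ) : Config := ⟨Function.update s.mem (a, i, j) x, s.time⟩

/-- Run `step 0`, …, `step (r - 1)` one after the other. -/
def iterate (step : ℕ → Config → PMF Config) : ℕ → Config → PMF Config
  | 0, s => PMF.pure s
  | r + 1, s => (iterate step r s).bind (step r)

open Classical in
/-- The law of the configuration after a command. -/
def Cmd.exec (I : Input) : Cmd → Config → PMF Config
  | skip => fun s => PMF.pure (s.tick 1)
  | store a i j x => fun s =>
      PMF.pure ((s.write a (i.eval I s.mem) (j.eval I s.mem) (x.eval I s.mem)).tick
        (i.cost + j.cost + x.cost + 1))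
  | draw a i j x => fun s =>
      (PMF.uniformOfFintype (Fin (x.eval I s.mem + 1))).map fun y =>
        (s.write a (i.eval I s.mem) (j.eval I s.mem) (y : ℕ)).tick (i.cost + j.cost + x.cost + 1)
  | seq c d => fun s => (c.exec I s).bind (d.exec I)
  | cond p c d => fun s =>
      if p.holds I s.mem then c.exec I (s.tick (p.cost + 1)) else d.exec I (s.tick (p.cost + 1))
  | loop a x c => fun s =>
      iterate (fun r s' => c.exec I ((s'.write a 0 0 r).tick 1)) (x.eval I s.mem)
        (s.tick (x.cost + 1))

/-- The law of the final configuration of a program. -/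
def Cmd.run (P : Cmd) (I : Input) : PMF Config := P.exec I ⟨fun _ => 0, 0⟩

variable {V : Type*} [MetricSpace V] {n m : ℕ}

/-- The input of a program that describes a colored metric space, whose points are listed by `pt`,
together with the constraints, the repetition parameter and the target diversity. -/
def encode (pt : Fin n ≃ V) (color : V → Fin m) (ℓ u : Fin m → ℕ) (k T : ℕ) (τ : ℝ) : Input where
  n := n
  m := m
  k := k
  T := T
  color i := if h : i < n then color (pt ⟨i, h⟩) else 0
  lower i := if h : i < m then ℓ ⟨i, h⟩ else 0
  upper i := if h : i < m then u ⟨i, h⟩ else 0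
  dist i j := if h : i < n ∧ j < n then Dist.dist (pt ⟨i, h.1⟩) (pt ⟨j, h.2⟩) else 0
  τ := τ

open Classical in
/-- The set of points that a program outputs: the numbers of its points stand in the cells `(i, 0)` of
array `1`, for `i` less than the length, which stands in the cell `(0, 0)` of array `0`. -/
def outputSet [Fintype V] (pt : Fin n ≃ V) (s : Config) : Finset V :=
  Finset.univ.filter fun v => ∃ i < s.mem (0, 0, 0), s.mem (1, i, 0) = (pt.symm v : ℕ)

end Machine

end

end FMMD

/-! Write `γ = τ / 5`, `s = √(log m)`, `α = s / m`, and let `O` be a fair set with distances at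
least `5 γ`.

Pruning loses little (`IsPruning.exists_representatives`). If at most `k` points of a color were
kept, every point of that color has a kept point closer than `2 γ`, and two such replacements stay
`5 γ - 4 γ` apart. If `k + 1` points were kept, they are `2 γ` apart, so every representative
already fixed is closer than `γ` to at most one of them; there are fewer than `k + 1` of these, and
a free point remains. Hence `U` contains points `g o` of the same colors as `o ∈ O` with distances
at least `γ`.

One decomposition separates all `g o` with probability at least `exp (-128) / m`
(`decompose_captures`). Two points joined by a path of `2 Δ₂` edges are closer than `2 Δ₂ γ α ≤ γ`,
so the balls of radius `R ≤ Δ₂` around the points `g o` are disjoint. The point `g o` survives in a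
cluster if the first point of its `R`-ball in the random order lies in its `(R - 1)`-ball. For
disjoint balls these events are independent, with probabilities `|B (R - 1)| / |B R|`
(`card_goodOrders_mul`). Averaging over `R`, convexity of `exp` turns the product of the ratios into
a telescoping sum of logarithms (`sum_prod_ratio_ge`). A ball of radius `Δ₂` has at most `m` points,
at most one per color, and a ball of radius `Δ₁ - 1` has at least `Δ₁` points unless it is a whole
component, so each ball grows by a factor of at most `8 s`. With at most `m` balls and at least `1 /
(4 α)` radii the exponent is at most `4 s log (8 s) ≤ log m + 128`.

If the points `g o` lie in different clusters, sending each of these clusters to the color of its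
`o` is a flow of value `k`, so every maximum flow has value `k`, saturates all lower bounds and
gives a fair set (`IsAssignment.fair`). Points of different clusters are at distance at least `γ α`
in any case. Finally `T m` rounds all fail with probability at most `(1 - c / m) ^ (T m) ≤ exp (-c
T) ≤ 2 ^ (-c T)` (`guarantee`).

For the running time an explicit program is verified. At most `N ≤ m (k + 1)` points are kept. A
kept point has at most one neighbor of each color, so breadth first search from all points takes
`O(N² m)`. A round costs `O(N²)` for the clusters and `O(m N)` for each of `k` augmentations of a
matching of clusters with colors. Optimality of the matching is certified by a set of colors closed
under alternating paths, which is a minimum cut (`isMaxFlow_selFlow`). The random order comes from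
an inside-out shuffle, uniform by a bijection. Everything after the draws is deterministic and
depends on them only through the clusters, so the program realizes one admissible family of
arbitrary choices (`mainCmd_correct`). -/

namespace FMMD

noncomputable section

set_option linter.unusedSectionVars false
set_option linter.unusedSimpArgs false

/-! ## Deterministic execution -/

section Deterministic

/-- The memory of the machine. -/
abbrev Mem := ℕ × ℕ × ℕ → ℕ

/-- A command without random draws. -/
def Cmd.drawFree : Cmd → Bool
  | .skip => true
  | .store _ _ _ _ => true
  | .draw _ _ _ _ => false
  | .seq c d => c.drawFree && d.drawFree
  | .cond _ c d => c.drawFree && d.drawFree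
  | .loop _ _ c => c.drawFree

open Classical in
/-- The memory after a draw-free command, and the time that the command takes. -/
def Cmd.det (I : Input) : Cmd → Mem → Mem × ℕ
  | .skip => fun M => (M, 1)
  | .store a i j x => fun M =>
      (Function.update M (a, i.eval I M, j.eval I M) (x.eval I M), i.cost + j.cost + x.cost + 1)
  | .draw _ _ _ _ => fun M => (M, 0)
  | .seq c d => fun M =>
      ((d.det I (c.det I M).1).1, (c.det I M).2 + (d.det I (c.det I M).1).2)
  | .cond p c d => fun M =>
      if p.holds I M then ((c.det I M).1, p.cost + 1 + (c.det I M).2)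
      else ((d.det I M).1, p.cost + 1 + (d.det I M).2)
  | .loop a x c => fun M =>
      Nat.rec (M, x.cost + 1) (fun r q =>
        ((c.det I (Function.update q.1 (a, 0, 0) r)).1,
          q.2 + 1 + (c.det I (Function.update q.1 (a, 0, 0) r)).2)) (x.eval I M)

/-- Without draws no probability is left, and since programs cannot read the clock, the memory and
the elapsed time evolve separately. This reduces all of the program except the two draws to a
function on memories. -/
theorem Cmd.exec_eq_pure (I : Input) (c : Cmd) (hc : c.drawFree = true) (s : Config) :
    c.exec I s = PMF.pure ⟨(c.det I s.mem).1, s.time + (c.det I s.mem).2⟩ := by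
  induction c generalizing s with
  | skip => rfl
  | store a i j x => rfl
  | draw => simp [Cmd.drawFree] at hc
  | seq c d ihc ihd =>
    simp only [Cmd.drawFree, Bool.and_eq_true] at hc
    simp only [Cmd.exec, Cmd.det, ihc hc.1, PMF.pure_bind, ihd hc.2, add_assoc]
  | cond p c d ihc ihd =>
    simp only [Cmd.drawFree, Bool.and_eq_true] at hc
    simp only [Cmd.exec, Cmd.det]
    split_ifs
    · simp only [ihc hc.1, Config.tick, add_assoc]
    · simp only [ihd hc.2, Config.tick, add_assoc]
  | loop a x c ih =>
    simp only [Cmd.drawFree] at hc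
    simp only [Cmd.exec, Cmd.det]
    generalize x.eval I s.mem = r
    induction r with
    | zero => rfl
    | succ r ihr =>
      rw [iterate, ihr, PMF.pure_bind, ih hc]
      simp only [Config.tick, Config.write, add_assoc]

/-- The draw-free command `c` started with the memory `M` takes time at most `t` and ends with a
memory that satisfies `Q`. -/
def Spec (I : Input) (c : Cmd) (M : Mem) (t : ℕ) (Q : Mem → Prop) : Prop :=
  (c.det I M).2 ≤ t ∧ Q (c.det I M).1

variable {I : Input} {M : Mem} {t : ℕ} {Q : Mem → Prop}

theorem Spec.mono {c : Cmd} {t' : ℕ} {Q' : Mem → Prop} (h : Spec I c M t' Q') (ht : t' ≤ t)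
    (hQ : ∀ M', Q' M' → Q M') : Spec I c M t Q :=
  ⟨h.1.trans ht, hQ _ h.2⟩

theorem Spec.seq {c d : Cmd} (t₁ t₂ : ℕ) (h : Spec I c M t₁ fun M' => Spec I d M' t₂ Q)
    (ht : t₁ + t₂ ≤ t) : Spec I (.seq c d) M t Q :=
  ⟨(add_le_add h.1 h.2.1).trans ht, h.2.2⟩

theorem Spec.skip (hQ : Q M) (ht : 1 ≤ t) : Spec I .skip M t Q := ⟨ht, hQ⟩

theorem Spec.store {a : ℕ} {i j x : NExpr}
    (hQ : Q (Function.update M (a, i.eval I M, j.eval I M) (x.eval I M)))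
    (ht : i.cost + j.cost + x.cost + 1 ≤ t) : Spec I (.store a i j x) M t Q :=
  ⟨ht, hQ⟩

theorem Spec.cond {p : BExpr} {c d : Cmd} (t' : ℕ) (hc : p.holds I M → Spec I c M t' Q)
    (hd : ¬ p.holds I M → Spec I d M t' Q) (ht : p.cost + 1 + t' ≤ t) :
    Spec I (.cond p c d) M t Q := by
  unfold Spec
  simp only [Cmd.det]
  split_ifs with h
  · exact ⟨(Nat.add_le_add_left (hc h).1 _).trans ht, (hc h).2⟩
  · exact ⟨(Nat.add_le_add_left (hd h).1 _).trans ht, (hd h).2⟩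

/-- The arrays that a command may write to. -/
def Cmd.writes : Cmd → List ℕ
  | .skip => []
  | .store a _ _ _ => [a]
  | .draw a _ _ _ => [a]
  | .seq c d => c.writes ++ d.writes
  | .cond _ c d => c.writes ++ d.writes
  | .loop a _ c => a :: c.writes

/-- `M` and `M'` agree on all arrays that are not in `W`. -/
def Frame (W : List ℕ) (M M' : Mem) : Prop := ∀ a i j, a ∉ W → M' (a, i, j) = M (a, i, j)

theorem Frame.refl (W : List ℕ) (M : Mem) : Frame W M M := fun _ _ _ _ => rfl

theorem Frame.trans {W : List ℕ} {M M' M'' : Mem} (h : Frame W M M') (h' : Frame W M' M'') :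
    Frame W M M'' := fun a i j ha => (h' a i j ha).trans (h a i j ha)

theorem Frame.mono {W W' : List ℕ} {M M' : Mem} (h : Frame W M M') (hW : W ⊆ W') :
    Frame W' M M' := fun a i j ha => h a i j fun h' => ha (hW h')

theorem Frame.update {W : List ℕ} {M M' : Mem} (h : Frame W M M') {a : ℕ} (ha : a ∈ W)
    (i j x : ℕ) : Frame W M (Function.update M' (a, i, j) x) := by
  intro b i' j' hb
  rw [Function.update_of_ne, h b i' j' hb]
  rintro h'
  simp only [Prod.mk.injEq] at h'
  exact hb (h'.1 ▸ ha)

/-- The frame rule: facts about arrays outside the syntactic list `c.writes` survive `c`. In the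
verification below each such transfer costs one `decide` on array numbers. -/
theorem Cmd.det_frame (I : Input) (c : Cmd) (M : Mem) : Frame c.writes M (c.det I M).1 := by
  induction c generalizing M with
  | skip => exact Frame.refl _ _
  | store a i j x => exact (Frame.refl _ M).update (by simp [Cmd.writes]) _ _ _
  | draw => exact Frame.refl _ _
  | seq c d ihc ihd =>
    exact ((ihc M).mono (by simp [Cmd.writes])).trans ((ihd _).mono (by simp [Cmd.writes]))
  | cond p c d ihc ihd =>
    simp only [Cmd.det]
    split_ifs
    · exact (ihc M).mono (by simp [Cmd.writes])
    · exact (ihd M).mono (by simp [Cmd.writes])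
  | loop a x c ih =>
    simp only [Cmd.det]
    generalize x.eval I M = r
    induction r with
    | zero => exact Frame.refl _ _
    | succ r ihr =>
      exact (ihr.update (by simp [Cmd.writes]) _ _ _).trans
        ((ih _).mono (by simp [Cmd.writes]))

theorem Spec.frame {c : Cmd} (h : Spec I c M t Q) :
    Spec I c M t fun M' => Q M' ∧ Frame c.writes M M' :=
  ⟨h.1, h.2, c.det_frame I M⟩

/-- The rule for loops with the invariant `Inv`. -/
theorem Spec.loop {a : ℕ} {x : NExpr} {c : Cmd} (b : ℕ) (Inv : ℕ → Mem → Prop)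
    (h0 : Inv 0 M)
    (hstep : ∀ r M', r < x.eval I M → Inv r M' → Frame (a :: c.writes) M M' →
      Spec I c (Function.update M' (a, 0, 0) r) b (Inv (r + 1)))
    (hQ : ∀ M', Inv (x.eval I M) M' → Frame (a :: c.writes) M M' → Q M')
    (ht : x.eval I M * (b + 1) + (x.cost + 1) ≤ t) : Spec I (.loop a x c) M t Q := by
  -- The fold in `Cmd.det` is repeated literally, so that time bound, invariant and frame go through
  -- a single induction.
  have key : ∀ r ≤ x.eval I M, ∀ q : Mem × ℕ,
      q = Nat.rec (M, x.cost + 1) (fun r q =>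
        ((c.det I (Function.update q.1 (a, 0, 0) r)).1,
          q.2 + 1 + (c.det I (Function.update q.1 (a, 0, 0) r)).2)) r →
      q.2 ≤ r * (b + 1) + (x.cost + 1) ∧ Inv r q.1 ∧ Frame (a :: c.writes) M q.1 := by
    intro r
    induction r with
    | zero => rintro - q rfl; exact ⟨by simp, h0, Frame.refl _ _⟩
    | succ r ih =>
      rintro hr q rfl
      obtain ⟨h1, h2, h3⟩ := ih (by omega) _ rfl
      have h := hstep r _ (by omega) h2 h3
      refine ⟨?_, h.2, (h3.update (by simp) _ _ _).trans ((c.det_frame I _).mono (by simp))⟩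
      have := h.1
      simp only at h1 ⊢
      calc _ ≤ r * (b + 1) + (x.cost + 1) + 1 + b := by gcongr
        _ = _ := by ring
  obtain ⟨h1, h2, h3⟩ := key _ le_rfl _ rfl
  exact ⟨h1.trans ht, hQ _ h2 h3⟩

/-- The expression is the constant `0`. -/
def NExpr.isZero : NExpr → Bool
  | .const 0 => true
  | _ => false

/-- The integer expression `x` reads only cells `(i, 0)` of the arrays in `A` and the cells `(0, 0)` of
the arrays in `B`. -/
def NExpr.readsOnly (A B : List ℕ) : NExpr → Bool
  | .const _ => true
  | .numPoints => true
  | .numColors => true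
  | .solutionSize => true
  | .repetitions => true
  | .color v => v.readsOnly A B
  | .lower i => i.readsOnly A B
  | .upper i => i.readsOnly A B
  | .load a i j => j.isZero && (A.contains a && i.readsOnly A B || B.contains a && i.isZero)
  | .plus x y => x.readsOnly A B && y.readsOnly A B
  | .minus x y => x.readsOnly A B && y.readsOnly A B

/-- The test `p` compares integers and reads only cells `(i, 0)` of the arrays in `A` and the cells
`(0, 0)` of the arrays in `B`. -/
def BExpr.readsOnly (A B : List ℕ) : BExpr → Bool
  | .eq x y => x.readsOnly A B && y.readsOnly A B
  | .lt x y => x.readsOnly A B && y.readsOnly A B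
  | .rlt _ _ => false
  | .neg p => p.readsOnly A B
  | .conj p q => p.readsOnly A B && q.readsOnly A B

/-- The draw-free command `c` compares only integers and reads only cells `(i, 0)` of the arrays in
`A` and the cells `(0, 0)` of the arrays in `B`. -/
def Cmd.readsOnly (A B : List ℕ) : Cmd → Bool
  | .skip => true
  | .store _ i j x => i.readsOnly A B && j.readsOnly A B && x.readsOnly A B
  | .draw _ _ _ _ => false
  | .seq c d => c.readsOnly A B && d.readsOnly A B
  | .cond p c d => p.readsOnly A B && c.readsOnly A B && d.readsOnly A B
  | .loop _ x c => x.readsOnly A B && c.readsOnly A B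

/-- `M` and `M'` agree on the cells `(i, 0)` of the arrays in `A` and on the cells `(0, 0)` of the
arrays in `B`. -/
def Agree (A B : List ℕ) (M M' : Mem) : Prop :=
  (∀ a ∈ A, ∀ i, M (a, i, 0) = M' (a, i, 0)) ∧ ∀ b ∈ B, M (b, 0, 0) = M' (b, 0, 0)

theorem Agree.update {A B : List ℕ} {M M' : Mem} (h : Agree A B M M') (c : ℕ × ℕ × ℕ) (x : ℕ) :
    Agree A B (Function.update M c x) (Function.update M' c x) := by
  refine ⟨fun a ha i => ?_, fun b hb => ?_⟩
  · by_cases hc : (a, i, 0) = c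
    · simp [hc]
    · simp [Function.update_of_ne hc, h.1 a ha i]
  · by_cases hc : (b, 0, 0) = c
    · simp [hc]
    · simp [Function.update_of_ne hc, h.2 b hb]

theorem NExpr.eval_of_isZero (I : Input) (M : Mem) {x : NExpr} (hx : x.isZero = true) :
    x.eval I M = 0 := by
  unfold NExpr.isZero at hx
  split at hx
  · rfl
  · simp at hx

theorem NExpr.eval_congr (I : Input) {A B : List ℕ} {M M' : Mem} (h : Agree A B M M') (x : NExpr)
    (hx : x.readsOnly A B = true) : x.eval I M = x.eval I M' := by
  induction x with
  | load a i j ihi ihj =>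
    simp only [NExpr.readsOnly, Bool.and_eq_true, Bool.or_eq_true, List.contains_iff_mem] at hx
    obtain ⟨hj, ⟨ha, hi⟩ | ⟨hb, hi⟩⟩ := hx
    · simp only [NExpr.eval, ihi hi, NExpr.eval_of_isZero I _ hj]
      exact h.1 a ha _
    · simp only [NExpr.eval, NExpr.eval_of_isZero I _ hi, NExpr.eval_of_isZero I _ hj]
      exact h.2 a hb
  | _ => simp_all [NExpr.eval, NExpr.readsOnly]

theorem BExpr.holds_congr (I : Input) {A B : List ℕ} {M M' : Mem} (h : Agree A B M M') (p : BExpr)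
    (hp : p.readsOnly A B = true) : p.holds I M ↔ p.holds I M' := by
  induction p with
  | eq x y =>
    simp only [BExpr.readsOnly, Bool.and_eq_true] at hp
    simp only [BExpr.holds, x.eval_congr I h hp.1, y.eval_congr I h hp.2]
  | lt x y =>
    simp only [BExpr.readsOnly, Bool.and_eq_true] at hp
    simp only [BExpr.holds, x.eval_congr I h hp.1, y.eval_congr I h hp.2]
  | rlt x y => simp [BExpr.readsOnly] at hp
  | neg p ih => simp only [BExpr.holds, ih hp]
  | conj p q ihp ihq =>
    simp only [BExpr.readsOnly, Bool.and_eq_true] at hp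
    simp only [BExpr.holds, ihp hp.1, ihq hp.2]

/-- The values that a command leaves in the arrays that it reads depend only on these arrays. -/
theorem Cmd.det_agree (I : Input) {A B : List ℕ} (c : Cmd) (hc : c.readsOnly A B = true) {M M' : Mem}
    (h : Agree A B M M') : Agree A B (c.det I M).1 (c.det I M').1 := by
  induction c generalizing M M' with
  | skip => exact h
  | store a i j x =>
    simp only [Cmd.readsOnly, Bool.and_eq_true] at hc
    simp only [Cmd.det, i.eval_congr I h hc.1.1, j.eval_congr I h hc.1.2, x.eval_congr I h hc.2]
    exact h.update _ _
  | draw => exact h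
  | seq c d ihc ihd =>
    simp only [Cmd.readsOnly, Bool.and_eq_true] at hc
    exact ihd hc.2 (ihc hc.1 h)
  | cond p c d ihc ihd =>
    simp only [Cmd.readsOnly, Bool.and_eq_true] at hc
    have hp := p.holds_congr I h hc.1.1
    by_cases hM : p.holds I M
    · simp only [Cmd.det, if_pos hM, if_pos (hp.1 hM)]
      exact ihc hc.1.2 h
    · simp only [Cmd.det, if_neg hM, if_neg (mt hp.2 hM)]
      exact ihd hc.2 h
  | loop a x c ih =>
    simp only [Cmd.readsOnly, Bool.and_eq_true] at hc
    simp only [Cmd.det, x.eval_congr I h hc.1]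
    generalize x.eval I M' = r
    induction r with
    | zero => exact h
    | succ r ihr => exact ih hc.2 (ihr.update _ _)

end Deterministic

/-! ## Pruning keeps a fair and spread-out set -/

section PruningFacts

theorem mem_colorClass {V : Type*} {m : ℕ} {color : V → Fin m} {S : Finset V} {i : Fin m} {v : V} :
    v ∈ colorClass color S i ↔ v ∈ S ∧ color v = i := by
  simp [colorClass]

variable {V : Type*} [Fintype V] [MetricSpace V] {m : ℕ}

/-- `Y` is a subset of `W` with pairwise distances at least `γ`, and it is maximal or of
size `b + 1`. -/
structure IsNet (W : Finset V) (γ : ℝ) (b : ℕ) (Y : Finset V) : Prop where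
  subset : Y ⊆ W
  separated : ∀ x ∈ Y, ∀ y ∈ Y, x ≠ y → γ ≤ dist x y
  card_le : Y.card ≤ b + 1
  covers : Y.card ≤ b → ∀ w ∈ W, ∃ y ∈ Y, dist w y < γ

/-- The invariant is that the marked points are those closer than `γ` to a selected point. A newly
selected point is unmarked, hence far from the earlier ones; a run that stops below the budget has
no unmarked point left, which is the covering property. -/
theorem PruneLoop.isNet {W : Finset V} {γ : ℝ} {b : ℕ} {M X Y : Finset V}
    (h : PruneLoop W γ b M X Y) (hM : ∀ w ∈ W, w ∈ M ↔ ∃ x ∈ X, dist w x < γ) (hX : X ⊆ W)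
    (hsep : ∀ x ∈ X, ∀ y ∈ X, x ≠ y → γ ≤ dist x y) (hcard : X.card ≤ b + 1) :
    IsNet W γ b Y := by
  classical
  induction h with
  | done M X h =>
    refine ⟨hX, hsep, hcard, fun hb w hw => ?_⟩
    by_contra hc
    exact h ⟨⟨w, hw, fun hwM => hc ((hM w hw).1 hwM)⟩, hb⟩
  | step M X Y v hv hvM hXb _ ih =>
    refine ih (fun w hw => ?_) (Finset.insert_subset hv hX) ?_
      ((Finset.card_insert_le _ _).trans (by omega))
    · simp [hM w hw, hw, or_comm]
    · have hfar : ∀ x ∈ X, γ ≤ dist v x := fun x hx => by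
        by_contra hc
        exact hvM ((hM v hv).2 ⟨x, hx, not_le.1 hc⟩)
      intro x hx y hy hxy
      rcases Finset.mem_insert.1 hx with rfl | hx' <;>
        rcases Finset.mem_insert.1 hy with rfl | hy'
      · exact absurd rfl hxy
      · exact hfar y hy'
      · rw [dist_comm]; exact hfar x hx'
      · exact hsep x hx' y hy' hxy

variable {color : V → Fin m} {γ : ℝ} {b : ℕ} {U : Finset V}

/-- The points of each color form a net of the points of that color in the whole space. -/
theorem IsPruning.isNet (h : IsPruning color γ b U) (i : Fin m) :
    IsNet (colorClass color Finset.univ i) γ b (colorClass color U i) := by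
  classical
  obtain ⟨Y, hY, rfl⟩ := h
  have hnet : ∀ i, IsNet (colorClass color Finset.univ i) γ b (Y i) := fun i =>
    (hY i).isNet (by simp) (by simp) (by simp) (by simp)
  have : colorClass color (Finset.univ.biUnion Y) i = Y i := by
    ext v
    simp only [mem_colorClass, Finset.mem_biUnion, Finset.mem_univ, true_and]
    constructor
    · rintro ⟨⟨j, hj⟩, rfl⟩
      have := (mem_colorClass.1 ((hnet j).subset hj)).2
      rwa [this]
    · intro hv
      exact ⟨⟨i, hv⟩, (mem_colorClass.1 ((hnet i).subset hv)).2⟩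
  rw [this]
  exact hnet i

theorem IsPruning.card_le (h : IsPruning color γ b U) : U.card ≤ m * (b + 1) := by
  classical
  have : U.card = ∑ i, (colorClass color U i).card :=
    Finset.card_eq_sum_card_fiberwise (f := color) (t := Finset.univ) (by simp)
      |>.trans (by simp only [colorClass])
  rw [this]
  calc _ ≤ ∑ _i : Fin m, (b + 1) := Finset.sum_le_sum fun i _ => (h.isNet i).card_le
    _ = _ := by simp

theorem IsPruning.separated (h : IsPruning color γ b U) {x y : V} (hx : x ∈ U) (hy : y ∈ U)
    (hxy : x ≠ y) (hc : color x = color y) : γ ≤ dist x y :=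
  (h.isNet (color x)).separated x (mem_colorClass.2 ⟨hx, rfl⟩) y
    (mem_colorClass.2 ⟨hy, hc.symm⟩) hxy

theorem le_dist_of_le_diversity {S : Finset V} {τ : ℝ} (h : ENNReal.ofReal τ ≤ diversity S)
    {x y : V} (hx : x ∈ S) (hy : y ∈ S) (hxy : x ≠ y) : τ ≤ dist x y := by
  have := h.trans (Set.einfsep_le_edist_of_mem (s := (S : Set V)) hx hy hxy)
  rw [edist_dist] at this
  exact (ENNReal.ofReal_le_ofReal_iff dist_nonneg).1 this

theorem le_diversity {S : Finset V} {τ : ℝ}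
    (h : ∀ x ∈ S, ∀ y ∈ S, x ≠ y → τ ≤ dist x y) : ENNReal.ofReal τ ≤ diversity S := by
  refine Set.le_einfsep fun x hx y hy hxy => ?_
  rw [edist_dist]
  exact ENNReal.ofReal_le_ofReal (h x hx y hy hxy)

/-- If `O` has at most `k` points, with pairwise distances at least `5 γ`, then pruning with
threshold `2 γ` and budget `k` keeps points of the same colors as the points of `O`, with pairwise
distances at least `γ`. -/
theorem IsPruning.exists_representatives {k : ℕ} (h : IsPruning color (2 * γ) k U)
    {O : Finset V} (hO : O.card ≤ k) (hsep : ∀ x ∈ O, ∀ y ∈ O, x ≠ y → 5 * γ ≤ dist x y) :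
    ∃ g : V → V, (∀ o ∈ O, g o ∈ U ∧ color (g o) = color o) ∧
      ∀ x ∈ O, ∀ y ∈ O, x ≠ y → γ ≤ dist (g x) (g y) := by
  classical
  -- The points whose color did not exhaust the budget: there the kept points cover, and a nearby
  -- one can be taken.
  set small : Finset V := O.filter fun o => (colorClass color U (color o)).card ≤ k with hsmall
  have hrep : ∀ o : V, ∃ y, o ∈ small → (y ∈ U ∧ color y = color o) ∧ dist o y < 2 * γ := by
    intro o
    by_cases ho : o ∈ small
    · obtain ⟨y, hy, hd⟩ := (h.isNet (color o)).covers (Finset.mem_filter.1 ho).2 o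
        (mem_colorClass.2 ⟨Finset.mem_univ _, rfl⟩)
      exact ⟨y, fun _ => ⟨mem_colorClass.1 hy, hd⟩⟩
    · exact ⟨o, fun h => absurd h ho⟩
  choose g₀ hg₀ using hrep
  -- The points of the exhausted colors are represented one at a time, greedily, after all points of
  -- `small`.
  have main : ∀ Q : Finset V, Q ⊆ O \ small →
      ∃ g : V → V, (∀ o ∈ small ∪ Q, g o ∈ U ∧ color (g o) = color o) ∧
        ∀ x ∈ small ∪ Q, ∀ y ∈ small ∪ Q, x ≠ y → γ ≤ dist (g x) (g y) := by
    intro Q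
    induction Q using Finset.induction_on with
    | empty =>
      intro _
      refine ⟨g₀, by simpa using fun o ho => (hg₀ o ho).1, ?_⟩
      simp only [Finset.union_empty]
      intro x hx y hy hxy
      have h1 := hsep x (Finset.mem_filter.1 hx).1 y (Finset.mem_filter.1 hy).1 hxy
      have h2 := (hg₀ x hx).2
      have h3 := (hg₀ y hy).2
      have h4 := dist_triangle4 x (g₀ x) (g₀ y) y
      rw [dist_comm (g₀ y) y] at h4
      linarith
    | insert o Q hoQ ih =>
      intro hQ
      obtain ⟨g, hg, hgsep⟩ := ih ((Finset.subset_insert _ _).trans hQ)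
      have ho := Finset.mem_sdiff.1 (hQ (Finset.mem_insert_self _ _))
      have hcard : (small ∪ Q).card < (colorClass color U (color o)).card := by
        have h1 : k < (colorClass color U (color o)).card := by
          by_contra hc
          exact ho.2 (Finset.mem_filter.2 ⟨ho.1, not_lt.1 hc⟩)
        have h2 : (small ∪ Q) ⊆ O := Finset.union_subset (Finset.filter_subset _ _)
          (((Finset.subset_insert _ _).trans hQ).trans Finset.sdiff_subset)
        exact ((Finset.card_le_card h2).trans hO).trans_lt h1
      obtain ⟨y, hy, hfar⟩ : ∃ y ∈ colorClass color U (color o),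
          ∀ x ∈ small ∪ Q, γ ≤ dist y (g x) := by
        -- Pigeonhole: otherwise two of the more than `k` kept points are closer than `γ` to the
        -- same representative, hence closer than `2 γ` to each other.
        by_contra! hc
        have : ∀ y : V, ∃ x, y ∈ colorClass color U (color o) →
            x ∈ small ∪ Q ∧ dist y (g x) < γ := by
          intro y
          by_cases hy : y ∈ colorClass color U (color o)
          · obtain ⟨x, hx⟩ := hc y hy
            exact ⟨x, fun _ => hx⟩
          · exact ⟨y, fun h => absurd h hy⟩
        choose f hf using this
        obtain ⟨y, hy, y', hy', hne, hyy⟩ := Finset.exists_ne_map_eq_of_card_lt_of_maps_to hcard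
          (f := f) (fun y hy => (hf y hy).1)
        have h1 := (h.isNet (color o)).separated y hy y' hy' hne
        have h2 := (hf y hy).2
        have h3 := (hf y' hy').2
        rw [← hyy] at h3
        have h4 := dist_triangle_right y y' (g (f y))
        linarith
      have hyU := mem_colorClass.1 hy
      have hne : ∀ x ∈ small ∪ Q, x ≠ o := by
        rintro x hx rfl
        rcases Finset.mem_union.1 hx with hx | hx
        · exact ho.2 hx
        · exact hoQ hx
      refine ⟨Function.update g o y, ?_, ?_⟩
      · intro x hx
        rw [Finset.union_insert, Finset.mem_insert] at hx
        rcases hx with rfl | hx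
        · simpa using hyU
        · rw [Function.update_of_ne (hne x hx)]
          exact hg x hx
      · intro x hx x' hx' hxx
        rw [Finset.union_insert, Finset.mem_insert] at hx hx'
        rcases hx with rfl | hx <;> rcases hx' with rfl | hx'
        · exact absurd rfl hxx
        · rw [Function.update_self, Function.update_of_ne (hne x' hx')]
          exact hfar x' hx'
        · rw [Function.update_self, Function.update_of_ne (hne x hx), dist_comm]
          exact hfar x hx
        · rw [Function.update_of_ne (hne x hx), Function.update_of_ne (hne x' hx')]
          exact hgsep x hx x' hx' hxx
  obtain ⟨g, h1, h2⟩ := main _ subset_rfl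
  have hU : small ∪ (O \ small) = O := Finset.union_sdiff_of_subset (Finset.filter_subset _ _)
  rw [hU] at h1 h2
  exact ⟨g, h1, h2⟩

end PruningFacts

/-! ## Balls in graphs -/

section GraphBalls

variable {W : Type*} [Fintype W] (G : SimpleGraph W)

open Classical in
/-- The points at graph distance at most `t` from `u`. -/
def graphBall (u : W) (t : ℕ) : Finset W := Finset.univ.filter fun v => G.edist u v ≤ t

variable {G}

theorem mem_graphBall {u v : W} {t : ℕ} : v ∈ graphBall G u t ↔ G.edist u v ≤ t := by
  simp [graphBall]

theorem self_mem_graphBall (u : W) (t : ℕ) : u ∈ graphBall G u t := by simp [mem_graphBall]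

theorem graphBall_mono (u : W) {s t : ℕ} (h : s ≤ t) : graphBall G u s ⊆ graphBall G u t :=
  fun v hv => mem_graphBall.2 ((mem_graphBall.1 hv).trans (by exact_mod_cast h))

theorem edist_le_iff_exists_walk {u v : W} {t : ℕ} :
    G.edist u v ≤ t ↔ ∃ p : G.Walk u v, p.length ≤ t := by
  constructor
  · intro h
    obtain ⟨p, hp⟩ := SimpleGraph.exists_walk_of_edist_ne_top
      (ne_top_of_le_ne_top (ENat.natCast_ne_top t) h)
    exact ⟨p, by rw [← hp] at h; exact_mod_cast h⟩
  · rintro ⟨p, hp⟩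
    exact (SimpleGraph.edist_le p).trans (by exact_mod_cast hp)

/-- Cut the last edge off a walk. All growth arguments for balls, the separation of clusters and the
search are based on this one-step form. -/
theorem edist_le_succ_iff {u v : W} {t : ℕ} :
    G.edist u v ≤ (t + 1 : ℕ) ↔ G.edist u v ≤ t ∨ ∃ w, G.edist u w ≤ t ∧ G.Adj w v := by
  constructor
  · intro h
    rw [G.edist_comm] at h
    obtain ⟨p, hp⟩ := edist_le_iff_exists_walk.1 h
    cases p with
    | nil => left; simp
    | cons h p =>
      right
      refine ⟨_, ?_, h.symm⟩
      rw [G.edist_comm]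
      exact edist_le_iff_exists_walk.2 ⟨p, by simpa using hp⟩
  · rintro (h | ⟨w, h, hw⟩)
    · exact h.trans (by exact_mod_cast Nat.le_succ t)
    · obtain ⟨p, hp⟩ := edist_le_iff_exists_walk.1 h
      exact edist_le_iff_exists_walk.2 ⟨p.concat hw, by simpa using hp⟩

/-- A ball that does not grow in one step never grows again. -/
theorem graphBall_eq_of_eq_succ {u : W} {s : ℕ} (h : graphBall G u s = graphBall G u (s + 1))
    {t : ℕ} (ht : s ≤ t) : graphBall G u t = graphBall G u s := by
  induction t, ht using Nat.le_induction with
  | base => rfl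
  | succ t ht ih =>
    refine subset_antisymm (fun v hv => ?_) (graphBall_mono u (by omega))
    rcases edist_le_succ_iff.1 (mem_graphBall.1 hv) with hv | ⟨w, hw, hwv⟩
    · rw [← ih]; exact mem_graphBall.2 hv
    · rw [h]
      have : w ∈ graphBall G u s := by rw [← ih]; exact mem_graphBall.2 hw
      exact mem_graphBall.2 (edist_le_succ_iff.2 (Or.inr ⟨w, mem_graphBall.1 this, hwv⟩))

/-- A ball has more points than its radius says, or it is a whole component. -/
theorem lt_card_graphBall_or (u : W) (t : ℕ) :
    t < (graphBall G u t).card ∨ ∀ t' ≥ t, graphBall G u t' = graphBall G u t := by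
  induction t with
  | zero => left; exact Finset.card_pos.2 ⟨u, self_mem_graphBall u 0⟩
  | succ t ih =>
    by_cases h : graphBall G u t = graphBall G u (t + 1)
    · right
      intro t' ht'
      rw [graphBall_eq_of_eq_succ h (by omega : t ≤ t'), ← h]
    · rcases ih with ih | ih
      · left
        have := Finset.card_lt_card
          (Finset.ssubset_iff_subset_ne.2 ⟨graphBall_mono u (by omega : t ≤ t + 1), h⟩)
        omega
      · exact absurd (ih (t + 1) (by omega)).symm h

end GraphBalls

/-! ## The geometry of the clusters -/

section Clusters

variable {V : Type*} [MetricSpace V] {U : Finset V} {r : ℝ}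

theorem nearGraph_dist_le {u v : {x // x ∈ U}} (p : (nearGraph U r).Walk u v) :
    dist (u : V) v ≤ p.length * r := by
  induction p with
  | nil => simp
  | cons h p ih =>
    have := dist_triangle (_ : V) _ _ |>.trans (add_le_add h.2.le ih)
    rw [SimpleGraph.Walk.length_cons]
    push_cast
    linarith

/-- The first edge is strictly shorter than `r`. The strictness matters: `2 Δ₂ α ≤ 1` only gives a
weak inequality, while the representatives are at distance at least `γ`. -/
theorem nearGraph_dist_lt {u v : {x // x ∈ U}} {t : ℕ} (hr : 0 ≤ r)
    (h : (nearGraph U r).edist u v ≤ t) (huv : u ≠ v) : dist (u : V) v < t * r := by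
  obtain ⟨p, hp⟩ := edist_le_iff_exists_walk.1 h
  cases p with
  | nil => exact absurd rfl huv
  | cons h p =>
    have h1 := nearGraph_dist_le p
    have h2 : ((p.length : ℝ) + 1) * r ≤ t * r := by
      rw [SimpleGraph.Walk.length_cons] at hp
      gcongr
      exact_mod_cast hp
    calc dist (u : V) v ≤ _ := dist_triangle _ _ _
      _ < r + p.length * r := add_lt_add_of_lt_of_le h.2 h1
      _ ≤ _ := by linarith

variable {π : Fin U.card ≃ {x // x ∈ U}} {R : ℕ}

theorem mem_cluster {j : Fin U.card} {v : V} : v ∈ cluster U r π R j ↔ ∃ hv : v ∈ U,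
    ((nearGraph U r).edist (π j) ⟨v, hv⟩ ≤ R ∧
      ∀ i < j, ¬ (nearGraph U r).edist (π i) ⟨v, hv⟩ ≤ R) ∧
      (nearGraph U r).edist (π j) ⟨v, hv⟩ < R := by
  simp [cluster]

/-- Points of different clusters are far apart. -/
theorem le_dist_of_mem_cluster {i j : Fin U.card} (hij : i ≠ j) {u v : V}
    (hu : u ∈ cluster U r π R i) (hv : v ∈ cluster U r π R j) : r ≤ dist u v := by
  wlog h : i < j generalizing i j u v
  · rw [dist_comm]
    exact this hij.symm hv hu (lt_of_le_of_ne (not_lt.1 h) hij.symm)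
  obtain ⟨hu, ⟨hu1, hu2⟩, hu3⟩ := mem_cluster.1 hu
  obtain ⟨hv, ⟨hv1, hv2⟩, hv3⟩ := mem_cluster.1 hv
  by_contra hc
  -- The earlier center reaches `u` with graph distance strictly below `R`, so one more edge takes
  -- it to `v` within `R`, and `v` would have been removed before turn `j`. This is why the boundary
  -- of each ball is discarded.
  refine hv2 i h ?_
  by_cases huv : u = v
  · subst huv; exact hu1
  · have hadj : (nearGraph U r).Adj ⟨u, hu⟩ ⟨v, hv⟩ := ⟨by simpa using huv, not_le.1 hc⟩
    rcases R with - | R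
    · simp at hu3
    · refine edist_le_succ_iff.2 (Or.inr ⟨_, ?_, hadj⟩)
      exact (ENat.lt_add_one_iff (ENat.natCast_ne_top R)).1 (by simpa using hu3)

theorem cluster_disjoint {i j : Fin U.card} (hij : i ≠ j) :
    Disjoint (cluster U r π R i) (cluster U r π R j) := by
  wlog h : i < j generalizing i j
  · exact (this hij.symm (lt_of_le_of_ne (not_lt.1 h) hij.symm)).symm
  rw [Finset.disjoint_left]
  intro v hu hv
  obtain ⟨hu, ⟨hu1, hu2⟩, hu3⟩ := mem_cluster.1 hu
  obtain ⟨hv, ⟨hv1, hv2⟩, hv3⟩ := mem_cluster.1 hv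
  exact hv2 i h hu1

end Clusters

/-! ## Random orders -/

section Orders

variable {W ι : Type*} [Fintype W] [DecidableEq W] {N : ℕ}

open Classical in
/-- The orders in which the first point of `B` lies in `A`, for all pairs `(A, B) = (A o, B o)` with
`o ∈ S`. -/
def goodOrders [Fintype (Fin N ≃ W)] (A B : ι → Finset W) (S : Finset ι) : Finset (Fin N ≃ W) :=
  Finset.univ.filter fun π => ∀ o ∈ S, ∃ a ∈ A o, ∀ b ∈ B o, π.symm a ≤ π.symm b

/-- The first points of disjoint sets are independent and uniform, stated as a counting identity
free of division. In the induction, the good orders for `S` are split by the first point `b` of the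
new set `B o` into parts `F b`; swapping two points of `B o` maps one part into another and fixes
all other sets, so the parts have equal size. `E` consists of all of them, and the event for `o` of
those with `b ∈ A o`. -/
theorem card_goodOrders_mul [Fintype (Fin N ≃ W)] {A B : ι → Finset W} {S : Finset ι}
    (hAB : ∀ o ∈ S, A o ⊆ B o) (hne : ∀ o ∈ S, (A o).Nonempty)
    (hdisj : ∀ o ∈ S, ∀ o' ∈ S, o ≠ o' → Disjoint (B o) (B o')) :
    (goodOrders (N := N) A B S).card * ∏ o ∈ S, (B o).card =
      Fintype.card (Fin N ≃ W) * ∏ o ∈ S, (A o).card := by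
  classical
  induction S using Finset.induction_on with
  | empty => simp [goodOrders]
  | insert o S ho ih =>
    specialize ih (fun x hx => hAB x (Finset.mem_insert_of_mem hx))
      (fun x hx => hne x (Finset.mem_insert_of_mem hx))
      (fun x hx y hy => hdisj x (Finset.mem_insert_of_mem hx) y (Finset.mem_insert_of_mem hy))
    set E := goodOrders (N := N) A B S with hE
    let F : W → Finset (Fin N ≃ W) := fun b => E.filter fun π => ∀ b' ∈ B o, π.symm b ≤ π.symm b'
    -- exchanging two points of `B o` in the order does not affect the other balls
    have hle : ∀ b ∈ B o, ∀ b' ∈ B o, (F b).card ≤ (F b').card := by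
      intro b hb b' hb'
      refine Finset.card_le_card_of_injOn (fun π => π.trans (Equiv.swap b b')) ?_
        (fun x _ y _ h => by
          have := congrArg (fun e => e.trans (Equiv.swap b b')) h
          simpa [Equiv.trans_assoc] using this)
      intro π hπ
      simp only [F, hE, goodOrders, Finset.coe_filter, Finset.mem_filter, Finset.mem_univ,
        true_and, Set.mem_ofPred_eq] at hπ ⊢
      have hfix : ∀ x ∈ S, ∀ c ∈ B x, (Equiv.swap b b') c = c := by
        intro x hx c hc
        have hd := Finset.disjoint_left.1 (hdisj x (Finset.mem_insert_of_mem hx) o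
          (Finset.mem_insert_self _ _) (by rintro rfl; exact ho hx)) hc
        exact Equiv.swap_apply_of_ne_of_ne (by rintro rfl; exact hd hb) (by rintro rfl; exact hd hb')
      refine ⟨fun x hx => ?_, fun c hc => ?_⟩
      · obtain ⟨a, ha, hmin⟩ := hπ.1 x hx
        refine ⟨a, ha, fun c hc => ?_⟩
        simp only [Equiv.symm_trans_apply, Equiv.symm_swap]
        rw [hfix x hx c hc, hfix x hx a (hAB x (Finset.mem_insert_of_mem hx) ha)]
        exact hmin c hc
      · simp only [Equiv.symm_trans_apply, Equiv.symm_swap, Equiv.swap_apply_right]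
        apply hπ.2
        rw [Equiv.swap_apply_def]
        split_ifs <;> assumption
    obtain ⟨a₀, ha₀⟩ := hne o (Finset.mem_insert_self _ _)
    have hsub := hAB o (Finset.mem_insert_self _ _)
    have hconst : ∀ b ∈ B o, (F b).card = (F a₀).card := fun b hb =>
      le_antisymm (hle b hb a₀ (hsub ha₀)) (hle a₀ (hsub ha₀) b hb)
    have hpd : ∀ T ⊆ B o, (T : Set W).PairwiseDisjoint F := by
      intro T hT b hb b' hb' hbb
      rw [Function.onFun, Finset.disjoint_left]
      intro π h1 h2
      have h3 := (Finset.mem_filter.1 h1).2 b' (hT hb')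
      have h4 := (Finset.mem_filter.1 h2).2 b (hT hb)
      exact hbb (π.symm.injective (le_antisymm h3 h4))
    have hEB : E = (B o).biUnion F := by
      ext π
      simp only [Finset.mem_biUnion, F, Finset.mem_filter]
      constructor
      · intro h
        obtain ⟨b, hb, hmin⟩ := Finset.exists_min_image (B o) π.symm ⟨a₀, hsub ha₀⟩
        exact ⟨b, hb, h, hmin⟩
      · rintro ⟨b, _, h, _⟩; exact h
    have hEA : goodOrders (N := N) A B (insert o S) = (A o).biUnion F := by
      ext π
      simp only [goodOrders, Finset.mem_biUnion, F, Finset.mem_filter, Finset.mem_univ, true_and,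
        hE, Finset.mem_insert, forall_eq_or_imp]
      constructor
      · rintro ⟨⟨a, ha, h1⟩, h2⟩
        exact ⟨a, ha, h2, h1⟩
      · rintro ⟨a, ha, h2, h1⟩
        exact ⟨⟨a, ha, h1⟩, h2⟩
    have h1 : E.card = (B o).card * (F a₀).card := by
      conv_lhs => rw [hEB, Finset.card_biUnion (hpd _ subset_rfl), Finset.sum_congr rfl hconst]
      simp
    have h2 : (goodOrders (N := N) A B (insert o S)).card = (A o).card * (F a₀).card := by
      rw [hEA, Finset.card_biUnion (hpd _ hsub),
        Finset.sum_congr rfl (fun b hb => hconst b (hsub hb))]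
      simp
    rw [Finset.prod_insert ho, Finset.prod_insert ho, h2]
    calc _ = (A o).card * (E.card * ∏ x ∈ S, (B x).card) := by rw [h1]; ring
      _ = _ := by rw [ih]; ring

end Orders

/-! ## Averaging over the radius -/

section Averaging

/-- If the numbers `b t` grow from `b a` to at most `q * b a`, then the mean of the product of the
ratios `b t / b (t + 1)` is at least `q ^ (- #S / L)`. -/
theorem sum_prod_ratio_ge {ι : Type*} (S : Finset ι) (b : ι → ℕ → ℝ) (a L : ℕ) (hL : 0 < L)
    (hb : ∀ o ∈ S, ∀ t, 0 < b o t) {q : ℝ}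
    (hgrow : ∀ o ∈ S, Real.log (b o (a + L)) - Real.log (b o a) ≤ q) :
    L * Real.exp (-(S.card * q / L)) ≤
      ∑ t ∈ Finset.range L, ∏ o ∈ S, (b o (a + t) / b o (a + t + 1)) := by
  set x : ℕ → ℝ := fun t => ∑ o ∈ S, (Real.log (b o (a + t)) - Real.log (b o (a + t + 1))) with hx
  have hprod : ∀ t, ∏ o ∈ S, (b o (a + t) / b o (a + t + 1)) = Real.exp (x t) := by
    intro t
    rw [hx, Real.exp_sum]
    refine Finset.prod_congr rfl fun o ho => ?_
    rw [Real.exp_sub, Real.exp_log (hb o ho _), Real.exp_log (hb o ho _)]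
  -- For each `o` the logarithms telescope over the radii.
  have hsum : -(S.card * q) ≤ ∑ t ∈ Finset.range L, x t := by
    rw [hx, Finset.sum_comm]
    have : ∀ o ∈ S, -q ≤ ∑ t ∈ Finset.range L,
        (Real.log (b o (a + t)) - Real.log (b o (a + t + 1))) := by
      intro o ho
      have := Finset.sum_range_sub' (fun t => Real.log (b o (a + t))) L
      simp only [← add_assoc, add_zero] at this
      rw [this]
      linarith [hgrow o ho]
    calc -(S.card * q) = ∑ _o ∈ S, -q := by simp
      _ ≤ _ := Finset.sum_le_sum this
  have hLpos : (0 : ℝ) < L := by exact_mod_cast hL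
  set y := -(S.card * q / L) with hy
  have hyL : L * y ≤ ∑ t ∈ Finset.range L, x t := by
    have : (L : ℝ) * y = -(S.card * q) := by rw [hy]; field_simp
    linarith
  -- Jensen's inequality by the tangent of `exp` at `y`: `exp x ≥ exp y * (x - y + 1)`, summed over
  -- `t`, where `y` is a lower bound for the mean of the exponents.
  calc L * Real.exp y ≤ Real.exp y * (L + ∑ t ∈ Finset.range L, x t - L * y) := by
        have := Real.exp_pos y
        nlinarith
    _ = ∑ t ∈ Finset.range L, Real.exp y * (x t - y + 1) := by
        rw [← Finset.mul_sum, Finset.sum_add_distrib, Finset.sum_sub_distrib]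
        simp only [Finset.sum_const, Finset.card_range, nsmul_eq_mul, mul_one]
        ring
    _ ≤ ∑ t ∈ Finset.range L, Real.exp (x t) := by
        refine Finset.sum_le_sum fun t _ => ?_
        calc _ ≤ Real.exp y * Real.exp (x t - y) := by
              gcongr; exact Real.add_one_le_exp _
          _ = _ := by rw [← Real.exp_add]; congr 1; ring
    _ = _ := Finset.sum_congr rfl fun t _ => (hprod t).symm

end Averaging

/-! ## The parameters -/

section Parameters

variable {m : ℕ}

theorem log_pos_of_two_le (hm : 2 ≤ m) : 0 < Real.log m :=
  Real.log_pos (by exact_mod_cast hm)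

theorem alpha_pos (hm : 2 ≤ m) : 0 < alpha m := by
  have := log_pos_of_two_le hm
  unfold alpha
  positivity

theorem mul_alpha (hm : 2 ≤ m) : m * alpha m = Real.sqrt (Real.log m) := by
  unfold alpha
  field_simp

/-- By `log m ≤ m - 1 ≤ m² / 4`. It makes the set of radii non-empty and keeps graph neighbors
closer than `γ / 2`. -/
theorem two_mul_alpha_le_one (hm : 2 ≤ m) : 2 * alpha m ≤ 1 := by
  have hm' : (2 : ℝ) ≤ m := by exact_mod_cast hm
  have h : Real.sqrt (Real.log m) ≤ m / 2 := by
    rw [Real.sqrt_le_left (by positivity)]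
    have := Real.log_le_sub_one_of_pos (by positivity : (0 : ℝ) < m)
    nlinarith [sq_nonneg ((m : ℝ) - 2)]
  unfold alpha
  rw [← mul_div_assoc, div_le_one (by positivity)]
  linarith

theorem one_le_radiusMin (m : ℕ) : 1 ≤ radiusMin m := le_max_right _ _

theorem one_le_radiusMax (hm : 2 ≤ m) : 1 ≤ radiusMax m := by
  unfold radiusMax
  rw [Nat.one_le_floor_iff, one_le_div (by have := alpha_pos hm; positivity)]
  exact two_mul_alpha_le_one hm

theorem radiusMin_le_radiusMax (hm : 2 ≤ m) : radiusMin m ≤ radiusMax m := by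
  have := alpha_pos hm
  refine max_le (Nat.floor_le_floor ?_) (one_le_radiusMax hm)
  gcongr
  norm_num

theorem radiusMax_mul_alpha_le (hm : 2 ≤ m) : 2 * radiusMax m * alpha m ≤ 1 := by
  have h := alpha_pos hm
  have : (radiusMax m : ℝ) ≤ 1 / (2 * alpha m) := Nat.floor_le (by positivity)
  rw [le_div_iff₀ (by positivity)] at this
  linarith

/-- By `√(log m) ≥ √(log 2) ≥ 1 / 2`. The program may therefore find both radii by scanning `1, …,
m`. -/
theorem radiusMax_le (hm : 2 ≤ m) : radiusMax m ≤ m := by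
  have h1 : (radiusMax m : ℝ) * (2 * alpha m) ≤ 1 := by linarith [radiusMax_mul_alpha_le hm]
  have h2 : 1 ≤ m * (2 * alpha m) := by
    have h3 : (1 / 2 : ℝ) ≤ Real.sqrt (Real.log m) := by
      apply Real.le_sqrt_of_sq_le
      have := Real.log_two_gt_d9
      have : Real.log 2 ≤ Real.log m := Real.log_le_log (by norm_num) (by exact_mod_cast hm)
      norm_num
      linarith
    linarith [mul_alpha hm]
  have h3 := alpha_pos hm
  exact_mod_cast le_of_mul_le_mul_right (h1.trans h2) (by positivity)

/-- The number of possible radii is at least `1 / (4 α)`. -/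
theorem inv_le_number_of_radii (hm : 2 ≤ m) :
    1 / (4 * alpha m) ≤ (radiusMax m - radiusMin m + 1 : ℕ) := by
  have h := alpha_pos hm
  rw [Nat.cast_add, Nat.cast_sub (radiusMin_le_radiusMax hm), Nat.cast_one]
  have h1 : 1 / (2 * alpha m) < radiusMax m + 1 := Nat.lt_floor_add_one _
  have h2 : 1 / (2 * alpha m) = 1 / (4 * alpha m) + 1 / (4 * alpha m) := by
    field_simp; norm_num
  -- Let `x = 1 / (4 α)`. If `x ≤ 1`, then `Δ₁ = 1` and already one radius is enough. Otherwise `Δ₁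
  -- ≤ x` and `Δ₂ + 1 > 2 x`.
  rcases le_total (1 / (4 * alpha m)) 1 with h3 | h3
  · have h4 : radiusMin m = 1 := by
      refine max_eq_right ?_
      exact_mod_cast (Nat.floor_le (by positivity)).trans h3
    have : (1 : ℝ) ≤ radiusMax m := by exact_mod_cast one_le_radiusMax hm
    rw [h4]
    push_cast
    linarith
  · have h4 : (radiusMin m : ℝ) ≤ 1 / (4 * alpha m) := by
      have : radiusMin m = ⌊1 / (4 * alpha m)⌋₊ := max_eq_left (Nat.one_le_floor_iff _ |>.2 h3)
      rw [this]
      exact Nat.floor_le (by positivity)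
    linarith

/-- With `x = 1 / (4 α)`: the maximum with `1` compensates the rounding, since `2 Δ₁ ≥ ⌊x⌋ + 1 > x`.
-/
theorem inv_le_radiusMin (hm : 2 ≤ m) : 1 / (8 * alpha m) ≤ radiusMin m := by
  have h := alpha_pos hm
  have h1 : 1 / (4 * alpha m) < ⌊1 / (4 * alpha m)⌋₊ + 1 := Nat.lt_floor_add_one _
  have h2 : (⌊1 / (4 * alpha m)⌋₊ : ℝ) ≤ radiusMin m := by exact_mod_cast le_max_left _ _
  have h3 : (1 : ℝ) ≤ radiusMin m := by exact_mod_cast one_le_radiusMin m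
  have h4 : 1 / (8 * alpha m) = (1 / (4 * alpha m)) / 2 := by field_simp; norm_num
  linarith

/-- The source of the constant `128`. The tangent of the logarithm at `s = 8` gives `log (8 s) ≤ 4 +
s / 8`, and `s² + 128 - 4 s (4 + s / 8) = (s - 16)² / 2`. -/
theorem four_mul_log_le {s : ℝ} (hs : 0 < s) : 4 * s * Real.log (8 * s) ≤ s ^ 2 + 128 := by
  have h1 : Real.log (8 * s) = 6 * Real.log 2 + Real.log (s / 8) := by
    rw [show 8 * s = 2 ^ 6 * (s / 8) by ring, Real.log_mul (by norm_num) (by positivity),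
      Real.log_pow]
    norm_num
  have h2 := Real.log_le_sub_one_of_pos (by positivity : 0 < s / 8)
  have h3 := Real.log_two_lt_d9
  have h4 : Real.log (8 * s) ≤ 4 + s / 8 := by rw [h1]; linarith
  nlinarith [sq_nonneg (s - 16)]

end Parameters

/-! ## The success probability of one decomposition -/

section Success

variable {V : Type*} [MetricSpace V] {m : ℕ} {U : Finset V} {color : V → Fin m} {γ : ℝ}

/-- The ball stays within distance `γ / 2` of its center, so two of its points are at most `γ < 2 γ`
apart and have different colors. -/
theorem card_graphBall_le (hm : 2 ≤ m) (hγ : 0 < γ)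
    (hU : ∀ x ∈ U, ∀ y ∈ U, x ≠ y → color x = color y → 2 * γ ≤ dist x y) (u : {x // x ∈ U}) :
    (graphBall (nearGraph U (γ * alpha m)) u (radiusMax m)).card ≤ m := by
  have h := alpha_pos hm
  have hd : ∀ x ∈ graphBall (nearGraph U (γ * alpha m)) u (radiusMax m),
      dist (u : V) x ≤ γ / 2 := by
    intro x hx
    by_cases hux : u = x
    · subst hux; simp; positivity
    · refine (nearGraph_dist_lt (by positivity) (mem_graphBall.1 hx) hux).le.trans ?_
      nlinarith [radiusMax_mul_alpha_le hm]
  calc _ ≤ (Finset.univ : Finset (Fin m)).card := by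
        refine Finset.card_le_card_of_injOn (fun x => color (x : V)) (by simp) ?_
        intro x hx y hy hxy
        by_contra hne
        have h1 := hU x x.2 y y.2 (fun h => hne (Subtype.ext h)) hxy
        have h2 := dist_triangle_left (x : V) y u
        have h3 := hd x hx
        have h4 := hd y hy
        linarith
    _ = m := by simp

/-- A lower bound for the success probability, times the number of colors. -/
def successConstant : ℝ := Real.exp (-128)

/-- The clusters in `D` contain the points `g o`, `o ∈ O`, and no two of them are in the same
cluster. -/
def Captures {N : ℕ} (O : Finset V) (g : V → V) (D : Fin N → Finset V) : Prop :=
  ∃ i : V → Fin N, (∀ x ∈ O, ∀ y ∈ O, i x = i y → x = y) ∧ ∀ o ∈ O, g o ∈ D (i o)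

/-- Let `a` be the first point of the `(R + 1)`-ball around `p o`. No earlier center reaches `p o`,
so `p o` belongs to the cluster of `a`, and as `a` lies in the `R`-ball, `p o` is not on the
discarded boundary. Disjointness of the balls makes these centers different. -/
theorem captures_of_mem_goodOrders [DecidableEq {x // x ∈ U}]
    [Fintype (Fin U.card ≃ {x // x ∈ U})] {r : ℝ} {R : ℕ} {O : Finset V}
    {p : V → {x // x ∈ U}}
    (hdisj : ∀ x ∈ O, ∀ y ∈ O, x ≠ y → Disjoint (graphBall (nearGraph U r) (p x) (R + 1))
      (graphBall (nearGraph U r) (p y) (R + 1)))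
    {π : Fin U.card ≃ {x // x ∈ U}}
    (hπ : π ∈ goodOrders (fun o => graphBall (nearGraph U r) (p o) R)
      (fun o => graphBall (nearGraph U r) (p o) (R + 1)) O) :
    Captures O (fun o => (p o : V)) (cluster U r π (R + 1)) := by
  simp only [goodOrders, Finset.mem_filter, Finset.mem_univ, true_and] at hπ
  have : ∀ o : V, ∃ a, o ∈ O → a ∈ graphBall (nearGraph U r) (p o) R ∧
      ∀ b ∈ graphBall (nearGraph U r) (p o) (R + 1), π.symm a ≤ π.symm b := by
    intro o
    by_cases ho : o ∈ O
    · obtain ⟨a, ha⟩ := hπ o ho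
      exact ⟨a, fun _ => ha⟩
    · exact ⟨p o, fun h => absurd h ho⟩
  choose a ha using this
  refine ⟨fun o => π.symm (a o), fun x hx y hy hxy => ?_, fun o ho => ?_⟩
  · by_contra hne
    have hxy : a x = a y := π.symm.injective hxy
    refine Finset.disjoint_left.1 (hdisj x hx y hy hne)
      (graphBall_mono _ (Nat.le_succ R) (ha x hx).1) ?_
    rw [hxy]
    exact graphBall_mono _ (Nat.le_succ R) (ha y hy).1
  · have h1 : (nearGraph U r).edist (a o) (p o) ≤ R := by
      rw [SimpleGraph.edist_comm]; exact mem_graphBall.1 (ha o ho).1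
    refine mem_cluster.2 ⟨(p o).2, ⟨?_, fun i hi hc => ?_⟩, ?_⟩
    · simpa using h1.trans (by exact_mod_cast Nat.le_succ R)
    · have h2 := (ha o ho).2 (π i) (mem_graphBall.2 (by rw [SimpleGraph.edist_comm]; exact hc))
      rw [Equiv.symm_apply_apply] at h2
      exact absurd h2 (not_le.2 hi)
    · simpa using h1.trans_lt (by exact_mod_cast Nat.lt_succ_self R)

/-- For a fixed radius the probability is at least the product of the ratios of ball sizes, by
counting orders; the mean of these products over the radii is then bounded below through the
logarithmic growth of the balls. -/
theorem decompose_captures (hm : 2 ≤ m) (hγ : 0 < γ)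
    (hU : ∀ x ∈ U, ∀ y ∈ U, x ≠ y → color x = color y → 2 * γ ≤ dist x y)
    {O : Finset V} (hne : O.Nonempty) (hO : O.card ≤ m) {g : V → V} (hg : ∀ o ∈ O, g o ∈ U)
    (hsep : ∀ x ∈ O, ∀ y ∈ O, x ≠ y → γ ≤ dist (g x) (g y)) :
    ENNReal.ofReal (successConstant / m) ≤
      (decompose m U γ).toOuterMeasure {D | Captures O g D} := by
  classical
  have hα := alpha_pos hm
  have hm0 : (0 : ℝ) < m := by positivity
  obtain ⟨o₀, ho₀⟩ := hne
  set G := nearGraph U (γ * alpha m) with hG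
  -- Outside `O` the value is irrelevant; some point of `U` is taken.
  let p : V → {x // x ∈ U} := fun o => if h : o ∈ O then ⟨g o, hg o h⟩ else ⟨g o₀, hg o₀ ho₀⟩
  have hp : ∀ o ∈ O, (p o : V) = g o := fun o ho => by simp [p, ho]
  -- The radii are `a + t + 1` with `t < L`, so the ratios of consecutive balls telescope from
  -- radius `Δ₁ - 1` to `Δ₂`.
  set a := radiusMin m - 1 with ha
  set L := radiusMax m - radiusMin m + 1 with hL
  have haL : a + L = radiusMax m := by
    have := one_le_radiusMin m
    have := radiusMin_le_radiusMax hm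
    omega
  have hdisj : ∀ t < L, ∀ x ∈ O, ∀ y ∈ O, x ≠ y →
      Disjoint (graphBall G (p x) (a + t + 1)) (graphBall G (p y) (a + t + 1)) := by
    intro t ht x hx y hy hxy
    rw [Finset.disjoint_left]
    intro v hvx hvy
    have h1 : G.edist (p x) (p y) ≤ (2 * radiusMax m : ℕ) := by
      have h2 := mem_graphBall.1 (graphBall_mono _ (by omega : a + t + 1 ≤ radiusMax m) hvx)
      have h3 := mem_graphBall.1 (graphBall_mono _ (by omega : a + t + 1 ≤ radiusMax m) hvy)
      rw [SimpleGraph.edist_comm] at h3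
      refine SimpleGraph.edist_triangle.trans ((add_le_add h2 h3).trans ?_)
      rw [two_mul]
      exact_mod_cast le_rfl
    have hd := hsep x hx y hy hxy
    have h2 : p x ≠ p y := by
      intro h
      rw [← hp x hx, ← hp y hy, h, dist_self] at hd
      linarith
    have h3 := nearGraph_dist_lt (by positivity) h1 h2
    rw [hp x hx, hp y hy] at h3
    push_cast at h3
    nlinarith [radiusMax_mul_alpha_le hm]
  -- the expected product of the ratios of the sizes of the balls
  have hb : ∀ o t, (0 : ℝ) < (graphBall G (p o) t).card := fun o t =>
    Nat.cast_pos.2 (Finset.card_pos.2 ⟨_, self_mem_graphBall _ _⟩)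
  have hs : 0 < Real.sqrt (Real.log m) := Real.sqrt_pos.2 (log_pos_of_two_le hm)
  have hgrow : ∀ o ∈ O, Real.log (graphBall G (p o) (a + L)).card -
      Real.log (graphBall G (p o) a).card ≤ Real.log (8 * Real.sqrt (Real.log m)) := by
    intro o ho
    have hmin := inv_le_radiusMin hm
    have hmin' : (1 : ℝ) ≤ radiusMin m := by exact_mod_cast one_le_radiusMin m
    have h8 : (m : ℝ) / radiusMin m ≤ 8 * Real.sqrt (Real.log m) := by
      rw [← mul_alpha hm, div_le_iff₀ (by positivity)]
      rw [div_le_iff₀ (by positivity)] at hmin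
      nlinarith
    have hmm : (radiusMin m : ℝ) ≤ m := by
      exact_mod_cast (radiusMin_le_radiusMax hm).trans (radiusMax_le hm)
    have h1m : 1 ≤ (m : ℝ) / radiusMin m := by
      rwa [one_le_div (by positivity)]
    -- Either the smallest ball has at least `Δ₁` points and the growth is at most `m / Δ₁ ≤ 8 m α =
    -- 8 s`, or it is a whole component and does not grow at all.
    rcases lt_card_graphBall_or (G := G) (p o) a with h | h
    · have h1 : (radiusMin m : ℝ) ≤ (graphBall G (p o) a).card := by
        have := one_le_radiusMin m
        exact_mod_cast (by omega : radiusMin m ≤ (graphBall G (p o) a).card)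
      have h2 : ((graphBall G (p o) (a + L)).card : ℝ) ≤ m := by
        rw [haL]
        exact_mod_cast card_graphBall_le hm hγ hU (p o)
      rw [← Real.log_div (hb _ _).ne' (hb _ _).ne']
      refine Real.log_le_log (div_pos (hb _ _) (hb _ _)) (le_trans ?_ h8)
      have := hb o (a + L)
      gcongr
    · rw [h (a + L) (by omega), sub_self]
      exact Real.log_nonneg (h1m.trans h8)
  have hmean := sum_prod_ratio_ge O (fun o t => ((graphBall G (p o) t).card : ℝ)) a L (by omega)
    (fun o _ t => hb o t) hgrow
  have hLpos : (0 : ℝ) < L := by exact_mod_cast (by omega : 0 < L)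
  have hexp : successConstant / m ≤
      Real.exp (-(O.card * Real.log (8 * Real.sqrt (Real.log m)) / L)) := by
    set s := Real.sqrt (Real.log m) with hs'
    have hlog : 0 ≤ Real.log (8 * s) := by
      have := hgrow o₀ ho₀
      refine le_trans ?_ this
      rw [sub_nonneg]
      exact Real.log_le_log (hb _ _)
        (Nat.cast_le.2 (Finset.card_le_card (graphBall_mono _ (by omega))))
    -- From `|O| ≤ m = s / α` and `L ≥ 1 / (4 α)`.
    have h1 : O.card * Real.log (8 * s) / L ≤ 4 * s * Real.log (8 * s) := by
      rw [div_le_iff₀ hLpos]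
      have h2 := inv_le_number_of_radii hm
      rw [div_le_iff₀ (by positivity)] at h2
      have h3 : (O.card : ℝ) ≤ m := by exact_mod_cast hO
      have h4 : (m : ℝ) ≤ 4 * s * L := by
        rw [hs', ← mul_alpha hm]
        nlinarith
      nlinarith
    have h2 := four_mul_log_le hs
    rw [Real.sq_sqrt (log_pos_of_two_le hm).le] at h2
    calc successConstant / m = Real.exp (-(Real.log m + 128)) := by
          rw [successConstant, neg_add, Real.exp_add, Real.exp_neg (Real.log m),
            Real.exp_log hm0]
          ring
      _ ≤ _ := Real.exp_le_exp.2 (by linarith)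
  -- the probability for a fixed radius
  have : Nonempty (Fin U.card ≃ {x // x ∈ U}) := ⟨U.equivFin.symm⟩
  let _ : Fintype (Fin U.card ≃ {x // x ∈ U}) := Fintype.ofFinite _
  have hfix : ∀ t < L, ENNReal.ofReal (∏ o ∈ O, (((graphBall G (p o) (a + t)).card : ℝ) /
      (graphBall G (p o) (a + t + 1)).card)) ≤
      (randomOrder U).toOuterMeasure
        {π | Captures O g (cluster U (γ * alpha m) π (radiusMin m + t))} := by
    intro t ht
    have hcount := card_goodOrders_mul (N := U.card) (S := O)
      (A := fun o => graphBall G (p o) (a + t)) (B := fun o => graphBall G (p o) (a + t + 1))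
      (fun o _ => graphBall_mono _ (Nat.le_succ _)) (fun o _ => ⟨_, self_mem_graphBall _ _⟩)
      (hdisj t ht)
    set E := goodOrders (N := U.card) (fun o => graphBall G (p o) (a + t))
      (fun o => graphBall G (p o) (a + t + 1)) O with hE
    have hsub : (E : Set (Fin U.card ≃ {x // x ∈ U})) ⊆
        {π | Captures O g (cluster U (γ * alpha m) π (radiusMin m + t))} := by
      intro π hπ
      have hR : radiusMin m + t = a + t + 1 := by have := one_le_radiusMin m; omega
      obtain ⟨i, hi, hmem⟩ := captures_of_mem_goodOrders (hdisj t ht) hπ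
      refine ⟨i, hi, fun o ho => ?_⟩
      rw [hR, ← hp o ho]
      exact hmem o ho
    refine le_trans ?_ (MeasureTheory.measure_mono hsub)
    have hcard : (0 : ℝ) < Fintype.card (Fin U.card ≃ {x // x ∈ U}) := by
      exact_mod_cast Fintype.card_pos
    have hval : ∏ o ∈ O, (((graphBall G (p o) (a + t)).card : ℝ) /
        (graphBall G (p o) (a + t + 1)).card) =
        E.card / Fintype.card (Fin U.card ≃ {x // x ∈ U}) := by
      rw [Finset.prod_div_distrib, div_eq_div_iff
        (Finset.prod_pos fun o _ => hb o _).ne' hcard.ne', mul_comm]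
      exact_mod_cast hcount.symm
    rw [hval, PMF.toOuterMeasure_apply_finset]
    have : ∀ π ∈ E, randomOrder U π =
        ((Fintype.card (Fin U.card ≃ {x // x ∈ U}) : ℕ) : ENNReal)⁻¹ := fun π _ =>
      PMF.uniformOfFintype_apply _
    rw [Finset.sum_congr rfl this, Finset.sum_const, nsmul_eq_mul,
      ENNReal.ofReal_div_of_pos hcard, ENNReal.ofReal_natCast, ENNReal.ofReal_natCast]
    rfl
  -- the average over the radius
  have hdec : decompose m U γ = (randomRadius m).bind fun R =>
      (randomOrder U).map fun π => cluster U (γ * alpha m) π R := by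
    unfold decompose PMF.map
    rw [PMF.bind_comm]
    rfl
  have hI : (Finset.Icc (radiusMin m) (radiusMax m)).Nonempty :=
    Finset.nonempty_Icc.2 (radiusMin_le_radiusMax hm)
  rw [hdec, PMF.toOuterMeasure_bind_apply]
  have hrad : ∀ R ∈ Finset.Icc (radiusMin m) (radiusMax m),
      randomRadius m R = ENNReal.ofReal (1 / L) := by
    intro R hR
    rw [randomRadius, dif_pos hI, PMF.uniformOfFinset_apply_of_mem _ hR, Nat.card_Icc,
      ENNReal.ofReal_div_of_pos hLpos, ENNReal.ofReal_one, ENNReal.ofReal_natCast, one_div]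
    congr 2
    have := radiusMin_le_radiusMax hm
    omega
  have himage : (Finset.range L).image (radiusMin m + ·) =
      Finset.Icc (radiusMin m) (radiusMax m) := by
    ext R
    simp only [Finset.mem_image, Finset.mem_range, Finset.mem_Icc]
    have := radiusMin_le_radiusMax hm
    constructor
    · rintro ⟨t, ht, rfl⟩; omega
    · intro h; exact ⟨R - radiusMin m, by omega, by omega⟩
  calc ENNReal.ofReal (successConstant / m)
      ≤ ENNReal.ofReal (1 / L * ∑ t ∈ Finset.range L, ∏ o ∈ O,
          (((graphBall G (p o) (a + t)).card : ℝ) / (graphBall G (p o) (a + t + 1)).card)) := by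
        refine ENNReal.ofReal_le_ofReal (hexp.trans ?_)
        rw [one_div, inv_mul_eq_div, le_div_iff₀ hLpos, mul_comm]
        exact hmean
    _ = ∑ t ∈ Finset.range L, ENNReal.ofReal (1 / L) * ENNReal.ofReal (∏ o ∈ O,
          (((graphBall G (p o) (a + t)).card : ℝ) / (graphBall G (p o) (a + t + 1)).card)) := by
        rw [ENNReal.ofReal_mul (by positivity), ENNReal.ofReal_sum_of_nonneg, Finset.mul_sum]
        exact fun t _ => Finset.prod_nonneg fun o _ => div_nonneg (hb _ _).le (hb _ _).le
    _ ≤ ∑ t ∈ Finset.range L, randomRadius m (radiusMin m + t) *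
          ((randomOrder U).map fun π => cluster U (γ * alpha m) π (radiusMin m + t)).toOuterMeasure
            {D | Captures O g D} := by
        refine Finset.sum_le_sum fun t ht => ?_
        rw [hrad _ (by rw [← himage]; exact Finset.mem_image_of_mem _ ht),
          PMF.toOuterMeasure_map_apply]
        gcongr
        exact hfix t (Finset.mem_range.1 ht)
    _ = ∑ R ∈ Finset.Icc (radiusMin m) (radiusMax m), randomRadius m R *
          ((randomOrder U).map fun π => cluster U (γ * alpha m) π R).toOuterMeasure
            {D | Captures O g D} := by
        rw [← himage, Finset.sum_image fun x _ y _ h => Nat.add_left_cancel h]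
    _ ≤ _ := ENNReal.sum_le_tsum _

end Success

/-! ## Flows in the assignment network -/

section Flows

variable {V : Type*} [Fintype V] {m N : ℕ}

theorem Node.sum_eq {M : Type*} [AddCommMonoid M] (g : Node N m → M) :
    ∑ b, g b = g .source + ((∑ i, g (.clus i)) + ((∑ j, g (.col j)) + (g .slack + g .sink))) := by
  let e : Node N m ≃ Unit ⊕ (Fin N ⊕ (Fin m ⊕ (Unit ⊕ Unit))) :=
    { toFun := fun
        | .source => .inl ()
        | .clus i => .inr (.inl i)
        | .col j => .inr (.inr (.inl j))
        | .slack => .inr (.inr (.inr (.inl ())))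
        | .sink => .inr (.inr (.inr (.inr ())))
      invFun := fun
        | .inl () => .source
        | .inr (.inl i) => .clus i
        | .inr (.inr (.inl j)) => .col j
        | .inr (.inr (.inr (.inl ()))) => .slack
        | .inr (.inr (.inr (.inr ()))) => .sink
      left_inv := by rintro (_ | _ | _ | _ | _) <;> rfl
      right_inv := by rintro (_ | _ | _ | _ | _) <;> rfl }
  rw [← e.symm.sum_comp]
  simp only [Fintype.sum_sum_type, Finset.univ_unique, Finset.sum_singleton]
  rfl

variable {color : V → Fin m} {ℓ u : Fin m → ℕ} {k : ℕ} {D : Fin N → Finset V}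
  {f : Node N m → Node N m → ℕ}

/-- The conservation laws and the capacity bounds of a flow, arc by arc. -/
structure FlowFacts (color : V → Fin m) (ℓ u : Fin m → ℕ) (k : ℕ) (D : Fin N → Finset V)
    (f : Node N m → Node N m → ℕ) : Prop where
  source_le : ∀ i, f .source (.clus i) ≤ 1
  clus_le : ∀ i j, f (.clus i) (.col j) ≤ 1
  exists_of_pos : ∀ i j, 0 < f (.clus i) (.col j) → ∃ v ∈ D i, color v = j
  sink_le : ∀ j, f (.col j) .sink ≤ ℓ j
  slack_le : ∀ j, f (.col j) .slack ≤ u j - ℓ j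
  slack_sink_le : f .slack .sink ≤ k - ∑ j, ℓ j
  clus_eq : ∀ i, ∑ j, f (.clus i) (.col j) = f .source (.clus i)
  col_eq : ∀ j, ∑ i, f (.clus i) (.col j) = f (.col j) .sink + f (.col j) .slack
  slack_eq : ∑ j, f (.col j) .slack = f .slack .sink
  value_eq : flowValue .source f = ((∑ i, f .source (.clus i) : ℕ) : ℤ)

/-- A flow vanishes wherever the capacity is zero, so the conservation sums over all nodes collapse
to the arcs of the network. -/
theorem IsFlow.facts (h : IsFlow (capacity color ℓ u k D) .source .sink f) :
    FlowFacts color ℓ u k D f := by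
  obtain ⟨hcap, hcons⟩ := h
  have hzero : ∀ a b, capacity color ℓ u k D a b = 0 → f a b = 0 := fun a b hab =>
    Nat.le_zero.1 (hab ▸ hcap a b)
  have z1 : ∀ a, f a .source = 0 := by rintro (_ | _ | _ | _ | _) <;> exact hzero _ _ rfl
  have z2 : ∀ b, f .sink b = 0 := by rintro (_ | _ | _ | _ | _) <;> exact hzero _ _ rfl
  have z3 : ∀ j, f .source (.col j) = 0 := fun _ => hzero _ _ rfl
  have z4 : f .source .slack = 0 := hzero _ _ rfl
  have z5 : f .source .sink = 0 := hzero _ _ rfl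
  have z6 : ∀ i i', f (.clus i) (.clus i') = 0 := fun _ _ => hzero _ _ rfl
  have z7 : ∀ i, f (.clus i) .slack = 0 := fun _ => hzero _ _ rfl
  have z8 : ∀ i, f (.clus i) .sink = 0 := fun _ => hzero _ _ rfl
  have z9 : ∀ j i, f (.col j) (.clus i) = 0 := fun _ _ => hzero _ _ rfl
  have z10 : ∀ j j', f (.col j) (.col j') = 0 := fun _ _ => hzero _ _ rfl
  have z11 : ∀ i, f .slack (.clus i) = 0 := fun _ => hzero _ _ rfl
  have z12 : ∀ j, f .slack (.col j) = 0 := fun _ => hzero _ _ rfl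
  have z13 : f .slack .slack = 0 := hzero _ _ rfl
  refine ⟨fun i => hcap _ _, fun i j => (hcap _ _).trans ?_, fun i j hij => ?_, fun j => hcap _ _,
    fun j => hcap _ _, hcap _ _, fun i => ?_, fun j => ?_, ?_, ?_⟩
  · simp only [capacity]; split_ifs <;> simp
  · by_contra hc
    exact hij.ne' (hzero _ _ (by simp only [capacity, if_neg hc]))
  · have := hcons (.clus i) (by simp) (by simp)
    rw [Node.sum_eq, Node.sum_eq] at this
    simpa [z1, z2, z3, z4, z5, z6, z7, z8, z9, z10, z11, z12, z13] using this.symm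
  · have := hcons (.col j) (by simp) (by simp)
    rw [Node.sum_eq, Node.sum_eq] at this
    simpa [z1, z2, z3, z4, z5, z6, z7, z8, z9, z10, z11, z12, z13, add_comm] using this
  · have := hcons .slack (by simp) (by simp)
    rw [Node.sum_eq, Node.sum_eq] at this
    simpa [z1, z2, z3, z4, z5, z6, z7, z8, z9, z10, z11, z12, z13] using this
  · unfold flowValue
    rw [Node.sum_eq, Node.sum_eq]
    simp [z1, z3, z4, z5]

/-- The number of clusters that are assigned to the color `j`. -/
def selCount (sel : Fin N → Option (Fin m)) (j : Fin m) : ℕ :=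
  (Finset.univ.filter fun i => sel i = some j).card

/-- The flow that sends every cluster to the color that `sel` assigns to it. -/
def selFlow (ℓ : Fin m → ℕ) (sel : Fin N → Option (Fin m)) : Node N m → Node N m → ℕ
  | .source, .clus i => if (sel i).isSome then 1 else 0
  | .clus i, .col j => if sel i = some j then 1 else 0
  -- A color first uses its direct arc, up to the lower bound; only the surplus goes through the
  -- slack node.
  | .col j, .sink => min (selCount sel j) (ℓ j)
  | .col j, .slack => selCount sel j - ℓ j
  | .slack, .sink => ∑ j, (selCount sel j - ℓ j)
  | _, _ => 0

theorem sum_ite_some (o : Option (Fin m)) :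
    (∑ j, if o = some j then 1 else 0) = if o.isSome then 1 else 0 := by
  cases o <;> simp

theorem isFlow_selFlow {sel : Fin N → Option (Fin m)}
    (hsel : ∀ i j, sel i = some j → ∃ v ∈ D i, color v = j) (hu : ∀ j, selCount sel j ≤ u j)
    (hk : ∑ j, (selCount sel j - ℓ j) ≤ k - ∑ j, ℓ j) :
    IsFlow (capacity color ℓ u k D) .source .sink (selFlow ℓ sel) := by
  constructor
  · rintro (_ | i | j | _ | _) (_ | i' | j' | _ | _) <;>
      simp only [selFlow, capacity, le_refl]
    · split_ifs <;> simp
    · split_ifs with h1 h2 h2 <;> simp_all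
    · exact Nat.sub_le_sub_right (hu j) _
    · exact min_le_right _ _
    · exact hk
  · rintro (_ | i | j | _ | _) h1 h2
    · exact absurd rfl h1
    · rw [Node.sum_eq, Node.sum_eq]
      simp only [selFlow, Finset.sum_const_zero, add_zero, zero_add, sum_ite_some]
    · rw [Node.sum_eq, Node.sum_eq]
      simp only [selFlow, Finset.sum_const_zero, add_zero, zero_add]
      rw [← Finset.card_filter, ← selCount]
      omega
    · rw [Node.sum_eq, Node.sum_eq]
      simp only [selFlow, Finset.sum_const_zero, add_zero, zero_add]
    · exact absurd rfl h2

theorem sum_selCount (sel : Fin N → Option (Fin m)) (Y : Finset (Fin m)) :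
    ∑ j ∈ Y, selCount sel j = (Finset.univ.filter fun i => ∃ j ∈ Y, sel i = some j).card := by
  unfold selCount
  rw [← Finset.card_biUnion]
  · congr 1
    ext i
    simp
  · intro j _ j' _ hjj
    rw [Function.onFun, Finset.disjoint_left]
    intro i h1 h2
    simp only [Finset.mem_filter, Finset.mem_univ, true_and] at h1 h2
    exact hjj (Option.some.inj (h1.symm.trans h2))

theorem flowValue_selFlow (sel : Fin N → Option (Fin m)) :
    flowValue .source (selFlow ℓ sel) = ((∑ j, selCount sel j : ℕ) : ℤ) := by
  unfold flowValue
  rw [Node.sum_eq, Node.sum_eq, sum_selCount]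
  simp only [selFlow, Finset.sum_const_zero, add_zero, zero_add, Nat.cast_zero, sub_zero]
  rw [← Nat.cast_sum, ← Finset.card_filter]
  congr! 3 with i
  simp [Option.isSome_iff_exists]

/-- A selection is a maximum flow if there is a set `Y` of colors, closed under alternating paths
from unassigned clusters, in which all colors are used to the full, or in which all lower bounds
are met, with all the additional flow that is possible. -/
theorem isMaxFlow_selFlow {sel : Fin N → Option (Fin m)}
    (hsel : ∀ i j, sel i = some j → ∃ v ∈ D i, color v = j) (hlu : ∀ j, ℓ j ≤ u j)
    (hu : ∀ j, selCount sel j ≤ u j) (hk : ∑ j, (selCount sel j - ℓ j) ≤ k - ∑ j, ℓ j)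
    (Y : Finset (Fin m))
    (hY : ∀ i, ∀ v ∈ D i, (∀ j, sel i = some j → j ∈ Y) → color v ∈ Y)
    (hfull : (∀ j ∈ Y, u j ≤ selCount sel j) ∨
      ((∀ j ∈ Y, ℓ j ≤ selCount sel j) ∧ (∀ j ∉ Y, selCount sel j ≤ ℓ j) ∧
        k - ∑ j, ℓ j ≤ ∑ j, (selCount sel j - ℓ j))) :
    IsMaxFlow (capacity color ℓ u k D) .source .sink (selFlow ℓ sel) := by
  classical
  refine ⟨isFlow_selFlow hsel hu hk, fun g hg => ?_⟩
  have h := hg.facts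
  rw [flowValue_selFlow, h.value_eq, Nat.cast_le]
  -- Weak duality for the cut with the source, the clusters of `A` and the colors of `Y` on one
  -- side. Clusters outside `A` carry at most one unit each, and all of them are assigned to colors
  -- outside `Y`; clusters in `A` can only send flow into `Y`.
  set A : Finset (Fin N) := Finset.univ.filter fun i => ∀ j, sel i = some j → j ∈ Y with hA
  have h1 : ∑ i ∈ Aᶜ, g .source (.clus i) ≤ ∑ j ∈ Yᶜ, selCount sel j := by
    rw [sum_selCount]
    calc ∑ i ∈ Aᶜ, g .source (.clus i) ≤ ∑ i ∈ Aᶜ, 1 := Finset.sum_le_sum fun i _ => h.source_le i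
      _ = Aᶜ.card := by simp
      _ ≤ _ := by
        refine Finset.card_le_card fun i hi => ?_
        simp only [hA, Finset.mem_compl, Finset.mem_filter, Finset.mem_univ, true_and,
          not_forall] at hi ⊢
        obtain ⟨j, hj, hjY⟩ := hi
        exact ⟨j, hjY, hj⟩
  have h2 : ∑ i ∈ A, g .source (.clus i) ≤
      ∑ j ∈ Y, (g (.col j) .sink + g (.col j) .slack) := by
    calc ∑ i ∈ A, g .source (.clus i) = ∑ i ∈ A, ∑ j ∈ Y, g (.clus i) (.col j) := by
          refine Finset.sum_congr rfl fun i hi => ?_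
          rw [← h.clus_eq]
          refine (Finset.sum_subset (Finset.subset_univ Y) fun j _ hj => ?_).symm
          by_contra hne
          obtain ⟨v, hv, rfl⟩ := h.exists_of_pos i j (Nat.pos_of_ne_zero hne)
          exact hj (hY i v hv (Finset.mem_filter.1 hi).2)
      _ = ∑ j ∈ Y, ∑ i ∈ A, g (.clus i) (.col j) := Finset.sum_comm
      _ ≤ ∑ j ∈ Y, ∑ i, g (.clus i) (.col j) := Finset.sum_le_sum fun j _ =>
          Finset.sum_le_sum_of_subset (Finset.subset_univ A)
      _ = _ := Finset.sum_congr rfl fun j _ => h.col_eq j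
  -- In the first case the slack node lies beyond the cut and `Y` passes at most `u j` per color; in
  -- the second it lies on the near side and `Y` passes at most `ℓ j` per color plus the whole slack
  -- capacity.
  have h3 : ∑ j ∈ Y, (g (.col j) .sink + g (.col j) .slack) ≤ ∑ j ∈ Y, selCount sel j := by
    rcases hfull with hfull | ⟨hlow, hout, htot⟩
    · refine Finset.sum_le_sum fun j hj => ?_
      have := h.sink_le j
      have := h.slack_le j
      have := hfull j hj
      have := hlu j
      omega
    · rw [Finset.sum_add_distrib]
      calc _ ≤ ∑ j ∈ Y, ℓ j + ∑ j, g (.col j) .slack :=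
            add_le_add (Finset.sum_le_sum fun j _ => h.sink_le j)
              (Finset.sum_le_sum_of_subset (Finset.subset_univ Y))
        _ ≤ ∑ j ∈ Y, ℓ j + ∑ j, (selCount sel j - ℓ j) := by
            rw [h.slack_eq]
            exact Nat.add_le_add_left (h.slack_sink_le.trans htot) _
        _ = ∑ j ∈ Y, ℓ j + ∑ j ∈ Y, (selCount sel j - ℓ j) := by
            congr 1
            exact (Finset.sum_subset (Finset.subset_univ Y) fun j _ hj =>
              Nat.sub_eq_zero_of_le (hout j hj)).symm
        _ = _ := by
            rw [← Finset.sum_add_distrib]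
            exact Finset.sum_congr rfl fun j hj => Nat.add_sub_cancel' (hlow j hj)
  rw [← Finset.sum_add_sum_compl A, ← Finset.sum_add_sum_compl Y]
  omega

theorem exists_isMaxFlow {W : Type*} [Fintype W] (cap : W → W → ℕ) (s t : W) :
    ∃ f, IsMaxFlow cap s t f := by
  classical
  have hfin : {f : W → W → ℕ | IsFlow cap s t f}.Finite :=
    (Set.finite_Iic cap).subset fun f hf a b => hf.1 a b
  obtain ⟨f, hf, hmax⟩ := hfin.exists_maximalFor (flowValue s) _
    ⟨fun _ _ => 0, by simp [IsFlow]⟩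
  refine ⟨f, hf, fun g hg => ?_⟩
  rcases le_total (flowValue s g) (flowValue s f) with h | h
  · exact h
  · exact hmax hg h

theorem exists_isAssignment [Nonempty V] (color : V → Fin m) (ℓ u : Fin m → ℕ) (k : ℕ)
    (D : Fin N → Finset V) : ∃ S, IsAssignment color ℓ u k D S := by
  classical
  obtain ⟨f, hf⟩ := exists_isMaxFlow (capacity color ℓ u k D) .source .sink
  have : ∀ i j, ∃ v, 0 < f (.clus i) (.col j) → v ∈ D i ∧ color v = j := by
    intro i j
    by_cases hij : 0 < f (.clus i) (.col j)
    · obtain ⟨v, hv⟩ := hf.1.facts.exists_of_pos i j hij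
      exact ⟨v, fun _ => hv⟩
    · exact ⟨Classical.arbitrary V, fun h => absurd h hij⟩
  choose pick hpick using this
  exact ⟨_, f, hf, pick, hpick, rfl⟩

/-- The result of the assignment contains at most one point of every cluster. -/
theorem IsAssignment.exists_clusters {S : Finset V} (h : IsAssignment color ℓ u k D S) {x y : V}
    (hx : x ∈ S) (hy : y ∈ S) (hxy : x ≠ y) : ∃ i i', i ≠ i' ∧ x ∈ D i ∧ y ∈ D i' := by
  classical
  obtain ⟨f, hf, pick, hpick, rfl⟩ := h
  have h := hf.1.facts
  obtain ⟨i, j, hj, rfl⟩ := (Finset.mem_filter.1 hx).2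
  obtain ⟨i', j', hj', rfl⟩ := (Finset.mem_filter.1 hy).2
  refine ⟨i, i', ?_, (hpick _ _ hj).1, (hpick _ _ hj').1⟩
  rintro rfl
  have hne : j ≠ j' := by rintro rfl; exact hxy rfl
  have h1 := h.clus_eq i
  have h2 := h.source_le i
  have h3 : ∑ x ∈ {j, j'}, f (.clus i) (.col x) ≤ ∑ x, f (.clus i) (.col x) :=
    Finset.sum_le_sum_of_subset (Finset.subset_univ _)
  rw [Finset.sum_pair hne] at h3
  omega

/-- The colors of the result of the assignment, if the clusters are disjoint. -/
theorem card_colorClass_assignment (hD : ∀ i j, i ≠ j → Disjoint (D i) (D j))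
    (hf : FlowFacts color ℓ u k D f) {pick : Fin N → Fin m → V}
    (hpick : ∀ i j, 0 < f (.clus i) (.col j) → pick i j ∈ D i ∧ color (pick i j) = j)
    {S : Finset V} (hS : ∀ v, v ∈ S ↔ ∃ i j, 0 < f (.clus i) (.col j) ∧ v = pick i j)
    (j : Fin m) : (colorClass color S j).card = ∑ i, f (.clus i) (.col j) := by
  classical
  have h1 : colorClass color S j =
      (Finset.univ.filter fun i => 0 < f (.clus i) (.col j)).image fun i => pick i j := by
    ext v
    simp only [mem_colorClass, hS, Finset.mem_image, Finset.mem_filter, Finset.mem_univ, true_and]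
    constructor
    · rintro ⟨⟨i, j', hij, rfl⟩, rfl⟩
      refine ⟨i, ?_, ?_⟩ <;> rw [(hpick i j' hij).2]
      exact hij
    · rintro ⟨i, hij, rfl⟩
      exact ⟨⟨i, j, hij, rfl⟩, (hpick i j hij).2⟩
  rw [h1, Finset.card_image_of_injOn, Finset.card_filter]
  · refine Finset.sum_congr rfl fun i _ => ?_
    have := hf.clus_le i j
    split_ifs <;> omega
  · intro i hi i' hi' hii
    by_contra hne
    simp only [Finset.coe_filter, Finset.mem_univ, true_and, Set.mem_ofPred_eq] at hi hi'
    refine Finset.disjoint_left.1 (hD i i' hne) (hpick i j hi).1 ?_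
    simp only at hii
    rw [hii]
    exact (hpick i' j hi').1

theorem card_eq_sum_colorClass (color : V → Fin m) (S : Finset V) :
    S.card = ∑ j, (colorClass color S j).card := by
  classical
  exact Finset.card_eq_sum_card_fiberwise (f := color) (t := Finset.univ) (by simp)
      |>.trans (by simp only [colorClass])

/-- The result of the assignment is fair if and only if the flow has value `k`. -/
theorem fair_iff_flowValue_eq (hD : ∀ i j, i ≠ j → Disjoint (D i) (D j))
    (hlu : ∀ j, ℓ j ≤ u j) (hk : ∑ j, ℓ j ≤ k)
    (hf : IsFlow (capacity color ℓ u k D) .source .sink f) {pick : Fin N → Fin m → V}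
    (hpick : ∀ i j, 0 < f (.clus i) (.col j) → pick i j ∈ D i ∧ color (pick i j) = j)
    {S : Finset V} (hS : ∀ v, v ∈ S ↔ ∃ i j, 0 < f (.clus i) (.col j) ∧ v = pick i j) :
    Fair color ℓ u k S ↔ flowValue .source f = k := by
  have h := hf.facts
  have hcol := card_colorClass_assignment hD h hpick hS
  have htotal : S.card = ∑ i, f .source (.clus i) := by
    rw [card_eq_sum_colorClass color, Finset.sum_congr rfl fun j _ => hcol j, Finset.sum_comm]
    exact Finset.sum_congr rfl fun i _ => h.clus_eq i
  rw [h.value_eq, Nat.cast_inj, ← htotal, Fair]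
  refine ⟨fun hS => hS.1, fun hcard => ⟨hcard, fun j => ?_⟩⟩
  have hsum : ∑ j, f (.col j) .sink + f .slack .sink = k := by
    rw [← h.slack_eq, ← Finset.sum_add_distrib, ← hcard, card_eq_sum_colorClass color]
    exact Finset.sum_congr rfl fun j _ => by rw [hcol, h.col_eq]
  -- The arcs into the sink have total capacity `k`, so a flow of value `k` saturates them, in
  -- particular those of the lower bounds.
  have heq : ∑ j, f (.col j) .sink = ∑ j, ℓ j := by
    have h1 : ∑ j, f (.col j) .sink ≤ ∑ j, ℓ j := Finset.sum_le_sum fun j _ => h.sink_le j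
    have h2 := h.slack_sink_le
    omega
  have h1 := (Finset.sum_eq_sum_iff_of_le fun j _ => h.sink_le j).1 heq j (Finset.mem_univ j)
  rw [hcol, h.col_eq, h1]
  have h2 := h.slack_le j
  have h3 := hlu j
  constructor <;> omega

theorem Fair.lower_le_upper {O : Finset V} (hO : Fair color ℓ u k O) (j : Fin m) : ℓ j ≤ u j :=
  (hO.2 j).1.trans (hO.2 j).2

theorem Fair.sum_lower_le {O : Finset V} (hO : Fair color ℓ u k O) : ∑ j, ℓ j ≤ k := by
  rw [← hO.1, card_eq_sum_colorClass color]
  exact Finset.sum_le_sum fun j _ => (hO.2 j).1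

/-- If the clusters contain, in different clusters, points with the colors of a fair set, then the
result of the assignment is fair. -/
theorem IsAssignment.fair {S O : Finset V} (h : IsAssignment color ℓ u k D S)
    (hD : ∀ i j, i ≠ j → Disjoint (D i) (D j)) (hO : Fair color ℓ u k O) {g : V → V}
    (hg : ∀ o ∈ O, color (g o) = color o) (hcap : Captures O g D) : Fair color ℓ u k S := by
  classical
  obtain ⟨f, hf, pick, hpick, rfl⟩ := h
  have hlu := hO.lower_le_upper
  have hk := hO.sum_lower_le
  rw [fair_iff_flowValue_eq hD hlu hk hf.1 hpick (by simp)]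
  obtain ⟨i, hi, hmem⟩ := hcap
  -- The cluster that captures `g o` is assigned to the color of `o`; the choice of `o` is unique as
  -- `i` is injective on `O`.
  let sel : Fin N → Option (Fin m) := fun a =>
    if h : ∃ o ∈ O, i o = a then some (color h.choose) else none
  have hsel : ∀ a j, sel a = some j ↔ ∃ o ∈ O, i o = a ∧ color o = j := by
    intro a j
    by_cases h : ∃ o ∈ O, i o = a
    · simp only [sel, dif_pos h, Option.some.injEq]
      constructor
      · exact fun hj => ⟨_, h.choose_spec.1, h.choose_spec.2, hj⟩
      · rintro ⟨o, ho, hoa, rfl⟩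
        rw [hi _ h.choose_spec.1 o ho (h.choose_spec.2.trans hoa.symm)]
    · simp only [sel, dif_neg h, reduceCtorEq, false_iff]
      rintro ⟨o, ho, hoa, -⟩
      exact h ⟨o, ho, hoa⟩
  have hcount : ∀ j, selCount sel j = (colorClass color O j).card := by
    intro j
    have : (Finset.univ.filter fun a => sel a = some j) = (colorClass color O j).image i := by
      ext a
      simp only [hsel, Finset.mem_filter, Finset.mem_univ, true_and, Finset.mem_image,
        mem_colorClass]
      constructor
      · rintro ⟨o, h1, h2, h3⟩; exact ⟨o, ⟨h1, h3⟩, h2⟩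
      · rintro ⟨o, ⟨h1, h3⟩, h2⟩; exact ⟨o, h1, h2, h3⟩
    rw [selCount, this, Finset.card_image_of_injOn]
    intro x hx y hy hxy
    exact hi x (mem_colorClass.1 hx).1 y (mem_colorClass.1 hy).1 hxy
  have htotal : ∑ j, selCount sel j = k := by
    rw [Finset.sum_congr rfl fun j _ => hcount j, ← card_eq_sum_colorClass color, hO.1]
  have hflow : IsFlow (capacity color ℓ u k D) .source .sink (selFlow ℓ sel) := by
    refine isFlow_selFlow (fun a j ha => ?_) (fun j => (hcount j).trans_le (hO.2 j).2) ?_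
    · obtain ⟨o, ho, rfl, rfl⟩ := (hsel a j).1 ha
      exact ⟨g o, hmem o ho, hg o ho⟩
    · have : ∑ j, (selCount sel j - ℓ j) + ∑ j, ℓ j = ∑ j, selCount sel j := by
        rw [← Finset.sum_add_distrib]
        exact Finset.sum_congr rfl fun j _ =>
          Nat.sub_add_cancel ((hO.2 j).1.trans_eq (hcount j).symm)
      omega
  refine le_antisymm ?_ ?_
  · have h := hf.1.facts
    have hsum : ∑ i, f .source (.clus i) = ∑ j, f (.col j) .sink + f .slack .sink := by
      rw [← h.slack_eq, ← Finset.sum_add_distrib, ← Finset.sum_congr rfl fun i _ => h.clus_eq i,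
        Finset.sum_comm]
      exact Finset.sum_congr rfl fun j _ => h.col_eq j
    have h1 : ∑ j, f (.col j) .sink ≤ ∑ j, ℓ j := Finset.sum_le_sum fun j _ => h.sink_le j
    have h2 := h.slack_sink_le
    rw [h.value_eq]
    exact_mod_cast (by omega : ∑ i, f .source (.clus i) ≤ k)
  · have := hf.2 _ hflow
    rwa [flowValue_selFlow, htotal] at this

end Flows

/-! ## The approximation guarantee -/

section Guarantee

theorem toOuterMeasure_add_compl {α : Type*} (p : PMF α) (s : Set α) :
    p.toOuterMeasure s + p.toOuterMeasure sᶜ = 1 := by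
  rw [PMF.toOuterMeasure_apply, PMF.toOuterMeasure_apply, ← ENNReal.tsum_add, ← p.tsum_coe]
  exact tsum_congr fun x => Set.indicator_self_add_compl_apply s p x

variable {V : Type*} [Fintype V]

/-- If one round succeeds with probability at least `p`, then `r` rounds fail with probability at
most `(1 - p) ^ r`. -/
theorem repeatUntil_compl_le {Δ : Type*} {good : Finset V → Prop} {dec : PMF Δ}
    {solve : ℕ → Δ → Finset V} {A : Set (Finset V)} {C : Set Δ} {p : ENNReal}
    (hA : ∀ r, ∀ D ∈ dec.support, good (solve r D) → solve r D ∈ A)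
    (hC : ∀ r, ∀ D ∈ dec.support, D ∈ C → good (solve r D)) (hp : p ≤ dec.toOuterMeasure C)
    (r : ℕ) (S : Finset V) :
    (repeatUntil good dec solve r S).toOuterMeasure Aᶜ ≤ (1 - p) ^ r := by
  induction r generalizing S with
  | zero =>
    rw [pow_zero, ← toOuterMeasure_add_compl _ A]
    exact le_add_self
  | succ r ih =>
    rw [repeatUntil, PMF.toOuterMeasure_bind_apply]
    -- A good round ends inside `A` and contributes nothing to the failure; a round that is not good
    -- has `D ∉ C` and leaves `r` further rounds.
    calc _ ≤ ∑' D, (Cᶜ).indicator dec D * (1 - p) ^ r := by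
          refine ENNReal.tsum_le_tsum fun D => ?_
          by_cases hD : D ∈ dec.support
          · by_cases hg : good (solve r D)
            · rw [if_pos hg, PMF.toOuterMeasure_pure_apply, if_neg, mul_zero]
              · exact zero_le
              · exact fun h => h (hA r D hD hg)
            · rw [if_neg hg, Set.indicator_of_mem (show D ∈ Cᶜ from fun h => hg (hC r D hD h))]
              gcongr
              exact ih _
          · rw [(PMF.apply_eq_zero_iff _ _).2 hD, zero_mul]
            exact zero_le
      _ = dec.toOuterMeasure Cᶜ * (1 - p) ^ r := by
          rw [ENNReal.tsum_mul_right, PMF.toOuterMeasure_apply]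
      _ ≤ (1 - p) * (1 - p) ^ r := by
          gcongr
          have h1 := toOuterMeasure_add_compl dec C
          have h2 : dec.toOuterMeasure C ≠ ⊤ :=
            ne_top_of_le_ne_top ENNReal.one_ne_top (h1 ▸ le_self_add)
          rw [← h1]
          refine le_trans ?_ (tsub_le_tsub_left hp _)
          rw [ENNReal.add_sub_cancel_left h2]
      _ = _ := (pow_succ' _ _).symm

variable [MetricSpace V] {m : ℕ} {color : V → Fin m} {ℓ u : Fin m → ℕ} {k T : ℕ} {τ : ℝ}

theorem mem_support_decompose {U : Finset V} {γ : ℝ} {D : Fin U.card → Finset V}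
    (h : D ∈ (decompose m U γ).support) : ∃ π R, D = cluster U (γ * alpha m) π R := by
  simp only [decompose, PMF.mem_support_bind_iff, PMF.mem_support_map_iff] at h
  obtain ⟨π, -, R, -, rfl⟩ := h
  exact ⟨π, R, rfl⟩

/-- Soundness does not depend on luck: any fair result is spread out, because its points come from
different clusters. Randomness is only needed for fairness, where each round succeeds with
probability at least `c / m`. -/
theorem guarantee (hm : 2 ≤ m) (hk : 1 ≤ k) (hkm : k ≤ m) (hτ : 0 < τ) {O : Finset V}
    (hO : Fair color ℓ u k O) (hdiv : ENNReal.ofReal τ ≤ diversity O) {μ : PMF (Finset V)}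
    (hμ : IsOutputLaw color ℓ u k (2 * τ / 5) (τ / 5) k T μ) :
    ENNReal.ofReal (1 - (2 : ℝ) ^ (-(successConstant * (T : ℝ)))) ≤
      μ.toOuterMeasure {S | Fair color ℓ u k S ∧
        ENNReal.ofReal (Real.sqrt (Real.log m) * τ / (5 * m)) ≤ diversity S} := by
  obtain ⟨U, hU, solve, hsolve, rfl⟩ := hμ
  have hγ : 0 < τ / 5 := by positivity
  have hU' : IsPruning color (2 * (τ / 5)) k U := by rwa [← mul_div_assoc]
  have hα : τ / 5 * alpha m = Real.sqrt (Real.log m) * τ / (5 * m) := by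
    unfold alpha
    ring
  obtain ⟨g, hg, hgsep⟩ := hU'.exists_representatives hO.1.le (fun x hx y hy hxy => by
    have := le_dist_of_le_diversity hdiv hx hy hxy
    linarith)
  have hne : O.Nonempty := Finset.card_pos.1 (by have := hO.1; omega)
  have hp := decompose_captures hm hγ (fun x hx y hy hxy hc => hU'.separated hx hy hxy hc) hne
    (hO.1.trans_le hkm) (fun o ho => (hg o ho).1) hgsep
  set A := {S | Fair color ℓ u k S ∧
        ENNReal.ofReal (Real.sqrt (Real.log m) * τ / (5 * m)) ≤ diversity S} with hA
  have hfail := repeatUntil_compl_le (good := Fair color ℓ u k) (A := A) (solve := solve)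
    (fun r D hD hgood => by
      refine ⟨hgood, le_diversity fun x hx y hy hxy => ?_⟩
      obtain ⟨π, R, rfl⟩ := mem_support_decompose hD
      obtain ⟨i, i', hii, hxi, hyi⟩ := (hsolve r _).exists_clusters hx hy hxy
      rw [← hα]
      exact le_dist_of_mem_cluster hii hxi hyi)
    (fun r D hD hcap => by
      obtain ⟨π, R, rfl⟩ := mem_support_decompose hD
      exact (hsolve r _).fair (fun i j hij => cluster_disjoint hij) hO
        (fun o ho => (hg o ho).2) hcap) hp (T * m) ∅
  have hm0 : (0 : ℝ) < m := by positivity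
  have hc0 : 0 < successConstant := Real.exp_pos _
  have hc1 : successConstant ≤ 1 := Real.exp_le_one_iff.2 (by norm_num)
  have hcm : successConstant / m ≤ 1 := by
    rw [div_le_one hm0]
    exact hc1.trans (by exact_mod_cast (by omega : 1 ≤ m))
  have hbound : (1 - ENNReal.ofReal (successConstant / m)) ^ (T * m) ≤
      ENNReal.ofReal ((2 : ℝ) ^ (-(successConstant * (T : ℝ)))) := by
    rw [← ENNReal.ofReal_one, ← ENNReal.ofReal_sub _ (by positivity),
      ← ENNReal.ofReal_pow (by linarith)]
    refine ENNReal.ofReal_le_ofReal ?_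
    -- The factor `m` in the number of rounds cancels the `1 / m` in the success probability; the
    -- base `2` comes from `log 2 ≤ 1`.
    calc (1 - successConstant / m) ^ (T * m)
        ≤ Real.exp (-(successConstant / m)) ^ (T * m) := by
          have := Real.one_sub_le_exp_neg (successConstant / m)
          gcongr
      _ = Real.exp (-(successConstant * T)) := by
          rw [← Real.exp_nat_mul]
          congr 1
          push_cast
          field_simp
      _ ≤ _ := by
          rw [Real.rpow_def_of_pos (by norm_num)]
          apply Real.exp_le_exp.2
          have h2 : Real.log 2 ≤ 1 := by have := Real.log_two_lt_d9; linarith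
          have h3 : 0 ≤ successConstant * T := by positivity
          nlinarith
  have htot := toOuterMeasure_add_compl
    (repeatUntil (Fair color ℓ u k) (decompose m U (τ / 5)) solve (T * m) ∅) A
  have h2 := hfail.trans hbound
  rw [ENNReal.ofReal_sub _ (by positivity), ENNReal.ofReal_one, ← htot]
  exact tsub_le_iff_right.2 (by gcongr)

end Guarantee

/-! ## Notation for programs -/

section ProgramNotation

/-- Sequential composition. -/
infixr:60 " ;; " => Cmd.seq

/-- The cell `(0, 0)` of array `a`. -/
@[reducible] def var (a : ℕ) : NExpr := .load a (.const 0) (.const 0)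

/-- The cell `(i, 0)` of array `a`. -/
@[reducible] def get (a : ℕ) (i : NExpr) : NExpr := .load a i (.const 0)

/-- Assign to the cell `(0, 0)` of array `a`. -/
@[reducible] def setVar (a : ℕ) (x : NExpr) : Cmd := .store a (.const 0) (.const 0) x

/-- Assign to the cell `(i, 0)` of array `a`. -/
@[reducible] def put (a : ℕ) (i x : NExpr) : Cmd := .store a i (.const 0) x

end ProgramNotation

/-! ### Reading colors and distances off the encoded input -/

section Encoding

variable {V : Type*} [MetricSpace V] {n m k T : ℕ} {pt : Fin n ≃ V} {color : V → Fin m}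
  {ℓ u : Fin m → ℕ} {τ : ℝ}

theorem encode_color (v : V) :
    (encode pt color ℓ u k T τ).color (pt.symm v : ℕ) = (color v : ℕ) := by
  simp [encode]

theorem encode_dist (v w : V) :
    (encode pt color ℓ u k T τ).dist (pt.symm v : ℕ) (pt.symm w : ℕ) = dist v w := by
  simp [encode]

end Encoding

/-! ## The pruning command -/

section PruneProgram

/-- Scan the points and select every point that is not marked, as long as its color has not more
than `k` selected points. Array `3` lists the selected points, `2` is their number, array `4`
contains the number of selected points of every color. -/
def pruneCmd : Cmd :=
  .loop 7 .numPoints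
    (.cond (.lt .solutionSize (get 4 (.color (var 7)))) .skip
      (setVar 6 (.const 0) ;;
      .loop 8 (var 2)
        (.cond (.conj (.eq (.color (get 3 (var 8))) (.color (var 7)))
            (.rlt (.dist (var 7) (get 3 (var 8)))
              (.divide (.times (.cast (.const 2)) .tau) (.cast (.const 5)))))
          (setVar 6 (.const 1)) .skip) ;;
      .cond (.eq (var 6) (.const 0))
        (put 3 (var 2) (var 7) ;;
        setVar 2 (.plus (var 2) (.const 1)) ;;
        put 4 (.color (var 7)) (.plus (get 4 (.color (var 7))) (.const 1))) .skip))

variable {V : Type*} [Fintype V] [MetricSpace V] {n m : ℕ} {pt : Fin n ≃ V} {color : V → Fin m}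
  {γ : ℝ} {k : ℕ}

open Classical in
/-- `S` results from the first `r` passes of the pruning scan. -/
structure PruneInv (pt : Fin n ≃ V) (color : V → Fin m) (γ : ℝ) (k r : ℕ) (S : Finset V) : Prop where
  index_lt : ∀ x ∈ S, (pt.symm x : ℕ) < r
  card_le : ∀ i, (colorClass color S i).card ≤ k + 1
  -- `PruneLoop` grows at its beginning only. The run so far is therefore recorded as a prefix that
  -- can be put before every possible continuation.
  loop : ∀ i Y, PruneLoop (colorClass color Finset.univ i) γ k
    ((colorClass color Finset.univ i).filter fun w => ∃ x ∈ colorClass color S i, dist w x < γ)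
    (colorClass color S i) Y → PruneLoop (colorClass color Finset.univ i) γ k ∅ ∅ Y
  covers : ∀ v, (pt.symm v : ℕ) < r → (colorClass color S (color v)).card ≤ k →
    ∃ x ∈ colorClass color S (color v), dist v x < γ

theorem PruneInv.zero : PruneInv pt color γ k 0 ∅ := by
  refine ⟨by simp, by simp [colorClass], fun i Y h => ?_, by simp⟩
  simpa [colorClass] using h

/-- After the last point every color has either exceeded its budget or no unmarked point, so the
empty continuation is admissible for each color. -/
theorem PruneInv.isPruning {S : Finset V} (h : PruneInv pt color γ k n S) :
    IsPruning color γ k S := by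
  classical
  refine ⟨fun i => colorClass color S i, fun i => h.loop i _ (.done _ _ ?_), ?_⟩
  · rintro ⟨⟨v, hv, hvM⟩, hcard⟩
    obtain rfl := (mem_colorClass.1 hv).2
    exact hvM (Finset.mem_filter.2 ⟨hv, h.covers v (pt.symm v).2 hcard⟩)
  · ext v
    simp [mem_colorClass]

theorem PruneInv.skip {S : Finset V} {r : ℕ} {v : V} (h : PruneInv pt color γ k r S)
    (hv : (pt.symm v : ℕ) = r) (hskip : k < (colorClass color S (color v)).card ∨
      ∃ x ∈ S, color x = color v ∧ dist v x < γ) : PruneInv pt color γ k (r + 1) S := by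
  refine ⟨fun x hx => (h.index_lt x hx).trans (Nat.lt_succ_self r), h.card_le, h.loop, ?_⟩
  intro w hw hcard
  rcases Nat.lt_succ_iff_lt_or_eq.1 hw with hw | hw
  · exact h.covers w hw hcard
  · obtain rfl : w = v := pt.symm.injective (Fin.ext (hw.trans hv.symm))
    rcases hskip with hs | ⟨x, hx, hxc, hd⟩
    · omega
    · exact ⟨x, mem_colorClass.2 ⟨hx, hxc⟩, hd⟩

theorem colorClass_insert [DecidableEq V] (color : V → Fin m) (S : Finset V) (v : V) (i : Fin m) :
    colorClass color (insert v S) i =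
      if color v = i then insert v (colorClass color S i) else colorClass color S i := by
  ext x
  split_ifs with h
  · simp only [mem_colorClass, Finset.mem_insert]
    constructor
    · rintro ⟨rfl | hx, hc⟩
      · exact Or.inl rfl
      · exact Or.inr ⟨hx, hc⟩
    · rintro (rfl | ⟨hx, hc⟩)
      · exact ⟨Or.inl rfl, h⟩
      · exact ⟨Or.inr hx, hc⟩
  · simp only [mem_colorClass, Finset.mem_insert]
    constructor
    · rintro ⟨rfl | hx, hc⟩
      · exact absurd hc h
      · exact ⟨hx, hc⟩
    · rintro ⟨hx, hc⟩
      exact ⟨Or.inr hx, hc⟩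

-- A point that is far from the selected points of its color is unmarked. One scan thus interleaves
-- the loops of all colors, and selecting `v` is a step of the loop of its color alone.
open Classical in
theorem PruneInv.insert {S : Finset V} {r : ℕ} {v : V} (hγ : 0 < γ)
    (h : PruneInv pt color γ k r S) (hv : (pt.symm v : ℕ) = r)
    (hcard : (colorClass color S (color v)).card ≤ k)
    (hfar : ∀ x ∈ S, color x = color v → γ ≤ dist v x) :
    PruneInv pt color γ k (r + 1) (insert v S) := by
  have hvS : v ∉ S := fun hvS => by have := h.index_lt v hvS; omega
  refine ⟨fun x hx => ?_, fun i => ?_, fun i Y hY => ?_, fun w hw hcard' => ?_⟩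
  · rcases Finset.mem_insert.1 hx with rfl | hx
    · omega
    · exact (h.index_lt x hx).trans (Nat.lt_succ_self r)
  · rw [colorClass_insert]
    split_ifs with hi
    · subst hi
      exact (Finset.card_insert_le _ _).trans (by omega)
    · exact h.card_le i
  · rw [colorClass_insert] at hY
    split_ifs at hY with hi
    · subst hi
      refine h.loop _ _ (.step _ _ _ v (mem_colorClass.2 ⟨Finset.mem_univ _, rfl⟩) ?_ hcard ?_)
      · rintro hc
        obtain ⟨x, hx, hd⟩ := (Finset.mem_filter.1 hc).2
        have := hfar x (mem_colorClass.1 hx).1 (mem_colorClass.1 hx).2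
        linarith
      · convert hY using 1
        ext w
        simp only [Finset.mem_union, Finset.mem_filter, Finset.mem_insert, exists_eq_or_imp]
        rw [← and_or_left, or_comm]
    · exact h.loop _ _ hY
  · have hmono : colorClass color S (color w) ⊆ colorClass color (Insert.insert v S) (color w) :=
      fun x hx => mem_colorClass.2 ⟨Finset.mem_insert_of_mem (mem_colorClass.1 hx).1,
        (mem_colorClass.1 hx).2⟩
    rcases Nat.lt_succ_iff_lt_or_eq.1 hw with hw | hw
    · obtain ⟨x, hx, hd⟩ := h.covers w hw ((Finset.card_le_card hmono).trans hcard')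
      exact ⟨x, hmono hx, hd⟩
    · obtain rfl : w = v := pt.symm.injective (Fin.ext (hw.trans hv.symm))
      exact ⟨w, mem_colorClass.2 ⟨Finset.mem_insert_self _ _, rfl⟩, by simpa using hγ⟩

/-- The memory `M` lists the points of the list `L` in array `3`, and their number in array `2`. -/
def Lists (pt : Fin n ≃ V) (L : List V) (M : Mem) : Prop :=
  M (2, 0, 0) = L.length ∧ ∀ (p : ℕ) (h : p < L.length), M (3, p, 0) = (pt.symm L[p] : ℕ)

variable {ℓ u : Fin m → ℕ} {T : ℕ} {τ : ℝ}

-- Each point is compared with the points selected so far, of which there are at most `k + 1` per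
-- color; hence the total time `O(n m k)`. Cell `6` is the flag of a selected point of the same
-- color that is too close.
open Classical in
theorem spec_pruneCmd (hτ : 0 < τ) :
    Spec (encode pt color ℓ u k T τ) pruneCmd (fun _ => 0) (n * (m * (k + 1) * 100 + 200) + 2)
      fun M => ∃ L : List V, L.Nodup ∧ Lists pt L M ∧
        IsPruning color (2 * τ / 5) k L.toFinset := by
  set I := encode pt color ℓ u k T τ with hI
  unfold pruneCmd
  refine Spec.loop (m * (k + 1) * 100 + 199) (fun r M => ∃ L : List V, L.Nodup ∧ Lists pt L M ∧
    PruneInv pt color (2 * τ / 5) k r L.toFinset ∧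
    ∀ i : Fin m, M (4, i, 0) = (colorClass color L.toFinset i).card) ?_ ?_ ?_ ?_
  · exact ⟨[], List.nodup_nil, ⟨rfl, by simp⟩, by simpa using PruneInv.zero, by simp [colorClass]⟩
  · rintro r M hr ⟨L, hL, hlist, hinv, hcnt⟩ -
    have hr' : r < n := hr
    set v := pt ⟨r, hr'⟩ with hv
    have hvr : (pt.symm v : ℕ) = r := by simp [hv]
    have hcol : I.color r = color v := by rw [← hvr, encode_color]
    have hlen : L.length ≤ m * (k + 1) := by
      rw [← List.toFinset_card_of_nodup hL, card_eq_sum_colorClass color]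
      calc _ ≤ ∑ _i : Fin m, (k + 1) := Finset.sum_le_sum fun i _ => hinv.card_le i
        _ = _ := by simp
    have hcolor : ∀ p (hp : p < L.length), I.color (M (3, p, 0)) = color L[p] := fun p hp => by
      rw [hlist.2 p hp, encode_color]
    have hdist : ∀ p (hp : p < L.length), I.dist r (M (3, p, 0)) = dist v L[p] := fun p hp => by
      rw [hlist.2 p hp, ← hvr, encode_dist]
    have hcntv := hcnt (color v)
    have hkI : I.k = k := rfl
    have hτI : I.τ = τ := rfl
    refine Spec.cond (m * (k + 1) * 100 + 160) (fun h => ?_) (fun h => ?_) ?_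
    · replace h : k < M (4, color v, 0) := by
        simpa [BExpr.holds, NExpr.eval, hcol, Function.update_apply, hkI] using h
      refine Spec.skip ⟨L, hL, ?_, hinv.skip hvr (Or.inl (by omega)), ?_⟩ (by omega)
      · simpa [Lists, Function.update_apply] using hlist
      · simpa [Function.update_apply] using hcnt
    · replace h : M (4, color v, 0) ≤ k := by
        simpa [BExpr.holds, NExpr.eval, hcol, Function.update_apply, hkI] using h
      refine Spec.seq 4 (m * (k + 1) * 100 + 150) (Spec.store ?_ (by decide)) (by omega)
      refine Spec.seq (m * (k + 1) * 100 + 4) 100 ?_ (by omega)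
      refine Spec.loop 99 (fun q M' => M' (6, 0, 0) = 0 ↔
        ∀ p (hp : p < L.length), p < q → ¬ (color L[p] = color v ∧ dist v L[p] < 2 * τ / 5))
        ?_ ?_ ?_ ?_
      · simp [NExpr.eval]
      · intro q M' hq hinv' hF
        have hq' : q < L.length := by
          simpa [NExpr.eval, Function.update_apply, hlist.1] using hq
        have h3 : M' (3, q, 0) = M (3, q, 0) := by
          rw [hF 3 q 0 (by decide)]; simp [Function.update_apply]
        have h7 : M' (7, 0, 0) = r := by
          rw [hF 7 0 0 (by decide)]; simp [Function.update_apply]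
        have hsplit : (∀ p (hp : p < L.length), p < q + 1 →
            ¬ (color L[p] = color v ∧ dist v L[p] < 2 * τ / 5)) ↔
            (∀ p (hp : p < L.length), p < q →
              ¬ (color L[p] = color v ∧ dist v L[p] < 2 * τ / 5)) ∧
            ¬ (color L[q] = color v ∧ dist v L[q] < 2 * τ / 5) := by
          constructor
          · exact fun h => ⟨fun p hp hpq => h p hp (by omega), h q hq' (by omega)⟩
          · rintro ⟨h1, h2⟩ p hp hpq
            rcases Nat.lt_succ_iff_lt_or_eq.1 hpq with h | rfl
            · exact h1 p hp h
            · exact h2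
        refine Spec.cond 4 (fun h => ?_) (fun h => ?_) (by decide : _ ≤ 99)
        · refine Spec.store ?_ (by decide)
          simp only [BExpr.holds, NExpr.eval, RExpr.eval, Function.update_apply, h3, h7,
            hcolor q hq', hcol, hdist q hq', hτI, Fin.val_inj, Prod.mk.injEq, Nat.reduceEqDiff,
            false_and, if_false, and_self, if_true] at h
          simp only [hsplit, NExpr.eval, Function.update_self, one_ne_zero, false_iff]
          exact fun hc => hc.2 (by simpa using h)
        · refine Spec.skip ?_ (by decide)
          simp only [BExpr.holds, NExpr.eval, RExpr.eval, Function.update_apply, h3, h7,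
            hcolor q hq', hcol, hdist q hq', hτI, Fin.val_inj, Prod.mk.injEq, Nat.reduceEqDiff,
            false_and, if_false, and_self, if_true] at h
          simp only [hsplit, Function.update_apply, Prod.mk.injEq, Nat.reduceEqDiff, false_and,
            if_false, hinv']
          exact ⟨fun h1 => ⟨h1, by simpa using h⟩, fun h1 => h1.1⟩
      · intro M' hM' hF
        have hN : M' (2, 0, 0) = L.length := by
          rw [hF 2 0 0 (by decide)]; simpa [Function.update_apply] using hlist.1
        have h7 : M' (7, 0, 0) = r := by
          rw [hF 7 0 0 (by decide)]; simp [Function.update_apply]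
        have h3 : ∀ p, M' (3, p, 0) = M (3, p, 0) := fun p => by
          rw [hF 3 p 0 (by decide)]; simp [Function.update_apply]
        have h4 : ∀ p, M' (4, p, 0) = M (4, p, 0) := fun p => by
          rw [hF 4 p 0 (by decide)]; simp [Function.update_apply]
        have hscan : M' (6, 0, 0) = 0 ↔
            ∀ x ∈ L, color x = color v → 2 * τ / 5 ≤ dist v x := by
          rw [hM', List.forall_mem_iff_getElem]
          refine forall₂_congr fun p hp => ?_
          have : p < (var 2).eval I (Function.update (Function.update M (7, 0, 0) r) (6, 0, 0) 0) := by
            simpa [NExpr.eval, Function.update_apply, hlist.1] using hp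
          simp [NExpr.eval, Function.update_apply, hlist.1, hp]
        refine Spec.cond 60 (fun h => ?_) (fun h => ?_) (by decide)
        · replace h := hscan.1 (by simpa [BExpr.holds, NExpr.eval] using h)
          have hvL : v ∉ L := fun hvL => by
            have := hinv.index_lt v (List.mem_toFinset.2 hvL)
            omega
          refine Spec.seq 8 50 (Spec.store ?_ (by decide)) (by decide)
          refine Spec.seq 8 40 (Spec.store ?_ (by decide)) (by decide)
          refine Spec.store ?_ (by decide)
          simp only [NExpr.eval, Function.update_apply, hN, h7, hcol, h4, h3]
          refine ⟨L ++ [v], ?_, ⟨?_, fun p hp => ?_⟩, ?_, fun i => ?_⟩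
          · simpa [List.nodup_append] using ⟨hL, fun a ha hav => hvL (hav ▸ ha)⟩
          · simp
          · rw [List.length_append, List.length_singleton] at hp
            by_cases hpL : p < L.length
            · rw [List.getElem_append_left hpL]
              simp [hpL.ne, h3, hlist.2 p hpL]
            · have : p = L.length := by omega
              subst this
              simp [hvr]
          · rw [List.toFinset_append]
            have : L.toFinset ∪ [v].toFinset = insert v L.toFinset := by ext; simp [or_comm]
            rw [this]
            exact hinv.insert (by positivity) hvr (by omega) fun x hx => h x (List.mem_toFinset.1 hx)
          · have : (L ++ [v]).toFinset = insert v L.toFinset := by ext; simp [or_comm]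
            rw [this, colorClass_insert]
            by_cases hi : color v = i
            · subst hi
              rw [if_pos rfl, Finset.card_insert_of_notMem
                (fun h => hvL (List.mem_toFinset.1 (mem_colorClass.1 h).1)), ← hcnt]
              simp [hcol]
            · rw [if_neg hi, ← hcnt]
              simp [hcol, Fin.val_inj, Ne.symm hi, h4]
        · have h' : ¬ ∀ x ∈ L, color x = color v → 2 * τ / 5 ≤ dist v x := fun hc =>
            h (by simpa [BExpr.holds, NExpr.eval] using hscan.2 hc)
          push Not at h'
          refine Spec.skip ⟨L, hL, ⟨hN, fun p hp => (h3 p).trans (hlist.2 p hp)⟩,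
            hinv.skip hvr (Or.inr ?_), fun i => (h4 i).trans (hcnt i)⟩ (by decide)
          simpa using h'
      · simp [NExpr.eval, NExpr.cost, Function.update_apply, hlist.1]
        nlinarith
    · simp [BExpr.cost, NExpr.cost]
      omega
  · rintro M ⟨L, hL, hlist, hinv, hcnt⟩ -
    exact ⟨L, hL, hlist, hinv.isPruning⟩
  · simp [NExpr.eval, NExpr.cost, hI, encode]

end PruneProgram

/-! ## The table of neighbors -/

section NeighborProgram

/-- The distance below which two points are neighbors. -/
def nearExpr : RExpr :=
  .times (.divide .tau (.cast (.const 5)))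
    (.divide (.sqrt (.log (.cast .numColors))) (.cast .numColors))

/-- For all selected points, with numbers `p` and `q`, that are close to each other, write `q + 1`
into the cell `(p, c)` of array `9`, where `c` is the color of `q`. -/
def neighborCmd : Cmd :=
  .loop 10 (var 2) (.loop 11 (var 2)
    (.cond (.conj (.neg (.eq (var 10) (var 11)))
        (.rlt (.dist (get 3 (var 10)) (get 3 (var 11))) nearExpr))
      (.store 9 (var 10) (.color (get 3 (var 11))) (.plus (var 11) (.const 1))) .skip))

variable {V : Type*} [MetricSpace V] {n m : ℕ} {pt : Fin n ≃ V} {color : V → Fin m}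
  {k T : ℕ} {ℓ u : Fin m → ℕ} {τ : ℝ} {U : Finset V} {e : Fin U.card ≃ {x // x ∈ U}}

/-- Array `3` lists the points of `U`, in the order `e`, and array `2` contains their number. -/
def Points (pt : Fin n ≃ V) (e : Fin U.card ≃ {x // x ∈ U}) (M : Mem) : Prop :=
  M (2, 0, 0) = U.card ∧ ∀ p : Fin U.card, M (3, p, 0) = (pt.symm (e p) : ℕ)

theorem Points.congr {M M' : Mem} (h : Points pt e M) (h2 : M' (2, 0, 0) = M (2, 0, 0))
    (h3 : ∀ p, M' (3, p, 0) = M (3, p, 0)) : Points pt e M' :=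
  ⟨h2.trans h.1, fun p => (h3 _).trans (h.2 p)⟩

theorem Points.frame {M M' : Mem} {W : List ℕ} (h : Points pt e M) (hF : Frame W M M')
    (h2 : 2 ∉ W) (h3 : 3 ∉ W) : Points pt e M' :=
  h.congr (hF _ _ _ h2) fun _ => hF _ _ _ h3

theorem Points.update {M : Mem} (h : Points pt e M) {a : ℕ} (h2 : 2 ≠ a) (h3 : 3 ≠ a)
    (i j x : ℕ) : Points pt e (Function.update M (a, i, j) x) :=
  h.congr (Function.update_of_ne (by simp [h2]) _ _)
    fun p => Function.update_of_ne (by simp [h3]) _ _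

/-- Array `9` contains the neighbors of all selected points, sorted by their colors. -/
structure NeighborTable (color : V → Fin m) (r : ℝ) (e : Fin U.card ≃ {x // x ∈ U})
    (A : Fin U.card → Fin U.card → Prop) (M : Mem) : Prop where
  sound : ∀ (p : Fin U.card) (c q : ℕ), M (9, p, c) = q + 1 →
    ∃ q' : Fin U.card, (q' : ℕ) = q ∧ (nearGraph U r).Adj (e p) (e q') ∧
      (color (e q') : ℕ) = c
  -- The relation `A` tells which pairs have been compared so far; it serves as loop invariant and
  -- is everything at the end.
  complete : ∀ p q, A p q → (nearGraph U r).Adj (e p) (e q) → M (9, p, color (e q)) = q + 1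

theorem NeighborTable.congr {r : ℝ} {A : Fin U.card → Fin U.card → Prop} {M M' : Mem}
    (h : NeighborTable color r e A M) (h9 : ∀ p c, M' (9, p, c) = M (9, p, c)) :
    NeighborTable color r e A M' :=
  ⟨fun p c q hq => h.sound p c q ((h9 p c).symm.trans hq),
    fun p q hA hq => (h9 _ _).trans (h.complete p q hA hq)⟩

theorem NeighborTable.weaken {r : ℝ} {A A' : Fin U.card → Fin U.card → Prop} {M : Mem}
    (h : NeighborTable color r e A M)
    (hA : ∀ p q, A' p q → (nearGraph U r).Adj (e p) (e q) → A p q) :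
    NeighborTable color r e A' M :=
  ⟨h.sound, fun p q hA' hq => h.complete p q (hA p q hA' hq) hq⟩

theorem eval_nearExpr (M : Mem) :
    nearExpr.eval (encode pt color ℓ u k T τ) M = τ / 5 * alpha m := by
  simp [nearExpr, RExpr.eval, NExpr.eval, encode, alpha]

/-- Two neighbors of one point are less than `2 γ α ≤ γ` apart, while kept points of one color are
at least `2 γ` apart. So each point has at most one neighbor of each color and no entry is
overwritten: a row with one cell per color is a complete adjacency list. -/
theorem spec_neighborCmd (hm : 2 ≤ m) (hτ : 0 < τ)
    (hU : ∀ x ∈ U, ∀ y ∈ U, x ≠ y → color x = color y → 2 * (τ / 5) ≤ dist x y) {M : Mem}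
    (hP : Points pt e M) (h9 : ∀ p c, M (9, p, c) = 0) :
    Spec (encode pt color ℓ u k T τ) neighborCmd M (U.card * (U.card * 100 + 100) + 100)
      (NeighborTable color (τ / 5 * alpha m) e fun _ _ => True) := by
  set I := encode pt color ℓ u k T τ with hI
  set G := nearGraph U (τ / 5 * alpha m) with hG
  unfold neighborCmd
  have hN : (var 2).eval I M = U.card := by simpa [NExpr.eval] using hP.1
  refine Spec.loop (U.card * 100 + 99)
    (fun r M => NeighborTable color (τ / 5 * alpha m) e (fun p _ => (p : ℕ) < r) M)
    ?_ ?_ ?_ ?_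
  · exact ⟨fun p c q h => by rw [h9] at h; omega, fun p q h => absurd h (Nat.not_lt_zero _)⟩
  · intro r M₁ hr hinv hF
    rw [hN] at hr
    have hP₁ := (hP.frame hF (by decide) (by decide)).update (a := 10) (by decide) (by decide) 0 0 r
    have hN₁ : (var 2).eval I (Function.update M₁ (10, 0, 0) r) = U.card := by
      simpa [NExpr.eval] using hP₁.1
    refine Spec.loop 90 (fun s M => NeighborTable color (τ / 5 * alpha m) e
      (fun p q => (p : ℕ) < r ∨ (p : ℕ) = r ∧ (q : ℕ) < s) M) ?_ ?_ ?_ ?_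
    · refine (hinv.congr fun p c => by simp [Function.update_apply]).weaken fun p q h _ => ?_
      simpa using h
    · intro s M₂ hs hinv₂ hF₂
      rw [hN₁] at hs
      have hP₂ := (hP₁.frame hF₂ (by decide) (by decide)).update (a := 11) (by decide) (by decide) 0 0 s
      have h10 : M₂ (10, 0, 0) = r := by
        rw [hF₂ 10 0 0 (by decide)]; simp
      have hr3 := hP₂.2 ⟨r, hr⟩
      have hs3 := hP₂.2 ⟨s, hs⟩
      simp only [Function.update_apply, Prod.mk.injEq, Nat.reduceEqDiff, false_and, if_false]
        at hr3 hs3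
      have hadj : G.Adj (e ⟨r, hr⟩) (e ⟨s, hs⟩) ↔ r ≠ s ∧
          dist (e ⟨r, hr⟩ : V) (e ⟨s, hs⟩) < τ / 5 * alpha m := by
        simp [hG, nearGraph]
      refine Spec.cond 20 (fun h => ?_) (fun h => ?_) (by decide)
      · refine Spec.store ?_ (by decide)
        simp only [BExpr.holds, NExpr.eval, RExpr.eval, Function.update_apply, h10, hr3, hs3,
          eval_nearExpr, hI, encode_dist, Prod.mk.injEq, Nat.reduceEqDiff, false_and, if_false,
          and_self, if_true] at h
        rw [← hadj] at h
        simp only [NExpr.eval, Function.update_apply, h10, hr3, hs3, encode_color, hI,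
          Prod.mk.injEq, Nat.reduceEqDiff, false_and, if_false, and_self, if_true]
        refine ⟨fun p c q hq => ?_, fun p q hA hq => ?_⟩
        · by_cases hc : (p : ℕ) = r ∧ c = color (e ⟨s, hs⟩)
          · refine ⟨⟨s, hs⟩, ?_, ?_, hc.2.symm⟩
            · simp [Function.update_apply, hc.1, hc.2] at hq
              exact hq
            · have : p = ⟨r, hr⟩ := Fin.ext hc.1
              rw [this]; exact h
          · refine hinv₂.sound p c q ?_
            rw [← hq]
            simp only [Function.update_apply, Prod.mk.injEq, true_and, if_neg hc]
            simp
        · by_cases hc : (p : ℕ) = r ∧ (color (e q : V) : ℕ) = color (e ⟨s, hs⟩)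
          · have hp : p = ⟨r, hr⟩ := Fin.ext hc.1
            have hqs : q = ⟨s, hs⟩ := by
              by_contra hne
              rw [hp] at hq
              have h1 := hU _ (e q).2 _ (e ⟨s, hs⟩).2
                (fun h => hne (e.injective (Subtype.ext h))) (Fin.ext hc.2)
              have h2 := dist_triangle_left (e q : V) (e ⟨s, hs⟩) (e ⟨r, hr⟩)
              have h3 := hq.2
              have h4 := h.2
              have h5 := two_mul_alpha_le_one hm
              nlinarith
            subst hqs
            simp [Function.update_apply, hc.1]
          · simp only [Function.update_apply, Prod.mk.injEq, true_and, if_neg hc]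
            simp only [Nat.reduceEqDiff, false_and, if_false]
            refine hinv₂.complete p q ?_ hq
            rcases hA with hA | ⟨h1, h2⟩
            · exact Or.inl hA
            · refine Or.inr ⟨h1, lt_of_le_of_ne (Nat.lt_succ_iff.1 h2) fun h3 => hc ⟨h1, ?_⟩⟩
              rw [show q = ⟨s, hs⟩ from Fin.ext h3]
      · refine Spec.skip ?_ (by decide)
        simp only [BExpr.holds, NExpr.eval, RExpr.eval, Function.update_apply, h10, hr3, hs3,
          eval_nearExpr, hI, encode_dist, Prod.mk.injEq, Nat.reduceEqDiff, false_and, if_false,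
          and_self, if_true] at h
        rw [← hadj] at h
        refine (hinv₂.congr fun p c => by simp [Function.update_apply]).weaken fun p q hA hq => ?_
        rcases hA with hA | ⟨h1, h2⟩
        · exact Or.inl hA
        · refine Or.inr ⟨h1, lt_of_le_of_ne (Nat.lt_succ_iff.1 h2) fun h3 => h ?_⟩
          rwa [show (⟨r, hr⟩ : Fin U.card) = p from Fin.ext h1.symm,
            show (⟨s, hs⟩ : Fin U.card) = q from Fin.ext h3.symm]
    · rw [hN₁]
      intro M₂ hinv₂ _
      refine hinv₂.weaken fun p q hp _ => ?_
      have := q.2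
      omega
    · rw [hN₁]
      simp only [NExpr.cost]
      omega
  · rw [hN]
    intro M₁ hinv _
    exact hinv.weaken fun p _ _ _ => p.2
  · rw [hN]
    simp only [NExpr.cost]
    linarith

end NeighborProgram

/-! ## Breadth first search -/

section Search

variable {W : Type*} [Fintype W] [DecidableEq W] {G : SimpleGraph W} {s : W} {h : ℕ}
  {A A' : W → Prop} {d : W → ℕ} {Q : List W}

/-- The state of a breadth first search from `s`: the queue `Q`, the position `h` in it, and the
labels `d`, that is the distances plus one. The neighbors in `A` of the point at position `h` have
been visited. -/
structure Bfs (G : SimpleGraph W) (s : W) (h : ℕ) (A : W → Prop) (d : W → ℕ) (Q : List W) :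
    Prop where
  nodup : Q.Nodup
  mem_iff : ∀ v, v ∈ Q ↔ d v ≠ 0
  source : d s = 1
  sound : ∀ v t, d v = t + 1 → G.edist s v ≤ t
  mono : Q.Pairwise fun v w => d v ≤ d w
  near : ∀ hh : h < Q.length, ∀ v ∈ Q, d v ≤ d Q[h] + 1
  done : ∀ (i : ℕ) (hi : i < Q.length), i < h → ∀ v, G.Adj Q[i] v → d v ≠ 0 ∧ d v ≤ d Q[i] + 1
  current : ∀ hh : h < Q.length, ∀ v, G.Adj Q[h] v → A v → d v ≠ 0

theorem Bfs.init : Bfs G s 0 (fun _ => False) (Function.update (fun _ => 0) s 1) [s] := by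
  refine ⟨by simp, fun v => ?_, by simp, fun v t hv => ?_, by simp, ?_, by simp, by simp⟩
  · by_cases hv : v = s <;> simp [hv]
  · by_cases hvs : v = s
    · simp [hvs]
    · simp [hvs] at hv
  · intro _ v hv
    obtain rfl : v = s := by simpa using hv
    simp

theorem Bfs.weaken (H : Bfs G s h A d Q)
    (hA : ∀ hh : h < Q.length, ∀ v, G.Adj Q[h] v → A' v → A v ∨ d v ≠ 0) : Bfs G s h A' d Q :=
  { H with current := fun hh v hv hv' => (hA hh v hv hv').elim (H.current hh v hv) id }

/-- No label in the queue exceeds that of the current point by more than one, so the new label is a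
largest one and the queue stays sorted. -/
theorem Bfs.visit (H : Bfs G s h A d Q) (hh : h < Q.length) {w : W} (hw : d w = 0)
    (hadj : G.Adj Q[h] w) (hA : ∀ v, G.Adj Q[h] v → A' v → A v ∨ v = w) :
    Bfs G s h A' (Function.update d w (d Q[h] + 1)) (Q ++ [w]) := by
  have hwQ : w ∉ Q := fun hc => (H.mem_iff w).1 hc hw
  have hd : ∀ v ∈ Q, Function.update d w (d Q[h] + 1) v = d v := fun v hv =>
    Function.update_of_ne (by rintro rfl; exact hwQ hv) _ _
  have hdQ : ∀ i (hi : i < Q.length), Function.update d w (d Q[h] + 1) Q[i] = d Q[i] :=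
    fun i hi => hd _ (List.getElem_mem hi)
  have hle : ∀ v ∈ Q ++ [w], Function.update d w (d Q[h] + 1) v ≤ d Q[h] + 1 := by
    intro v hv
    rcases List.mem_append.1 hv with hv | hv
    · rw [hd v hv]; exact H.near hh v hv
    · rw [List.mem_singleton.1 hv, Function.update_self]
  refine ⟨?_, fun v => ?_, ?_, fun v t hv => ?_, ?_, fun hh' v hv => ?_, fun i hi hih v hv => ?_,
    fun hh' v hv hv' => ?_⟩
  · simpa [List.nodup_append] using ⟨H.nodup, fun a ha haw => hwQ (haw ▸ ha)⟩
  · by_cases hvw : v = w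
    · simp [hvw]
    · simp [hvw, H.mem_iff]
  · rw [hd s ((H.mem_iff s).2 (by rw [H.source]; exact one_ne_zero)), H.source]
  · by_cases hvw : v = w
    · subst hvw
      rw [Function.update_self] at hv
      obtain ⟨t', ht'⟩ := Nat.exists_eq_succ_of_ne_zero
        ((H.mem_iff _).1 (List.getElem_mem hh))
      obtain rfl : t = t' + 1 := by omega
      exact edist_le_succ_iff.2 (Or.inr ⟨_, H.sound _ _ ht', hadj⟩)
    · rw [Function.update_of_ne hvw] at hv
      exact H.sound v t hv
  · rw [List.pairwise_append]
    refine ⟨H.mono.imp_of_mem fun ha hb hab => by rwa [hd _ ha, hd _ hb], by simp, ?_⟩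
    intro a ha b hb
    rw [List.mem_singleton.1 hb, Function.update_self]
    exact hle a (List.mem_append_left _ ha)
  · rw [List.getElem_append_left hh, hdQ]
    exact hle v hv
  · have hi' : i < Q.length := by omega
    rw [List.getElem_append_left hi'] at hv ⊢
    obtain ⟨h1, h2⟩ := H.done i hi' hih v hv
    rw [hd v ((H.mem_iff v).2 h1), hdQ]
    exact ⟨h1, h2⟩
  · rw [List.getElem_append_left hh] at hv
    by_cases hvw : v = w
    · simp [hvw]
    · rw [Function.update_of_ne hvw]
      exact H.current hh v hv ((hA v hv hv').resolve_right hvw)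

/-- Labels are sorted along the queue, so the bound relative to the old position implies the one
relative to the next. Positions beyond the end of the queue are allowed, which covers the idle
passes of the program. -/
theorem Bfs.next (H : Bfs G s h A d Q) (hA : ∀ hh : h < Q.length, ∀ v, G.Adj Q[h] v → A v) :
    Bfs G s (h + 1) (fun _ => False) d Q := by
  refine { H with near := fun hh v hv => ?_, done := fun i hi hih v hv => ?_,
                  current := fun _ _ _ hf => hf.elim }
  · have h1 := H.near (by omega) v hv
    have h2 : d Q[h] ≤ d Q[h + 1] := List.pairwise_iff_getElem.1 H.mono _ _ _ _ (by omega)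
    omega
  · rcases Nat.lt_succ_iff_lt_or_eq.1 hih with h1 | rfl
    · exact H.done i hi h1 v hv
    · have h1 := H.current hi v hv (hA hi v hv)
      exact ⟨h1, H.near hi v ((H.mem_iff v).2 h1)⟩

/-- The queue has no repetitions, so after `card W` positions all of it has been processed. Then
neighbors of labeled points are labeled, with a label larger by at most one, and induction on the
distance bounds all labels from above. -/
theorem Bfs.label_le_iff (H : Bfs G s h A d Q) (hh : Fintype.card W ≤ h) (v : W) (t : ℕ) :
    (d v ≠ 0 ∧ d v ≤ t + 1) ↔ G.edist s v ≤ t := by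
  constructor
  · rintro ⟨h0, h1⟩
    obtain ⟨t', ht'⟩ := Nat.exists_eq_succ_of_ne_zero h0
    exact (H.sound v t' ht').trans (by exact_mod_cast (by omega : t' ≤ t))
  · intro hv
    induction t generalizing v with
    | zero =>
      obtain rfl : s = v := by simpa using hv
      simp [H.source]
    | succ t ih =>
      rcases edist_le_succ_iff.1 hv with hv | ⟨w, hw, hwv⟩
      · have := ih v hv
        exact ⟨this.1, by omega⟩
      · obtain ⟨h0, h1⟩ := ih w hw
        obtain ⟨i, hi, rfl⟩ := List.getElem_of_mem ((H.mem_iff w).2 h0)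
        have := H.nodup.length_le_card
        obtain ⟨h2, h3⟩ := H.done i hi (by omega) v hwv
        exact ⟨h2, by omega⟩

end Search

/-! ### Breadth first search from every kept point, in the machine -/

section SearchProgram

/-- Write the labels of breadth first searches from all points into array `12`. -/
def searchCmd : Cmd :=
  .loop 15 (var 2)
    (.store 12 (var 15) (var 15) (.const 1) ;;
    put 13 (.const 0) (var 15) ;;
    setVar 14 (.const 1) ;;
    .loop 16 (var 2)
      (.cond (.lt (var 16) (var 14))
        (setVar 51 (get 13 (var 16)) ;;
        .loop 17 .numColors
          (setVar 52 (.load 9 (var 51) (var 17)) ;;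
          .cond (.conj (.lt (.const 0) (var 52))
              (.eq (.load 12 (var 15) (.minus (var 52) (.const 1))) (.const 0)))
            (.store 12 (var 15) (.minus (var 52) (.const 1))
              (.plus (.load 12 (var 15) (var 51)) (.const 1)) ;;
            put 13 (var 14) (.minus (var 52) (.const 1)) ;;
            setVar 14 (.plus (var 14) (.const 1))) .skip))
        .skip))

variable {V : Type*} [MetricSpace V] {n m : ℕ} {pt : Fin n ≃ V} {color : V → Fin m}
  {k T : ℕ} {ℓ u : Fin m → ℕ} {τ : ℝ} {U : Finset V} {e : Fin U.card ≃ {x // x ∈ U}}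

/-- Array `12` contains the distances in the graph, plus one. -/
def DistanceTable (r : ℝ) (e : Fin U.card ≃ {x // x ∈ U}) (M : Mem) : Prop :=
  ∀ (p q : Fin U.card) (t : ℕ),
    (M (12, p, q) ≠ 0 ∧ M (12, p, q) ≤ t + 1) ↔ (nearGraph U r).edist (e p) (e q) ≤ t

/-- The memory contains the state of a breadth first search from the point with number `s`. -/
def SearchState (e : Fin U.card ≃ {x // x ∈ U}) (G : SimpleGraph {x // x ∈ U}) (s : Fin U.card)
    (h : ℕ) (A : {x // x ∈ U} → Prop) (M : Mem) : Prop :=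
  ∃ Q : List {x // x ∈ U}, M (14, 0, 0) = Q.length ∧
    (∀ (i : ℕ) (hi : i < Q.length), M (13, i, 0) = e.symm Q[i]) ∧
    Bfs G (e s) h A (fun v => M (12, s, e.symm v)) Q

-- A queue position is processed by scanning the `m` cells of one row of the neighbor table; the
-- points treated after `c` cells are those of color less than `c`. This gives `O(N² m)` for all
-- sources.
open Classical in
theorem spec_searchCmd {r : ℝ} {M : Mem} (hP : Points pt e M)
    (h9 : NeighborTable color r e (fun _ _ => True) M) (h12 : ∀ p q, M (12, p, q) = 0) :
    Spec (encode pt color ℓ u k T τ) searchCmd M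
      (U.card * (U.card * (m * 100 + 100) + 100) + 100) (DistanceTable r e) := by
  set I := encode pt color ℓ u k T τ with hI
  set G := nearGraph U r with hG
  unfold searchCmd
  have hN : (var 2).eval I M = U.card := by simpa [NExpr.eval] using hP.1
  refine Spec.loop (U.card * (m * 100 + 100) + 99) (fun r M' =>
    (∀ p : Fin U.card, (p : ℕ) < r → ∀ (q : Fin U.card) (t : ℕ),
      (M' (12, p, q) ≠ 0 ∧ M' (12, p, q) ≤ t + 1) ↔ G.edist (e p) (e q) ≤ t) ∧
    ∀ p q, r ≤ p → M' (12, p, q) = 0) ?_ ?_ ?_ ?_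
  · exact ⟨fun p hp => absurd hp (Nat.not_lt_zero _), fun p q _ => h12 p q⟩
  · rintro s M₁ hs ⟨hdone, hzero⟩ hF
    rw [hN] at hs
    have hP₁ := hP.frame hF (by decide) (by decide)
    have h9₁ := h9.congr fun p c => hF 9 p c (by decide)
    refine Spec.seq 10 (U.card * (m * 100 + 100) + 80) (Spec.store ?_ (by decide)) (by omega)
    refine Spec.seq 10 (U.card * (m * 100 + 100) + 70) (Spec.store ?_ (by decide)) (by omega)
    refine Spec.seq 10 (U.card * (m * 100 + 100) + 60) (Spec.store ?_ (by decide)) (by omega)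
    simp only [NExpr.eval, Function.update_apply, Prod.mk.injEq, Nat.reduceEqDiff, false_and,
      if_false, and_self, if_true]
    set M₂ : Mem := Function.update (Function.update (Function.update
      (Function.update M₁ (15, 0, 0) s) (12, s, s) 1) (13, 0, 0) s) (14, 0, 0) 1 with hM₂
    have hP₂ : Points pt e M₂ := (((hP₁.update (by decide) (by decide) _ _ _).update
      (by decide) (by decide) _ _ _).update (by decide) (by decide) _ _ _).update
      (by decide) (by decide) _ _ _
    have h9₂ := h9₁.congr (M' := M₂) fun p c => by simp [hM₂, Function.update_apply]
    have hN₂ : (var 2).eval I M₂ = U.card := by simpa [NExpr.eval] using hP₂.1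
    have h15 : M₂ (15, 0, 0) = s := by simp [hM₂, Function.update_apply]
    have hinit : SearchState e G ⟨s, hs⟩ 0 (fun _ => False) M₂ := by
      refine ⟨[e ⟨s, hs⟩], by simp [hM₂], fun i hi => ?_, ?_⟩
      · obtain rfl : i = 0 := by simpa using hi
        simp [hM₂, Function.update_apply]
      · convert Bfs.init (G := G) (s := e ⟨s, hs⟩) using 1
        ext v
        by_cases hv : v = e ⟨s, hs⟩
        · simp [hM₂, Function.update_apply, hv]
        · have : (e.symm v : ℕ) ≠ s := fun hc => hv (by
            have : e.symm v = ⟨s, hs⟩ := Fin.ext hc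
            rw [← this, Equiv.apply_symm_apply])
          simp [hM₂, Function.update_apply, hv, this, hzero]
    have hrest : ∀ p q, p ≠ s → M₂ (12, p, q) = M₁ (12, p, q) := fun p q hp => by
      simp [hM₂, Function.update_apply, hp]
    clear_value M₂
    refine Spec.loop (m * 100 + 99) (fun h M' => SearchState e G ⟨s, hs⟩ h (fun _ => False) M' ∧
      ∀ p q, p ≠ s → M' (12, p, q) = M₁ (12, p, q)) ⟨hinit, hrest⟩ ?_ ?_ ?_
    · rintro h M₃ hh ⟨⟨Q, hQlen, hQ, hB⟩, hrest₃⟩ hF₃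
      have h14 : (Function.update M₃ (16, 0, 0) h) (14, 0, 0) = Q.length := by
        simpa [Function.update_apply] using hQlen
      refine Spec.cond (m * 100 + 80) (fun hlt => ?_) (fun hlt => ?_) ?_
      · replace hlt : h < Q.length := by
          simpa [BExpr.holds, NExpr.eval, hQlen] using hlt
        refine Spec.seq 10 (m * 100 + 60) (Spec.store ?_ (by decide)) (by omega)
        simp only [NExpr.eval, Function.update_apply, Prod.mk.injEq, Nat.reduceEqDiff, false_and,
          if_false, and_self, if_true]
        set M₄ : Mem := Function.update (Function.update M₃ (16, 0, 0) h) (51, 0, 0) (M₃ (13, h, 0))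
          with hM₄
        have h9₄ : NeighborTable color r e (fun _ _ => True) M₄ := h9₂.congr fun p c => by
          simp [hM₄, Function.update_apply, hF₃ 9 p c (by decide)]
        have h15₄ : M₄ (15, 0, 0) = s := by
          simp [hM₄, Function.update_apply, hF₃ 15 0 0 (by decide), h15]
        have hstart : (∃ (Q : List {x // x ∈ U}) (hh : h < Q.length), M₄ (14, 0, 0) = Q.length ∧
            (∀ (i : ℕ) (hi : i < Q.length), M₄ (13, i, 0) = e.symm Q[i]) ∧
            Bfs G (e ⟨s, hs⟩) h (fun v => (color v : ℕ) < 0) (fun v => M₄ (12, s, e.symm v)) Q ∧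
            M₄ (51, 0, 0) = e.symm Q[h]) ∧ ∀ p q, p ≠ s → M₄ (12, p, q) = M₁ (12, p, q) := by
          refine ⟨⟨Q, hlt, by simpa [hM₄, Function.update_apply] using hQlen, fun i hi => ?_, ?_, ?_⟩,
            fun p q hp => ?_⟩
          · simpa [hM₄, Function.update_apply] using hQ i hi
          · simpa [hM₄, Function.update_apply] using hB
          · simpa [hM₄, Function.update_apply] using hQ h hlt
          · simpa [hM₄, Function.update_apply] using hrest₃ p q hp
        clear_value M₄
        refine Spec.loop 95 (fun c M' => (∃ (Q : List {x // x ∈ U}) (hh : h < Q.length),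
            M' (14, 0, 0) = Q.length ∧
            (∀ (i : ℕ) (hi : i < Q.length), M' (13, i, 0) = e.symm Q[i]) ∧
            Bfs G (e ⟨s, hs⟩) h (fun v => (color v : ℕ) < c) (fun v => M' (12, s, e.symm v)) Q ∧
            M' (51, 0, 0) = e.symm Q[h]) ∧ ∀ p q, p ≠ s → M' (12, p, q) = M₁ (12, p, q))
          hstart ?_ ?_ ?_
        · rintro c M₅ hc ⟨⟨Q, hh, hQlen, hQ, hB, h51⟩, hrest₅⟩ hF₅
          have h9₅ : NeighborTable color r e (fun _ _ => True) M₅ :=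
            h9₄.congr fun p c => hF₅ 9 p c (by decide)
          have h15₅ : M₅ (15, 0, 0) = s := (hF₅ 15 0 0 (by decide)).trans h15₄
          refine Spec.seq 10 70 (Spec.store ?_ (by decide)) (by omega)
          simp only [NExpr.eval, Function.update_apply, Prod.mk.injEq, Nat.reduceEqDiff, false_and,
            if_false, and_self, if_true, h51]
          have hsound := h9₅.sound (e.symm Q[h]) c
          refine Spec.cond 50 (fun hif => ?_) (fun hif => ?_) (by decide)
          · simp only [BExpr.holds, NExpr.eval, Function.update_apply, Prod.mk.injEq,
              Nat.reduceEqDiff, false_and, if_false, and_self, if_true, h15₅] at hif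
            obtain ⟨q, hq⟩ := Nat.exists_eq_succ_of_ne_zero hif.1.ne'
            obtain ⟨w, rfl, hadj, -⟩ := hsound q hq
            rw [hq, Nat.succ_sub_one] at hif
            rw [Equiv.apply_symm_apply] at hadj
            have hw0 : (fun v => M₅ (12, s, e.symm v)) (e w) = 0 := by simpa using hif.2
            refine Spec.seq 20 30 (Spec.store ?_ (by decide)) (by omega)
            refine Spec.seq 10 20 (Spec.store ?_ (by decide)) (by omega)
            refine Spec.store ?_ (by decide)
            simp only [NExpr.eval, Function.update_apply, Prod.mk.injEq, Nat.reduceEqDiff,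
              false_and, if_false, and_self, if_true, h15₅, h51, hq, hQlen, Nat.succ_sub_one]
            refine ⟨⟨Q ++ [e w], by simp; omega, by simp, fun i hi => ?_, ?_, ?_⟩, fun p q hp => ?_⟩
            · by_cases hi' : i < Q.length
              · rw [List.getElem_append_left hi']
                simp [hi'.ne, hQ i hi']
              · obtain rfl : i = Q.length := by
                  rw [List.length_append, List.length_singleton] at hi; omega
                simp
            · have hvisit := Bfs.visit (A' := fun v : {x // x ∈ U} => (color v : ℕ) < c + 1) hB hh hw0 hadj
                fun v hv hvc => by
                  rcases Nat.lt_succ_iff_lt_or_eq.1 hvc with hvc | hvc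
                  · exact Or.inl hvc
                  · right
                    have h1 := h9₅.complete (e.symm Q[h]) (e.symm v) trivial (by simpa using hv)
                    rw [Equiv.apply_symm_apply, hvc, hq, Nat.succ_inj] at h1
                    rw [Fin.ext h1, Equiv.apply_symm_apply]
              convert hvisit using 1
              ext v
              by_cases hv : v = e w
              · simp [hv]
              · have : (e.symm v : ℕ) ≠ w := fun hc => hv (by
                  have : e.symm v = w := Fin.ext hc
                  rw [← this, Equiv.apply_symm_apply])
                simp [hv, this]
            · rw [List.getElem_append_left hh]
            · simpa [hp] using hrest₅ p q hp
          · simp only [BExpr.holds, NExpr.eval, Function.update_apply, Prod.mk.injEq,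
              Nat.reduceEqDiff, false_and, if_false, and_self, if_true, h15₅] at hif
            refine Spec.skip ⟨⟨Q, hh, by simpa [Function.update_apply] using hQlen,
              fun i hi => ?_, ?_, ?_⟩, fun p q hp => ?_⟩ (by omega)
            · simpa [Function.update_apply] using hQ i hi
            · simp only [Function.update_apply, Prod.mk.injEq, Nat.reduceEqDiff, false_and,
                if_false]
              refine hB.weaken fun _ v hv hvc => ?_
              rcases Nat.lt_succ_iff_lt_or_eq.1 hvc with hvc | hvc
              · exact Or.inl hvc
              · right
                have h1 := h9₅.complete (e.symm Q[h]) (e.symm v) trivial (by simpa using hv)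
                rw [Equiv.apply_symm_apply, hvc] at h1
                rw [h1] at hif
                simpa using hif
            · simpa [Function.update_apply] using h51
            · simpa [Function.update_apply] using hrest₅ p q hp
        · rintro M₅ ⟨⟨Q, hh, hQlen, hQ, hB, -⟩, hrest₅⟩ -
          exact ⟨⟨Q, hQlen, hQ, hB.next fun _ v _ => (color v).2⟩, hrest₅⟩
        · show m * 96 + (NExpr.numColors.cost + 1) ≤ _
          simp only [NExpr.cost]
          omega
      -- The queue is exhausted, and the remaining passes of the counting loop do nothing.
      · replace hlt : ¬ h < Q.length := by
          simpa [BExpr.holds, NExpr.eval, hQlen] using hlt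
        refine Spec.skip ⟨⟨Q, h14, fun i hi => ?_, ?_⟩, fun p q hp => ?_⟩ (by omega)
        · simpa [Function.update_apply] using hQ i hi
        · simpa [Function.update_apply] using hB.next fun hh => absurd hh hlt
        · simpa [Function.update_apply] using hrest₃ p q hp
      · simp only [BExpr.cost, NExpr.cost]
        omega
    · rw [hN₂]
      rintro M₃ ⟨⟨Q, -, -, hB⟩, hrest₃⟩ -
      refine ⟨fun p hp q t => ?_, fun p q hp => ?_⟩
      · rcases Nat.lt_succ_iff_lt_or_eq.1 hp with hp | hp
        · rw [hrest₃ p q hp.ne]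
          exact hdone p hp q t
        · obtain rfl : p = ⟨s, hs⟩ := Fin.ext hp
          simpa using hB.label_le_iff (by simp) (e q) t
      · rw [hrest₃ p q (by omega)]
        exact hzero p q (by omega)
    · rw [hN₂]
      simp only [NExpr.cost]
      linarith
  · rw [hN]
    rintro M' ⟨h, -⟩ - p q t
    exact h p p.2 q t
  · rw [hN]
    simp only [NExpr.cost]
    linarith

end SearchProgram

/-! ## The parameters of the main loop -/

section SetupProgram

/-- `1 / (c α)`. -/
def inverseExpr (c : ℕ) : RExpr :=
  .divide (.cast (.const 1)) (.times (.cast (.const c))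
    (.divide (.sqrt (.log (.cast .numColors))) (.cast .numColors)))

/-- Compute `Δ₁` in array `18` and `Δ₂` in array `19`. -/
def radiusCmd : Cmd :=
  setVar 18 (.const 1) ;;
  .loop 20 .numColors
    (.cond (.rlt (inverseExpr 4) (.cast (.plus (var 20) (.const 1)))) .skip
      (setVar 18 (.plus (var 20) (.const 1))) ;;
    .cond (.rlt (inverseExpr 2) (.cast (.plus (var 20) (.const 1)))) .skip
      (setVar 19 (.plus (var 20) (.const 1))))

/-- Compute `T * m` in array `21`. -/
def roundsCmd : Cmd := .loop 22 .repetitions (setVar 21 (.plus (var 21) .numColors))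

/-- Compute the sum of the lower bounds in array `50`. -/
def lowerSumCmd : Cmd := .loop 53 .numColors (setVar 50 (.plus (var 50) (.lower (var 53))))

variable {V : Type*} [MetricSpace V] {n m : ℕ} {pt : Fin n ≃ V} {color : V → Fin m}
  {k T : ℕ} {ℓ u : Fin m → ℕ} {τ : ℝ}

theorem eval_inverseExpr (M : Mem) (c : ℕ) :
    (inverseExpr c).eval (encode pt color ℓ u k T τ) M = 1 / (c * alpha m) := by
  simp [inverseExpr, RExpr.eval, NExpr.eval, encode, alpha]

/-- Real numbers occur only in comparisons, so floors are found by search: `x < r + 1` holds if and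
only if `⌊x⌋ < r + 1`, and the last `r + 1` that fails this test is `⌊x⌋`. As `Δ₂ ≤ m`, scanning up
to `m` suffices. -/
theorem spec_radiusCmd (hm : 2 ≤ m) {M : Mem} (h19 : M (19, 0, 0) = 0) :
    Spec (encode pt color ℓ u k T τ) radiusCmd M (m * 100 + 100) fun M' =>
      M' (18, 0, 0) = radiusMin m ∧ M' (19, 0, 0) = radiusMax m := by
  set I := encode pt color ℓ u k T τ with hI
  have hα := alpha_pos hm
  obtain ⟨a, ha⟩ : ∃ a, a = ⌊1 / (4 * alpha m)⌋₊ := ⟨_, rfl⟩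
  obtain ⟨b, hb⟩ : ∃ b, b = ⌊1 / (2 * alpha m)⌋₊ := ⟨_, rfl⟩
  have ha' : ∀ r : ℕ, 1 / (((4 : ℕ) : ℝ) * alpha m) < ((r + 1 : ℕ) : ℝ) ↔ a < r + 1 := by
    intro r
    rw [ha, Nat.floor_lt (by positivity), Nat.cast_ofNat]
  have hb' : ∀ r : ℕ, 1 / (((2 : ℕ) : ℝ) * alpha m) < ((r + 1 : ℕ) : ℝ) ↔ b < r + 1 := by
    intro r
    rw [hb, Nat.floor_lt (by positivity), Nat.cast_ofNat]
  refine Spec.seq 10 (m * 100 + 90) (Spec.store ?_ (by decide)) (by omega)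
  simp only [NExpr.eval]
  refine Spec.loop 99 (fun r M' => M' (18, 0, 0) = max (min r a) 1 ∧
    M' (19, 0, 0) = min r b) ?_ ?_ ?_ ?_
  · simp [Function.update_apply, h19]
  · rintro r M₁ hr ⟨h18, h19⟩ -
    have h4 := ha' r
    have h2 := hb' r
    refine Spec.seq 45 45 ?_ (by omega)
    refine Spec.cond 20 (fun h => ?_) (fun h => ?_) (by decide)
    · refine Spec.skip ?_ (by decide)
      simp only [BExpr.holds, RExpr.eval, hI, eval_inverseExpr, NExpr.eval,
        Function.update_apply, if_true, h4] at h
      refine Spec.cond 20 (fun h' => ?_) (fun h' => ?_) (by decide)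
      · refine Spec.skip ?_ (by decide)
        simp only [BExpr.holds, RExpr.eval, hI, eval_inverseExpr, NExpr.eval,
          Function.update_apply, if_true, h2] at h'
        simp only [Function.update_apply, Prod.mk.injEq, Nat.reduceEqDiff, false_and, if_false,
          h18, h19]
        omega
      · refine Spec.store ?_ (by decide)
        simp only [BExpr.holds, RExpr.eval, hI, eval_inverseExpr, NExpr.eval,
          Function.update_apply, if_true, h2] at h'
        simp only [Function.update_apply, Prod.mk.injEq, Nat.reduceEqDiff, false_and, if_false,
          h18, h19, NExpr.eval, if_true]
        omega
    · refine Spec.store ?_ (by decide)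
      simp only [BExpr.holds, RExpr.eval, hI, eval_inverseExpr, NExpr.eval,
        Function.update_apply, if_true, h4] at h
      simp only [NExpr.eval, Function.update_apply, if_true]
      refine Spec.cond 20 (fun h' => ?_) (fun h' => ?_) (by decide)
      · refine Spec.skip ?_ (by decide)
        simp only [BExpr.holds, RExpr.eval, hI, eval_inverseExpr, NExpr.eval,
          Function.update_apply, Prod.mk.injEq, Nat.reduceEqDiff, false_and, if_false,
          if_true, h2] at h'
        simp only [Function.update_apply, Prod.mk.injEq, Nat.reduceEqDiff, false_and, if_false,
          h18, h19, and_self, if_true]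
        omega
      · refine Spec.store ?_ (by decide)
        simp only [BExpr.holds, RExpr.eval, hI, eval_inverseExpr, NExpr.eval,
          Function.update_apply, Prod.mk.injEq, Nat.reduceEqDiff, false_and, if_false,
          if_true, h2] at h'
        simp only [Function.update_apply, Prod.mk.injEq, Nat.reduceEqDiff, false_and, if_false,
          h18, h19, NExpr.eval, and_self, if_true]
        omega
  · rintro M₁ ⟨h18, h19⟩ -
    have h1 : b ≤ m := hb ▸ radiusMax_le hm
    have h2 : a ≤ m :=
      ha ▸ (le_max_left _ _).trans ((radiusMin_le_radiusMax hm).trans (radiusMax_le hm))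
    have h3 : NExpr.numColors.eval I (Function.update M (18, 0, 0) 1) = m := rfl
    rw [h3, min_eq_right h2] at h18
    rw [h3, min_eq_right h1] at h19
    exact ⟨h18.trans (by rw [radiusMin, ha]), h19.trans hb⟩
  · show m * 100 + (NExpr.numColors.cost + 1) ≤ _
    simp only [NExpr.cost]
    omega

/-- There is no integer multiplication, so `T * m` is a sum of `T` terms; the time `O(T)` is
affordable. -/
theorem spec_roundsCmd {M : Mem} (h21 : M (21, 0, 0) = 0) :
    Spec (encode pt color ℓ u k T τ) roundsCmd M (T * 100 + 100) fun M' =>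
      M' (21, 0, 0) = T * m := by
  refine Spec.loop 99 (fun r M' => M' (21, 0, 0) = r * m) (by simpa using h21) ?_ ?_ ?_
  · intro r M₁ hr h _
    refine Spec.store ?_ (by decide)
    simp [NExpr.eval, Function.update_apply, h, encode]
    ring
  · exact fun M' h _ => h
  · show T * 100 + (NExpr.repetitions.cost + 1) ≤ _
    simp only [NExpr.cost]
    omega

theorem spec_lowerSumCmd {M : Mem} (h50 : M (50, 0, 0) = 0) :
    Spec (encode pt color ℓ u k T τ) lowerSumCmd M (m * 100 + 100) fun M' =>
      M' (50, 0, 0) = ∑ j, ℓ j := by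
  set I := encode pt color ℓ u k T τ with hI
  refine Spec.loop 99 (fun r M' => M' (50, 0, 0) = ∑ j ∈ Finset.range r, I.lower j)
    (by simpa using h50) ?_ ?_ ?_
  · intro r M₁ hr h _
    refine Spec.store ?_ (by decide)
    simp [NExpr.eval, Function.update_apply, h, Finset.sum_range_succ]
  · intro M' h _
    rw [h]
    show ∑ j ∈ Finset.range m, I.lower j = _
    rw [Finset.sum_range]
    exact Finset.sum_congr rfl fun j _ => by simp [hI, encode]
  · show m * 100 + (NExpr.numColors.cost + 1) ≤ _
    simp only [NExpr.cost]
    omega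

end SetupProgram

/-! ## Random permutations -/

section Uniform

/-- Two independent uniform draws are one uniform draw from the product, which may be transported
along any bijection; it is applied to `shuffleEquiv`. -/
theorem uniform_bind_map {α β κ δ : Type*} [Fintype α] [Nonempty α] [Fintype β] [Nonempty β]
    [Fintype κ] [Nonempty κ] (φ : α × β ≃ κ) (g : α → β → δ) :
    ((PMF.uniformOfFintype α).bind fun a => (PMF.uniformOfFintype β).map (g a)) =
      (PMF.uniformOfFintype κ).map fun c => g (φ.symm c).1 (φ.symm c).2 := by
  classical
  ext d
  simp only [PMF.bind_apply, PMF.map_apply, PMF.uniformOfFintype_apply, tsum_fintype]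
  rw [← φ.sum_comp, Fintype.sum_prod_type]
  simp only [Equiv.symm_apply_apply, Finset.mul_sum, mul_ite, mul_zero]
  rw [← Fintype.card_congr φ, Fintype.card_prod, Nat.cast_mul,
    ENNReal.mul_inv (Or.inr (ENNReal.natCast_ne_top _)) (Or.inl (ENNReal.natCast_ne_top _))]

theorem uniform_map_equiv {α β : Type*} [Fintype α] [Nonempty α] [Fintype β] [Nonempty β]
    (φ : α ≃ β) : (PMF.uniformOfFintype α).map φ = PMF.uniformOfFintype β := by
  classical
  ext b
  simp only [PMF.map_apply, PMF.uniformOfFintype_apply, tsum_fintype]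
  rw [Finset.sum_eq_single (φ.symm b)]
  · simp [Fintype.card_congr φ]
  · intro a _ ha
    rw [if_neg]
    rintro rfl
    exact ha (by simp)
  · simp

/-- Extend a permutation of `{0, …, i - 1}` to `{0, …, i}`, fixing `i`. -/
def extendPerm {i : ℕ} (σ : Equiv.Perm (Fin i)) : Equiv.Perm (Fin (i + 1)) :=
  (finSuccEquivLast.trans (Equiv.optionCongr σ)).trans finSuccEquivLast.symm

theorem extendPerm_last {i : ℕ} (σ : Equiv.Perm (Fin i)) :
    extendPerm σ (Fin.last i) = Fin.last i := by
  simp [extendPerm]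

theorem extendPerm_castSucc {i : ℕ} (σ : Equiv.Perm (Fin i)) (x : Fin i) :
    extendPerm σ x.castSucc = (σ x).castSucc := by
  simp [extendPerm]

/-- The bijection behind the inside-out shuffle. -/
def shuffleEquiv (i : ℕ) : Equiv.Perm (Fin i) × Fin (i + 1) ≃ Equiv.Perm (Fin (i + 1)) :=
  Equiv.ofBijective (fun q => (Equiv.swap q.2 (Fin.last i)).trans (extendPerm q.1)) <| by
    rw [Fintype.bijective_iff_injective_and_card]
    constructor
    · rintro ⟨σ, y⟩ ⟨σ', y'⟩ h
      have h1 : ∀ x, extendPerm σ (Equiv.swap y (Fin.last i) x) =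
          extendPerm σ' (Equiv.swap y' (Fin.last i) x) := fun x => Equiv.congr_fun h x
      -- The drawn position is recovered as the preimage of the last point; then `σ` is recovered on
      -- the other points. Surjectivity follows by counting, `i! * (i + 1) = (i + 1)!`.
      have hy : y = y' := by
        have h2 := h1 y
        rw [Equiv.swap_apply_left, extendPerm_last] at h2
        have h3 := (extendPerm σ').injective ((extendPerm_last σ').trans h2)
        have h4 := congrArg (Equiv.swap y' (Fin.last i)) h3
        simpa using h4.symm
      subst hy
      have h2 : ∀ x, extendPerm σ x = extendPerm σ' x := fun x => by
        have := h1 (Equiv.swap y (Fin.last i) x)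
        simpa using this
      refine Prod.ext (Equiv.ext fun x => ?_) rfl
      have := h2 x.castSucc
      rw [extendPerm_castSucc, extendPerm_castSucc] at this
      exact Fin.castSucc_injective _ this
    · rw [Fintype.card_prod, Fintype.card_perm, Fintype.card_perm, Fintype.card_fin,
        Fintype.card_fin, Nat.factorial_succ, mul_comm]

theorem shuffleEquiv_apply {i : ℕ} (σ : Equiv.Perm (Fin i)) (y x : Fin (i + 1)) :
    shuffleEquiv i (σ, y) x = extendPerm σ (Equiv.swap y (Fin.last i) x) := rfl

end Uniform

/-! ### The inside-out shuffle in the machine -/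

section ShuffleProgram

theorem exec_draw_seq (I : Input) {a b : ℕ} {i j x : NExpr} {c : Cmd} (hc : c.drawFree = true)
    {s : Config} (hx : x.eval I s.mem = b) :
    (Cmd.seq (.draw a i j x) c).exec I s = (PMF.uniformOfFintype (Fin (b + 1))).map fun y =>
      ⟨(c.det I (Function.update s.mem (a, i.eval I s.mem, j.eval I s.mem) (y : ℕ))).1,
        s.time + (i.cost + j.cost + x.cost + 1) +
          (c.det I (Function.update s.mem (a, i.eval I s.mem, j.eval I s.mem) (y : ℕ))).2⟩ := by
  subst hx
  show (((PMF.uniformOfFintype (Fin (x.eval I s.mem + 1))).bind fun y => PMF.pure (y : ℕ)).map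
    fun y => (s.write a (i.eval I s.mem) (j.eval I s.mem) y).tick
      (i.cost + j.cost + x.cost + 1)).bind (c.exec I) = _
  simp only [PMF.map, PMF.bind_bind, PMF.pure_bind, Function.comp, Cmd.exec_eq_pure I c hc]
  rfl

/-- Write a uniformly random permutation into array `25`. -/
def shuffleCmd : Cmd :=
  .loop 27 (var 2)
    (.draw 26 (.const 0) (.const 0) (var 27) ;;
    put 25 (var 27) (get 25 (var 26)) ;;
    put 25 (var 26) (var 27))

/-- Write a uniformly random radius into array `28`. -/
def drawRadiusCmd : Cmd :=
  .draw 28 (.const 0) (.const 0) (.minus (var 19) (var 18)) ;;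
  setVar 28 (.plus (var 28) (var 18))

/-- What the shuffle of `i` points does to the configuration `s`. -/
structure Shuffled (s : Config) (i : ℕ) (σ : Equiv.Perm (Fin i)) (s' : Config) : Prop where
  perm : ∀ x : Fin i, s'.mem (25, x, 0) = σ x
  frame : Frame [27, 26, 25] s.mem s'.mem
  time_le : s'.time ≤ s.time + i * 50

/-- Pass `i` draws `y ≤ i`, moves entry `y` to place `i` and writes `i` to place `y`, which is the
map of `shuffleEquiv i`. Hence the whole configuration is a deterministic function of one uniform
permutation. The function is kept abstract, since stale values of the drawing cell are also part of
it. -/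
theorem iterate_shuffle (I : Input) (s : Config) (i : ℕ) :
    ∃ F : Equiv.Perm (Fin i) → Config,
      iterate (fun r s' => Cmd.exec I (.draw 26 (.const 0) (.const 0) (var 27) ;;
        put 25 (var 27) (get 25 (var 26)) ;; put 25 (var 26) (var 27))
          ((s'.write 27 0 0 r).tick 1)) i s = (PMF.uniformOfFintype _).map F ∧
      ∀ σ, Shuffled s i σ (F σ) := by
  induction i with
  | zero =>
    refine ⟨fun _ => s, ?_, fun σ => ⟨fun x => x.elim0, Frame.refl _ _, by simp⟩⟩
    rw [iterate]
    exact (PMF.map_const _ _).symm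
  | succ i ih =>
    obtain ⟨F, hF, hS⟩ := ih
    let c : Cmd := put 25 (var 27) (get 25 (var 26)) ;; put 25 (var 26) (var 27)
    let G : Config → ℕ → Config := fun s' y =>
      ⟨(c.det I (Function.update (Function.update s'.mem (27, 0, 0) i) (26, 0, 0) y)).1,
        -- The exact cost of a pass: the loop tick, the draw and the two assignments.
        s'.time + 1 + 6 + 18⟩
    have hG : ∀ s' y, (G s' y).mem = Function.update (Function.update (Function.update
        (Function.update s'.mem (27, 0, 0) i) (26, 0, 0) y) (25, i, 0) (s'.mem (25, y, 0)))
          (25, y, 0) i := by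
      intro s' y
      simp [G, c, Cmd.det, NExpr.eval, Function.update_apply]
    refine ⟨fun τ => G (F ((shuffleEquiv i).symm τ).1) ((shuffleEquiv i).symm τ).2, ?_, ?_⟩
    · rw [iterate, hF, PMF.bind_map, ← uniform_bind_map (shuffleEquiv i) fun σ y => G (F σ) y]
      congr 1
      funext σ
      rw [Function.comp, exec_draw_seq (b := i) I (by decide) (by
        simp [NExpr.eval, Config.write, Config.tick])]
      rfl
    · intro τ
      obtain ⟨⟨σ, y⟩, rfl⟩ := (shuffleEquiv i).surjective τ
      have h := hS σ
      simp only [Equiv.symm_apply_apply]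
      refine ⟨fun x => ?_, ?_, ?_⟩
      · rw [shuffleEquiv_apply]
        rcases eq_or_ne x y with rfl | hxy
        · rw [Equiv.swap_apply_left, extendPerm_last]
          simp [hG]
        · have h1 : (x : ℕ) ≠ y := fun h => hxy (Fin.ext h)
          rcases Fin.eq_castSucc_or_eq_last x with ⟨z, rfl⟩ | rfl
          · rw [Equiv.swap_apply_of_ne_of_ne hxy (Fin.castSucc_lt_last z).ne, extendPerm_castSucc]
            have h2 := z.2.ne
            rw [Fin.val_castSucc] at h1
            simpa [hG, Function.update_apply, h1, h2] using h.perm z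
          · rw [Equiv.swap_apply_right]
            have h3 : y ≠ Fin.last i := hxy.symm
            obtain ⟨z, rfl⟩ := Fin.exists_castSucc_eq.2 h3
            rw [extendPerm_castSucc]
            have h2 := z.2.ne
            simpa [hG, Function.update_apply, h2, h2.symm] using h.perm z
      · rw [hG]
        exact (((h.frame.update (by decide) _ _ _).update (by decide) _ _ _).update
          (by decide) _ _ _).update (by decide) _ _ _
      · have := h.time_le
        simp only [G]
        linarith

end ShuffleProgram

/-! ### The random order and the random radius of one repetition -/

section DrawProgram

variable {V : Type*} [MetricSpace V] {n m : ℕ} {pt : Fin n ≃ V} {color : V → Fin m}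
  {k T : ℕ} {ℓ u : Fin m → ℕ} {τ : ℝ} {U : Finset V} {e : Fin U.card ≃ {x // x ∈ U}}

theorem exec_shuffleCmd (I : Input) {s : Config} (hP : Points pt e s.mem) :
    ∃ F : (Fin U.card ≃ {x // x ∈ U}) → Config,
      shuffleCmd.exec I s = (randomOrder U).map F ∧
      ∀ π, (∀ j, (F π).mem (25, (j : Fin U.card), 0) = (e.symm (π j) : ℕ)) ∧
        Frame [27, 26, 25] s.mem (F π).mem ∧ (F π).time ≤ s.time + (U.card * 50 + 4) := by
  obtain ⟨F, hF, hS⟩ := iterate_shuffle I (s.tick 4) U.card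
  refine ⟨fun π => F (π.trans e.symm), ?_, fun π => ⟨(hS _).perm, (hS _).frame, ?_⟩⟩
  · have h1 : shuffleCmd.exec I s = iterate (fun r s' => Cmd.exec I
        (.draw 26 (.const 0) (.const 0) (var 27) ;;
        put 25 (var 27) (get 25 (var 26)) ;; put 25 (var 26) (var 27))
          ((s'.write 27 0 0 r).tick 1)) (s.mem (2, 0, 0)) (s.tick 4) := rfl
    rw [h1, hP.1, hF]
    let : Fintype (Fin U.card ≃ {x // x ∈ U}) := Fintype.ofFinite _
    have : Nonempty (Fin U.card ≃ {x // x ∈ U}) := ⟨e⟩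
    -- The memory holds a permutation of indices; composing with the fixed enumeration `e` gives a
    -- uniform order of `U`.
    let φ : Equiv.Perm (Fin U.card) ≃ (Fin U.card ≃ {x // x ∈ U}) :=
      ⟨fun σ => σ.trans e, fun π => π.trans e.symm, fun σ => by ext; simp, fun π => by ext; simp⟩
    have h2 : randomOrder U = (PMF.uniformOfFintype (Equiv.Perm (Fin U.card))).map φ :=
      (uniform_map_equiv φ).symm
    rw [h2, PMF.map_comp]
    congr 1
    funext σ
    exact congrArg F (φ.symm_apply_apply σ).symm
  · exact (hS _).time_le.trans (by simp only [Config.tick]; omega)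

theorem randomRadius_eq_map (hm : 2 ≤ m) : randomRadius m =
    (PMF.uniformOfFintype (Fin (radiusMax m - radiusMin m + 1))).map
      fun y : Fin _ => (y : ℕ) + radiusMin m := by
  have h := radiusMin_le_radiusMax hm
  rw [randomRadius, dif_pos (Finset.nonempty_Icc.2 h)]
  ext R
  rw [PMF.uniformOfFinset_apply, PMF.map_apply, tsum_fintype]
  simp only [PMF.uniformOfFintype_apply, Fintype.card_fin, Nat.card_Icc, Finset.mem_Icc]
  have hcard : radiusMax m + 1 - radiusMin m = radiusMax m - radiusMin m + 1 := by omega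
  split_ifs with hR
  · rw [Finset.sum_eq_single (⟨R - radiusMin m, by omega⟩ : Fin (radiusMax m - radiusMin m + 1)),
      hcard, if_pos (by simp only; omega)]
    · intro y _ hy
      exact if_neg fun h' => hy (Fin.ext (by simp only; omega))
    · simp
  · refine (Finset.sum_eq_zero fun y _ => if_neg ?_).symm
    rintro rfl
    have := y.2
    omega

theorem exec_drawRadiusCmd (hm : 2 ≤ m) (I : Input) {s : Config}
    (h18 : s.mem (18, 0, 0) = radiusMin m) (h19 : s.mem (19, 0, 0) = radiusMax m) :
    ∃ F : ℕ → Config, drawRadiusCmd.exec I s = (randomRadius m).map F ∧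
      ∀ R, radiusMin m ≤ R → (F R).mem (28, 0, 0) = R ∧ Frame [28] s.mem (F R).mem ∧
        (F R).time ≤ s.time + 20 := by
  -- The drawn number is `R - Δ₁`, so the configuration is a function of the radius alone.
  refine ⟨fun R => ⟨Function.update (Function.update s.mem (28, 0, 0) (R - radiusMin m))
    (28, 0, 0) (R - radiusMin m + radiusMin m), s.time + 20⟩, ?_, fun R hR => ⟨?_, ?_, le_rfl⟩⟩
  · rw [drawRadiusCmd, exec_draw_seq (b := radiusMax m - radiusMin m) I (by decide)
      (by simp [NExpr.eval, h18, h19]), randomRadius_eq_map hm, PMF.map_comp]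
    congr 1
    funext y
    simp [Cmd.det, NExpr.eval, NExpr.cost, h18, Function.update_apply]
  · simpa using Nat.sub_add_cancel hR
  · exact ((Frame.refl _ _).update (by decide) _ _ _).update (by decide) _ _ _

/-- The law of the random choices of one repetition. -/
def randomChoice (m : ℕ) (U : Finset V) : PMF ((Fin U.card ≃ {x // x ∈ U}) × ℕ) :=
  (randomOrder U).bind fun π => (randomRadius m).map fun R => (π, R)

theorem decompose_eq_map (γ : ℝ) : decompose m U γ =
    (randomChoice m U).map fun q => cluster U (γ * alpha m) q.1 q.2 := by
  simp [decompose, randomChoice, PMF.map_bind, PMF.map_comp, Function.comp_def]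

theorem mem_support_randomRadius (hm : 2 ≤ m) {R : ℕ} (hR : R ∈ (randomRadius m).support) :
    radiusMin m ≤ R ∧ R ≤ radiusMax m := by
  rw [randomRadius, dif_pos (Finset.nonempty_Icc.2 (radiusMin_le_radiusMax hm)),
    PMF.mem_support_uniformOfFinset_iff, Finset.mem_Icc] at hR
  exact hR

theorem mem_support_randomChoice (hm : 2 ≤ m) {q : (Fin U.card ≃ {x // x ∈ U}) × ℕ}
    (hq : q ∈ (randomChoice m U).support) : radiusMin m ≤ q.2 := by
  simp only [randomChoice, PMF.mem_support_bind_iff, PMF.mem_support_map_iff] at hq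
  obtain ⟨π, -, R, hR, rfl⟩ := hq
  exact (mem_support_randomRadius hm hR).1

theorem exec_draws (hm : 2 ≤ m) (I : Input) {s : Config} (hP : Points pt e s.mem)
    (h18 : s.mem (18, 0, 0) = radiusMin m) (h19 : s.mem (19, 0, 0) = radiusMax m) :
    ∃ F : (Fin U.card ≃ {x // x ∈ U}) × ℕ → Config,
      (shuffleCmd ;; drawRadiusCmd).exec I s = (randomChoice m U).map F ∧
      ∀ q, radiusMin m ≤ q.2 →
        (∀ j, (F q).mem (25, (j : Fin U.card), 0) = (e.symm (q.1 j) : ℕ)) ∧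
        (F q).mem (28, 0, 0) = q.2 ∧ Frame [28, 27, 26, 25] s.mem (F q).mem ∧
          (F q).time ≤ s.time + (U.card * 50 + 24) := by
  obtain ⟨F, hF, hS⟩ := exec_shuffleCmd I hP
  have h : ∀ π, ∃ F' : ℕ → Config, drawRadiusCmd.exec I (F π) = (randomRadius m).map F' ∧
      ∀ R, radiusMin m ≤ R → (F' R).mem (28, 0, 0) = R ∧ Frame [28] (F π).mem (F' R).mem ∧
        (F' R).time ≤ (F π).time + 20 := fun π =>
    exec_drawRadiusCmd hm I (((hS π).2.1 _ _ _ (by decide)).trans h18)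
      (((hS π).2.1 _ _ _ (by decide)).trans h19)
  choose F' hF' hS' using h
  refine ⟨fun q => F' q.1 q.2, ?_, fun q hq => ⟨fun j => ?_, (hS' q.1 q.2 hq).1, ?_, ?_⟩⟩
  · show (shuffleCmd.exec I s).bind (drawRadiusCmd.exec I) = _
    rw [hF, PMF.bind_map, randomChoice, PMF.map_bind]
    refine congrArg _ (funext fun π => ?_)
    rw [Function.comp, hF', PMF.map_comp]
    rfl
  · rw [(hS' q.1 q.2 hq).2.1 _ _ _ (by decide)]
    exact (hS q.1).1 j
  · exact ((hS q.1).2.1.mono (by decide)).trans ((hS' q.1 q.2 hq).2.1.mono (by decide))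
  · have h1 := (hS q.1).2.2
    have h2 := (hS' q.1 q.2 hq).2.2
    show (F' q.1 q.2).time ≤ _
    omega

end DrawProgram

/-! ## The clusters -/

section ClusterProgram

/-- Write into the cell `(v, 0)` of array `29` the number of the cluster that contains the point with
number `v`, plus `1`, or `0` if there is none. -/
def clusterCmd : Cmd :=
  .loop 31 (var 2)
    (put 29 (var 31) (.const 0) ;; setVar 30 (.const 0) ;;
    .loop 32 (var 2)
      (.cond (.conj (.eq (var 30) (.const 0))
          (.conj (.lt (.const 0) (.load 12 (get 25 (var 32)) (var 31)))
            (.lt (.load 12 (get 25 (var 32)) (var 31)) (.plus (var 28) (.const 2)))))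
        (setVar 30 (.const 1) ;;
        .cond (.lt (.load 12 (get 25 (var 32)) (var 31)) (.plus (var 28) (.const 1)))
          (put 29 (var 31) (.plus (var 32) (.const 1))) .skip) .skip))

variable {V : Type*} [MetricSpace V] {n m : ℕ} {pt : Fin n ≃ V} {color : V → Fin m}
  {k T : ℕ} {ℓ u : Fin m → ℕ} {τ : ℝ} {U : Finset V} {e : Fin U.card ≃ {x // x ∈ U}}

/-- Array `29` contains the numbers of the clusters of the points. -/
structure Labels (e : Fin U.card ≃ {x // x ∈ U}) (D : Fin U.card → Finset V) (M : Mem) : Prop where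
  label : ∀ v j : Fin U.card, M (29, v, 0) = (j : ℕ) + 1 ↔ (e v : V) ∈ D j
  le : ∀ v, M (29, v, 0) ≤ U.card
  high : ∀ v, U.card ≤ v → M (29, v, 0) = 0

/-- For each point the centers are scanned in the random order, and the flag in cell `30` stops at
the first one within `R`. The table holds distances plus one with `0` for infinity, so the bounds `R
+ 2` and `R + 1` in the tests mean distance at most `R` and less than `R`. -/
theorem spec_clusterCmd (I : Input) {r : ℝ} {π : Fin U.card ≃ {x // x ∈ U}} {R : ℕ} {M : Mem}
    (hR : 1 ≤ R) (h2 : M (2, 0, 0) = U.card)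
    (h25 : ∀ j : Fin U.card, M (25, j, 0) = (e.symm (π j) : ℕ)) (h28 : M (28, 0, 0) = R)
    (h12 : DistanceTable r e M) (h29 : ∀ v, U.card ≤ v → M (29, v, 0) = 0) :
    Spec I clusterCmd M (U.card * (U.card * 100 + 100) + 100)
      (Labels e (cluster U r π R)) := by
  set G := nearGraph U r with hG
  unfold clusterCmd
  have hN : (var 2).eval I M = U.card := by simpa [NExpr.eval] using h2
  refine Spec.loop (U.card * 100 + 99) (fun x M' =>
    (∀ v j : Fin U.card, (v : ℕ) < x → (M' (29, v, 0) = (j : ℕ) + 1 ↔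
      (e v : V) ∈ cluster U r π R j)) ∧ (∀ v, v < x → M' (29, v, 0) ≤ U.card) ∧
    ∀ v, U.card ≤ v → M' (29, v, 0) = 0) ?_ ?_ ?_ ?_
  · exact ⟨fun v j hv => by omega, fun v hv => by omega, h29⟩
  · intro x M₁ hx ⟨hlab, hle, hhigh⟩ hF
    rw [hN] at hx
    refine Spec.seq 10 (U.card * 100 + 80) (Spec.store ?_ (by decide)) (by omega)
    refine Spec.seq 10 (U.card * 100 + 70) (Spec.store ?_ (by decide)) (by omega)
    have hN₁ : M₁ (2, 0, 0) = U.card := (hF _ _ _ (by decide)).trans h2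
    obtain ⟨M₂, hM₂⟩ : ∃ M₂, M₂ = Function.update (Function.update
      (Function.update M₁ (31, 0, 0) x) (29, x, 0) 0) (30, 0, 0) 0 := ⟨_, rfl⟩
    simp only [NExpr.eval, Function.update_self]
    rw [← hM₂]
    have hN₂ : (var 2).eval I M₂ = U.card := by
      simpa [NExpr.eval, hM₂, Function.update_apply] using hN₁
    set v : Fin U.card := ⟨x, hx⟩ with hv
    refine Spec.loop 99 (fun y M' =>
      (∀ i, i ≠ x → M' (29, i, 0) = M₂ (29, i, 0)) ∧
      ((M' (30, 0, 0) = 0 ∧ (∀ i : Fin U.card, (i : ℕ) < y → ¬ G.edist (π i) (e v) ≤ R) ∧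
          M' (29, x, 0) = 0) ∨
        (M' (30, 0, 0) = 1 ∧ ∃ i : Fin U.card, G.edist (π i) (e v) ≤ R ∧
          (∀ j < i, ¬ G.edist (π j) (e v) ≤ R) ∧
          (G.edist (π i) (e v) < R → M' (29, x, 0) = (i : ℕ) + 1) ∧
          (¬ G.edist (π i) (e v) < R → M' (29, x, 0) = 0)))) ?_ ?_ ?_ ?_
    · exact ⟨fun _ _ => rfl, Or.inl ⟨by simp [hM₂], fun i hi => by omega, by
        simp [hM₂, Function.update_apply]⟩⟩
    · intro y M₃ hy ⟨hother, hinv⟩ hF₃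
      rw [hN₂] at hy
      set j : Fin U.card := ⟨y, hy⟩ with hj
      have h31 : M₃ (31, 0, 0) = x := by
        rw [hF₃ _ _ _ (by decide), hM₂]; simp [Function.update_apply]
      have h28' : M₃ (28, 0, 0) = R := by
        rw [hF₃ _ _ _ (by decide), hM₂]
        simpa [Function.update_apply] using (hF _ _ _ (by decide)).trans h28
      have h25' : M₃ (25, y, 0) = (e.symm (π j) : ℕ) := by
        rw [hF₃ _ _ _ (by decide), hM₂]
        simpa [Function.update_apply] using (hF 25 y 0 (by decide)).trans (h25 j)
      have h12' : M₃ (12, (e.symm (π j) : ℕ), x) = M (12, (e.symm (π j) : ℕ), x) := by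
        rw [hF₃ _ _ _ (by decide), hM₂]
        simpa [Function.update_apply] using hF 12 _ x (by decide)
      have hd : ∀ t, (M (12, (e.symm (π j) : ℕ), x) ≠ 0 ∧
          M (12, (e.symm (π j) : ℕ), x) ≤ t + 1) ↔ G.edist (π j) (e v) ≤ t := by
        intro t
        have := h12 (e.symm (π j)) v t
        rwa [Equiv.apply_symm_apply] at this
      have hd1 := hd R
      have hd2 := hd (R - 1)
      -- The table answers only weak inequalities; as `R ≥ 1`, the strict one is the weak one for `R
      -- - 1`.
      have hlt : G.edist (π j) (e v) < R ↔ G.edist (π j) (e v) ≤ (R - 1 : ℕ) := by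
        rw [← ENat.lt_natCast_add_one_iff]
        norm_cast
        rw [Nat.sub_add_cancel hR]
      rw [← hlt] at hd2
      set dd := M (12, (e.symm (π j) : ℕ), x) with hdd
      refine Spec.cond 40 (fun h => ?_) (fun h => ?_) (by decide)
      · refine Spec.seq 4 30 (Spec.store ?_ (by decide)) (by decide)
        simp only [BExpr.holds, NExpr.eval, Function.update_apply, h31, h28', h25', h12',
          Prod.mk.injEq, Nat.reduceEqDiff, false_and, if_false, and_self, if_true] at h
        rcases hinv with ⟨h30, hfar, h29x⟩ | ⟨h30, -⟩
        swap
        · omega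
        have hnear : G.edist (π j) (e v) ≤ R := hd1.1 ⟨by omega, by omega⟩
        have hfirst : ∀ j' < j, ¬ G.edist (π j') (e v) ≤ R := fun j' hj' => hfar j' hj'
        refine Spec.cond 10 (fun h' => ?_) (fun h' => ?_) (by decide)
        · refine Spec.store ?_ (by decide)
          simp only [BExpr.holds, NExpr.eval, Function.update_apply, h31, h28', h25', h12',
            Prod.mk.injEq, Nat.reduceEqDiff, false_and, if_false, and_self, if_true] at h'
          simp only [NExpr.eval, Function.update_apply, h31,
            Prod.mk.injEq, Nat.reduceEqDiff, false_and, if_false, and_self, if_true]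
          refine ⟨fun i hi => ?_, Or.inr ⟨trivial, j, hnear, hfirst, fun _ => ?_, fun hc => ?_⟩⟩
          · simpa [hi] using hother i hi
          · simp [hj]
          · exact absurd (hd2.1 ⟨by omega, by omega⟩) hc
        · refine Spec.skip ?_ (by decide)
          simp only [BExpr.holds, NExpr.eval, Function.update_apply, h31, h28', h25', h12',
            Prod.mk.injEq, Nat.reduceEqDiff, false_and, if_false, and_self, if_true] at h'
          simp only [NExpr.eval, Function.update_apply, h31,
            Prod.mk.injEq, Nat.reduceEqDiff, false_and, if_false, and_self, if_true]
          refine ⟨hother, Or.inr ⟨trivial, j, hnear, hfirst, fun hc => ?_, fun _ => h29x⟩⟩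
          have := hd2.2 hc
          omega
      · refine Spec.skip ?_ (by decide)
        simp only [BExpr.holds, NExpr.eval, Function.update_apply, h31, h28', h25', h12',
          Prod.mk.injEq, Nat.reduceEqDiff, false_and, if_false, and_self, if_true] at h
        simp only [NExpr.eval, Function.update_apply, h31,
          Prod.mk.injEq, Nat.reduceEqDiff, false_and, if_false, and_self, if_true]
        refine ⟨hother, hinv.imp (fun ⟨h30, hfar, h29x⟩ => ⟨h30, fun i hi => ?_, h29x⟩) id⟩
        rcases Nat.lt_succ_iff_lt_or_eq.1 hi with hi | hi
        · exact hfar i hi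
        · rw [show i = j from Fin.ext hi, ← hd1]
          omega
    · rw [hN₂]
      intro M₃ ⟨hother, hinv⟩ hF₃
      have hrest : ∀ i, i ≠ x → M₃ (29, i, 0) = M₁ (29, i, 0) := fun i hi => by
        rw [hother i hi, hM₂]
        simp [Function.update_apply, hi]
      refine ⟨fun w j hw => ?_, fun w hw => ?_, fun w hw => ?_⟩
      · rcases Nat.lt_succ_iff_lt_or_eq.1 hw with hw | hw
        · rw [hrest w hw.ne]
          exact hlab w j hw
        · obtain rfl : w = v := Fin.ext hw
          rw [mem_cluster]
          rcases hinv with ⟨-, hfar, h29x⟩ | ⟨-, i, hi, hfirst, hlt, hnlt⟩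
          · simp only [hv, h29x]
            refine ⟨fun h => by omega, fun ⟨_, h, _⟩ => absurd h.1 (hfar j j.2)⟩
          · constructor
            · intro h
              by_cases hc : G.edist (π i) (e v) < R
              · have h1 := hlt hc
                have : j = i := Fin.ext (by simp only [hv] at h; omega)
                subst this
                exact ⟨(e v).2, ⟨hi, hfirst⟩, hc⟩
              · have h1 := hnlt hc
                simp only [hv] at h
                omega
            · rintro ⟨_, ⟨h1, h2⟩, h3⟩
              have : j = i := by
                rcases lt_trichotomy i j with h | h | h
                · exact absurd hi (h2 i h)
                · exact h.symm
                · exact absurd h1 (hfirst j h)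
              subst this
              exact hlt h3
      · rcases Nat.lt_succ_iff_lt_or_eq.1 hw with hw | hw
        · rw [hrest w hw.ne]
          exact hle w hw
        · subst hw
          rcases hinv with ⟨-, hfar, h29x⟩ | ⟨-, i, hi, hfirst, hlt, hnlt⟩
          · omega
          · by_cases hc : G.edist (π i) (e v) < R
            · rw [hlt hc]; exact i.2
            · rw [hnlt hc]; omega
      · rw [hrest w (by omega)]
        exact hhigh w hw
    · rw [hN₂]
      simp only [NExpr.cost]
      omega
  · rw [hN]
    intro M₁ ⟨hlab, hle, hhigh⟩ _
    exact ⟨fun v j => hlab v j v.2, fun v => (lt_or_ge v U.card).elim (hle v)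
      fun h => (hhigh v h).le.trans (Nat.zero_le _), hhigh⟩
  · rw [hN]
    simp only [NExpr.cost]
    linarith

end ClusterProgram

/-! ## Matching clusters to colors by alternating paths

Points are numbered from `0` to `N - 1`; `cl p` is the number of the cluster of the point `p`, from
`1` to `N`, or `0` if `p` is in no cluster; `c p` is the color of `p`. A matching is a function `f`
such that `f x = p + 1` if the point `p` is chosen from the cluster `x`, and `f x = 0` if no point is
chosen from `x`. -/

section AlternatingPaths

/-- The number of clusters from which a point of color `j` is chosen. -/
def tally (N : ℕ) (c f : ℕ → ℕ) (j : ℕ) : ℕ :=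
  ∑ x ∈ Finset.range (N + 1), if f x ≠ 0 ∧ c (f x - 1) = j then 1 else 0

/-- `f` is a matching. -/
def IsMatch (N : ℕ) (cl f : ℕ → ℕ) : Prop :=
  ∀ x p, f x = p + 1 → p < N ∧ cl p = x ∧ x ≠ 0

/-- The cluster `x` is unmatched or matched to a color in `X`. -/
def Feeds (c f : ℕ → ℕ) (X : Finset ℕ) (x : ℕ) : Prop := ∀ q, f x = q + 1 → c q ∈ X

/-- Every color of a cluster that is unmatched or matched to a color in `X` is in `X`. -/
def Closed (N : ℕ) (cl c f : ℕ → ℕ) (X : Finset ℕ) : Prop :=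
  ∀ p < N, cl p ≠ 0 → Feeds c f X (cl p) → c p ∈ X

/-- `X` consists of colors that can be reached from unmatched clusters by alternating paths, which are
described by `par`, and every color is reached from colors of smaller rank. -/
structure Reached (N m : ℕ) (cl c f par rk : ℕ → ℕ) (X : Finset ℕ) : Prop where
  lt : ∀ j ∈ X, j < m
  rank_lt : ∀ j ∈ X, rk j < X.card
  ne_zero : ∀ j ∈ X, par j ≠ 0
  parent : ∀ j p, par j = p + 1 → j ∈ X ∧ p < N ∧ c p = j ∧ cl p ≠ 0 ∧
    ∀ q, f (cl p) = q + 1 → c q ∈ X ∧ rk (c q) < rk j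

variable {N m : ℕ} {cl c f par rk : ℕ → ℕ} {X Y : Finset ℕ}

theorem tally_zero (j : ℕ) : tally N c (fun _ => 0) j = 0 := by simp [tally]

/-- The old contribution of `x` is added on the left rather than subtracted on the right, as
subtraction of natural numbers truncates. -/
theorem tally_update {x : ℕ} (hx : x ≤ N) (p i : ℕ) :
    tally N c (Function.update f x (p + 1)) i + (if f x ≠ 0 ∧ c (f x - 1) = i then 1 else 0) =
      tally N c f i + if c p = i then 1 else 0 := by
  unfold tally
  have hmem : x ∈ Finset.range (N + 1) := Finset.mem_range.2 (by omega)
  rw [← Finset.add_sum_erase _ _ hmem, ← Finset.add_sum_erase _ _ hmem]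
  have h1 : ∀ y ∈ (Finset.range (N + 1)).erase x,
      (if Function.update f x (p + 1) y ≠ 0 ∧ c (Function.update f x (p + 1) y - 1) = i then 1 else 0)
        = if f y ≠ 0 ∧ c (f y - 1) = i then 1 else 0 := fun y hy => by
    rw [Function.update_of_ne (Finset.ne_of_mem_erase hy)]
  rw [Finset.sum_congr rfl h1]
  simp only [Function.update_self, Nat.add_sub_cancel, ne_eq, Nat.add_one_ne_zero, not_false_eq_true,
    true_and]
  omega

theorem IsMatch.tally_eq_zero (hf : IsMatch N cl f) (hc : ∀ p < N, c p < m) {j : ℕ} (hj : m ≤ j) :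
    tally N c f j = 0 := by
  refine Finset.sum_eq_zero fun x _ => if_neg ?_
  rintro ⟨h1, h2⟩
  obtain ⟨p, hp⟩ := Nat.exists_eq_succ_of_ne_zero h1
  have h3 := hc p (hf x p hp).1
  rw [hp, Nat.succ_sub_one] at h2
  omega

theorem IsMatch.update (hf : IsMatch N cl f) {p : ℕ} (hp : p < N) (hcl : cl p ≠ 0) :
    IsMatch N cl (Function.update f (cl p) (p + 1)) := by
  intro x q hq
  by_cases hx : x = cl p
  · subst hx
    rw [Function.update_self] at hq
    obtain rfl : p = q := by omega
    exact ⟨hp, rfl, hcl⟩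
  · rw [Function.update_of_ne hx] at hq
    exact hf x q hq

theorem Reached.empty : Reached N m cl c f (fun _ => 0) rk ∅ :=
  ⟨by simp, by simp, by simp, fun _ _ h => absurd h.symm (Nat.succ_ne_zero _)⟩

theorem Reached.mem_iff (h : Reached N m cl c f par rk X) {j : ℕ} : j ∈ X ↔ par j ≠ 0 := by
  refine ⟨h.ne_zero j, fun hj => ?_⟩
  obtain ⟨p, hp⟩ := Nat.exists_eq_succ_of_ne_zero hj
  exact (h.parent j p hp).1

/-- The new color gets the rank `X.card`, above all earlier ranks. So ranks decrease strictly along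
parents, and following parents terminates. -/
theorem Reached.insert (h : Reached N m cl c f par rk X) {p : ℕ} (hp : p < N) (hcl : cl p ≠ 0)
    (hc : c p < m) (hpX : c p ∉ X) (hfeed : Feeds c f X (cl p)) :
    Reached N m cl c f (Function.update par (c p) (p + 1)) (Function.update rk (c p) X.card)
      (insert (c p) X) := by
  have hne : ∀ j ∈ X, j ≠ c p := fun j hj h' => hpX (h' ▸ hj)
  refine ⟨fun j hj => ?_, fun j hj => ?_, fun j hj => ?_, fun j q hq => ?_⟩
  · rcases Finset.mem_insert.1 hj with rfl | hj
    exacts [hc, h.lt j hj]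
  · rw [Finset.card_insert_of_notMem hpX]
    rcases Finset.mem_insert.1 hj with rfl | hj
    · simp
    · rw [Function.update_of_ne (hne j hj)]
      exact (h.rank_lt j hj).trans (Nat.lt_succ_self _)
  · rcases Finset.mem_insert.1 hj with rfl | hj
    · simp
    · rw [Function.update_of_ne (hne j hj)]
      exact h.ne_zero j hj
  · by_cases hj : j = c p
    · subst hj
      rw [Function.update_self] at hq
      obtain rfl : p = q := by omega
      refine ⟨Finset.mem_insert_self _ _, hp, rfl, hcl, fun q hq => ?_⟩
      have h1 := hfeed q hq
      refine ⟨Finset.mem_insert_of_mem h1, ?_⟩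
      rw [Function.update_self, Function.update_of_ne (hne _ h1)]
      exact h.rank_lt _ h1
    · rw [Function.update_of_ne hj] at hq
      obtain ⟨h1, h2, h3, h4, h5⟩ := h.parent j q hq
      refine ⟨Finset.mem_insert_of_mem h1, h2, h3, h4, fun q' hq' => ?_⟩
      obtain ⟨h6, h7⟩ := h5 q' hq'
      refine ⟨Finset.mem_insert_of_mem h6, ?_⟩
      rwa [Function.update_of_ne (hne _ h6), Function.update_of_ne hj]

/-- Every closed set contains the reached colors. -/
theorem Reached.subset (h : Reached N m cl c f par rk X) (hY : Closed N cl c f Y) : X ⊆ Y := by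
  have key : ∀ r, ∀ j ∈ X, rk j < r → j ∈ Y := by
    intro r
    induction r with
    | zero => exact fun j _ hj => absurd hj (Nat.not_lt_zero _)
    | succ r ih =>
      intro j hj hr
      obtain ⟨p, hp⟩ := Nat.exists_eq_succ_of_ne_zero (h.ne_zero j hj)
      obtain ⟨-, h2, h3, h4, h5⟩ := h.parent j p hp
      rw [← h3]
      refine hY p h2 h4 fun q hq => ?_
      obtain ⟨h6, h7⟩ := h5 q hq
      exact ih _ h6 (by omega)
  exact fun j hj => key _ j hj (Nat.lt_succ_self _)

/-- An augmentation from the matching `f₀` along the path described by `par`, that increases the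
tally of the color `t`, after `s` steps: `f` is the current matching, and `cur = j + 1` if the color
`j` has lost a cluster that has to be replaced. -/
structure Augmenting (N : ℕ) (cl c par rk : ℕ → ℕ) (X : Finset ℕ) (f₀ : ℕ → ℕ) (t s cur : ℕ)
    (f : ℕ → ℕ) : Prop where
  isMatch : IsMatch N cl f
  changed : ∀ x, f x = f₀ x ∨ Feeds c f₀ X x ∧ Feeds c f X x
  tally : ∀ i, tally N c f i + (if cur = i + 1 then 1 else 0) =
    tally N c f₀ i + if i = t then 1 else 0
  current : ∀ j, cur = j + 1 → j ∈ X ∧ rk j + s < X.card ∧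
    ∀ q p, par q = p + 1 → rk q ≤ rk j → f (cl p) = f₀ (cl p)

theorem Augmenting.start (h : Reached N m cl c f par rk X) (hf : IsMatch N cl f) {t : ℕ}
    (ht : t ∈ X) : Augmenting N cl c par rk X f t 0 (t + 1) f := by
  refine ⟨hf, fun _ => Or.inl rfl, fun i => ?_, fun j hj => ?_⟩
  · simp [eq_comm]
  · obtain rfl : t = j := by omega
    exact ⟨ht, h.rank_lt t ht, fun _ _ _ _ => rfl⟩

/-- The cluster through which `j` was reached is given to `j`. If it was unmatched, the augmentation
ends; otherwise its former color, of smaller rank, is now one cluster short. The last clause of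
`Augmenting` says that the part of the path still ahead is untouched. -/
theorem Augmenting.step {f₀ : ℕ → ℕ} {t s j p : ℕ} (h : Reached N m cl c f₀ par rk X)
    (hcl : ∀ p, cl p ≤ N) (ha : Augmenting N cl c par rk X f₀ t s (j + 1) f) (hp : par j = p + 1) :
    Augmenting N cl c par rk X f₀ t (s + 1)
      (if f (cl p) = 0 then 0 else c (f (cl p) - 1) + 1) (Function.update f (cl p) (p + 1)) := by
  obtain ⟨h1, h2, h3, h4, h5⟩ := h.parent j p hp
  obtain ⟨-, hrank, hsame⟩ := ha.current j rfl
  have hfx := hsame j p hp le_rfl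
  refine ⟨ha.isMatch.update h2 h4, fun x => ?_, fun i => ?_, fun i hi => ?_⟩
  · by_cases hx : x = cl p
    · subst hx
      refine Or.inr ⟨fun q hq => (h5 q hq).1, fun q hq => ?_⟩
      rw [Function.update_self] at hq
      obtain rfl : p = q := by omega
      rwa [h3]
    · rw [Feeds, Feeds, Function.update_of_ne hx]
      exact ha.changed x
  · have h6 := ha.tally i
    have h7 := tally_update (c := c) (f := f) (hcl p) p i
    rw [h3] at h7
    have h8 : (if (if f (cl p) = 0 then 0 else c (f (cl p) - 1) + 1) = i + 1 then 1 else 0) =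
        if f (cl p) ≠ 0 ∧ c (f (cl p) - 1) = i then 1 else 0 := by
      by_cases h9 : f (cl p) = 0 <;> simp [h9]
    have h10 : (if j + 1 = i + 1 then 1 else 0) = if j = i then 1 else 0 := by simp
    rw [h8]
    rw [h10] at h6
    omega
  · have h0 : f (cl p) ≠ 0 := fun h0 => by simp [h0] at hi
    rw [if_neg h0] at hi
    obtain ⟨q, hq⟩ := Nat.exists_eq_succ_of_ne_zero h0
    rw [hq, Nat.succ_sub_one] at hi
    obtain rfl : c q = i := by omega
    obtain ⟨h6, h7⟩ := h5 q (hfx ▸ hq)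
    refine ⟨h6, by omega, fun q' p' hp' hr => ?_⟩
    -- If the same cluster served again for a color `q'` of rank at most that of `c q`, its old
    -- color `c q` would have rank below that of `q'`.
    by_cases hx : cl p' = cl p
    · obtain ⟨-, -, -, -, h8⟩ := h.parent q' p' hp'
      have := (h8 q (by rw [hx, ← hfx, hq])).2
      omega
    · rw [Function.update_of_ne hx]
      exact hsame q' p' hp' (by omega)

theorem Augmenting.idle {f₀ : ℕ → ℕ} {t s : ℕ} (ha : Augmenting N cl c par rk X f₀ t s 0 f) :
    Augmenting N cl c par rk X f₀ t (s + 1) 0 f :=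
  ⟨ha.isMatch, ha.changed, ha.tally, fun _ hj => absurd hj.symm (Nat.succ_ne_zero _)⟩

/-- Each step lowers the rank, and ranks are less than `X.card ≤ m`; so `m` steps complete every
augmentation. -/
theorem Augmenting.eq_zero {f₀ : ℕ → ℕ} {t cur : ℕ} (hX : ∀ j ∈ X, j < m)
    (ha : Augmenting N cl c par rk X f₀ t m cur f) : cur = 0 := by
  by_contra h
  obtain ⟨j, hj⟩ := Nat.exists_eq_succ_of_ne_zero h
  have h1 := (ha.current j hj).2.1
  have h2 : X.card ≤ m := by
    simpa using Finset.card_le_card (fun j hj => Finset.mem_range.2 (hX j hj) : X ⊆ Finset.range m)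
  omega

/-- Augmentations preserve closed sets. -/
theorem Augmenting.closed {f₀ : ℕ → ℕ} {t s cur : ℕ}
    (ha : Augmenting N cl c par rk X f₀ t s cur f) (hXY : X ⊆ Y) (hY : Closed N cl c f₀ Y) :
    Closed N cl c f Y := by
  intro p hp hcl hfeed
  refine hY p hp hcl ?_
  -- A changed cluster was unmatched or matched into `X ⊆ Y` before, so the closedness of `Y` under
  -- the old matching applies to it as well.
  rcases ha.changed (cl p) with h | ⟨h, -⟩
  · rwa [Feeds, ← h]
  · exact fun q hq => hXY (h q hq)

end AlternatingPaths

/-! ## The rounds of the assignment -/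

section Rounds

/-- The state of the assignment after `r` rounds: `f` is a matching, `cnt` are the tallies of the
colors, `tot` is the size of the matching and `ex` is its excess over the lower bounds. Unless the
matching has size `r`, there is a closed set of colors showing that it cannot be extended. -/
structure RoundInv (N m k : ℕ) (cl c ℓ u : ℕ → ℕ) (r : ℕ) (f cnt : ℕ → ℕ) (tot ex : ℕ) : Prop where
  isMatch : IsMatch N cl f
  cnt_eq : ∀ j, cnt j = tally N c f j
  cnt_le : ∀ j, cnt j ≤ u j
  tot_eq : tot = ∑ j ∈ Finset.range m, cnt j
  ex_eq : ex = ∑ j ∈ Finset.range m, (cnt j - ℓ j)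
  ex_le : ex + ∑ j ∈ Finset.range m, ℓ j ≤ k
  -- If some color exceeds its lower bound, a closed set separates the colors that meet their lower
  -- bounds from colors without surplus. This becomes the certificate of optimality as soon as the
  -- slack capacity `k - ∑ ℓ` is used up.
  surplus : (∀ j, cnt j ≤ ℓ j) ∨
    ∃ Y, Closed N cl c f Y ∧ (∀ j ∈ Y, ℓ j ≤ cnt j) ∧ ∀ j ∉ Y, cnt j ≤ ℓ j
  progress : tot = r ∨ ∃ Y, Closed N cl c f Y ∧ ((∀ j ∈ Y, u j ≤ cnt j) ∨
    ((∀ j ∈ Y, ℓ j ≤ cnt j) ∧ (∀ j ∉ Y, cnt j ≤ ℓ j) ∧ k ≤ ex + ∑ j ∈ Finset.range m, ℓ j))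

variable {N m k r tot ex : ℕ} {cl c ℓ u f cnt par rk : ℕ → ℕ} {X : Finset ℕ}

theorem RoundInv.zero (hk : ∑ j ∈ Finset.range m, ℓ j ≤ k) :
    RoundInv N m k cl c ℓ u 0 (fun _ => 0) (fun _ => 0) 0 0 :=
  ⟨fun _ _ h => absurd h.symm (Nat.succ_ne_zero _), fun _ => (tally_zero _).symm,
    fun _ => Nat.zero_le _, by simp, by simp, by simpa using hk, Or.inl fun _ => Nat.zero_le _,
    Or.inl rfl⟩

/-- The matching stays the same if no reached color has room. -/
theorem RoundInv.stay (h : RoundInv N m k cl c ℓ u r f cnt tot ex)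
    (hcl : Closed N cl c f X) (h1 : ∀ j ∈ X, ℓ j ≤ cnt j)
    (h2 : k ≤ ex + ∑ j ∈ Finset.range m, ℓ j ∨ ∀ j ∈ X, u j ≤ cnt j) :
    RoundInv N m k cl c ℓ u (r + 1) f cnt tot ex := by
  refine ⟨h.isMatch, h.cnt_eq, h.cnt_le, h.tot_eq, h.ex_eq, h.ex_le, h.surplus, Or.inr ?_⟩
  rcases h2 with h2 | h2
  · rcases h.surplus with h3 | ⟨Y, hY, h3, h4⟩
    · exact ⟨X, hcl, Or.inr ⟨h1, fun j _ => h3 j, h2⟩⟩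
    · exact ⟨Y, hY, Or.inr ⟨h3, h4, h2⟩⟩
  · exact ⟨X, hcl, Or.inl h2⟩

/-- The matching after an augmentation. -/
theorem RoundInv.augment (h : RoundInv N m k cl c ℓ u r f cnt tot ex) (hlu : ∀ j, ℓ j ≤ u j)
    (hX : Reached N m cl c f par rk X) (hcl : Closed N cl c f X) {t s : ℕ} {f' : ℕ → ℕ} (ht : t ∈ X)
    (h1 : cnt t < ℓ t ∨ (∀ j ∈ X, ℓ j ≤ cnt j) ∧ cnt t < u t ∧
      ex + ∑ j ∈ Finset.range m, ℓ j < k)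
    (ha : Augmenting N cl c par rk X f t s 0 f') :
    RoundInv N m k cl c ℓ u (r + 1) f' (Function.update cnt t (cnt t + 1)) (tot + 1)
      (if cnt t < ℓ t then ex else ex + 1) := by
  have htm : t ∈ Finset.range m := Finset.mem_range.2 (hX.lt t ht)
  -- An augmentation is possible only if no earlier round failed: a certificate `Y` would contain
  -- all reached colors, in particular `t`, and leave no room there.
  have hstuck : tot = r := by
    refine h.progress.resolve_right ?_
    rintro ⟨Y, hY, h2 | ⟨h2, h3, h4⟩⟩
    · have h5 := h2 t (hX.subset hY ht)
      have h6 := hlu t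
      omega
    · have h5 := h2 t (hX.subset hY ht)
      omega
  refine ⟨ha.isMatch, fun j => ?_, fun j => ?_, ?_, ?_, ?_, ?_, Or.inl (by omega)⟩
  · have h2 := ha.tally j
    rw [← h.cnt_eq] at h2
    rw [if_neg (by omega)] at h2
    by_cases hj : j = t
    · subst hj
      rw [Function.update_self]
      simp at h2
      omega
    · rw [Function.update_of_ne hj]
      simp [hj] at h2
      omega
  · by_cases hj : j = t
    · subst hj
      rw [Function.update_self]
      have := hlu j
      omega
    · rw [Function.update_of_ne hj]
      exact h.cnt_le j
  · rw [h.tot_eq, Finset.sum_update_of_mem htm, ← Finset.add_sum_erase _ _ htm,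
      Finset.sdiff_singleton_eq_erase]
    omega
  · have h2 : ∀ j ∈ (Finset.range m).erase t,
        Function.update cnt t (cnt t + 1) j - ℓ j = cnt j - ℓ j := fun j hj => by
      rw [Function.update_of_ne (Finset.ne_of_mem_erase hj)]
    rw [h.ex_eq, ← Finset.add_sum_erase _ _ htm, ← Finset.add_sum_erase _ _ htm,
      Finset.sum_congr rfl h2, Function.update_self]
    split_ifs <;> omega
  · have := h.ex_le
    split_ifs <;> omega
  -- If `t` is below its lower bound, no separating set exists, since it would contain `t`; so there
  -- is no surplus before or after. Otherwise all reached colors meet their lower bounds, and `X`,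
  -- or the previous separating set, which contains `X`, separates after the augmentation.
  · by_cases hlt : cnt t < ℓ t
    · rcases h.surplus with h2 | ⟨Y, hY, h2, -⟩
      · refine Or.inl fun j => ?_
        by_cases hj : j = t
        · subst hj; rw [Function.update_self]; exact hlt
        · rw [Function.update_of_ne hj]; exact h2 j
      · have := h2 t (hX.subset hY ht)
        omega
    · right
      have h3 := h1.resolve_left hlt
      have key : ∀ Y, X ⊆ Y → Closed N cl c f Y → (∀ j ∈ Y, ℓ j ≤ cnt j) →
          (∀ j ∉ Y, cnt j ≤ ℓ j) → ∃ Y, Closed N cl c f' Y ∧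
          (∀ j ∈ Y, ℓ j ≤ Function.update cnt t (cnt t + 1) j) ∧
          ∀ j ∉ Y, Function.update cnt t (cnt t + 1) j ≤ ℓ j := by
        intro Y hXY hY h4 h5
        refine ⟨Y, ha.closed hXY hY, fun j hj => ?_, fun j hj => ?_⟩
        · by_cases hjt : j = t
          · subst hjt; rw [Function.update_self]; exact (h4 j hj).trans (Nat.le_succ _)
          · rw [Function.update_of_ne hjt]; exact h4 j hj
        · rw [Function.update_of_ne (fun h' : j = t => hj (h'.symm ▸ hXY ht))]
          exact h5 j hj
      rcases h.surplus with h2 | ⟨Y, hY, h4, h5⟩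
      · exact key X subset_rfl hcl h3.1 fun j _ => h2 j
      · exact key Y (hX.subset hY) hY h4 h5

/-- After `k` rounds there is a closed set that shows that the matching cannot be extended. -/
theorem RoundInv.exists_closed (h : RoundInv N m k cl c ℓ u k f cnt tot ex)
    (hc : ∀ p < N, c p < m) :
    ∃ Y, Closed N cl c f Y ∧ ((∀ j ∈ Y, u j ≤ cnt j) ∨
      ((∀ j ∈ Y, ℓ j ≤ cnt j) ∧ (∀ j ∉ Y, cnt j ≤ ℓ j) ∧
        k ≤ ex + ∑ j ∈ Finset.range m, ℓ j)) := by
  rcases h.progress with h1 | h1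
  · have h2 : ∑ j ∈ Finset.range m, cnt j =
        ∑ j ∈ Finset.range m, min (cnt j) (ℓ j) + ∑ j ∈ Finset.range m, (cnt j - ℓ j) := by
      rw [← Finset.sum_add_distrib]
      exact Finset.sum_congr rfl fun j _ => by omega
    have h3 : ∑ j ∈ Finset.range m, min (cnt j) (ℓ j) ≤ ∑ j ∈ Finset.range m, ℓ j :=
      Finset.sum_le_sum fun j _ => min_le_right _ _
    rw [← h.tot_eq, ← h.ex_eq] at h2
    have h4 := h.ex_le
    -- All `k` rounds succeeded. Since the excess is at most `k - ∑ ℓ`, all lower bounds are met,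
    -- and the set of all colors is a certificate of the second kind.
    have h5 : ∑ j ∈ Finset.range m, min (cnt j) (ℓ j) = ∑ j ∈ Finset.range m, ℓ j := by omega
    rw [Finset.sum_eq_sum_iff_of_le fun j _ => min_le_right _ _] at h5
    refine ⟨Finset.range m, fun p hp _ _ => Finset.mem_range.2 (hc p hp),
      Or.inr ⟨fun j hj => min_eq_right_iff.1 (h5 j hj), fun j hj => ?_, by omega⟩⟩
    rw [h.cnt_eq, h.isMatch.tally_eq_zero hc (by simpa using hj)]
    exact Nat.zero_le _
  · exact h1

end Rounds

/-! ## The assignment command -/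

section AssignProgram

/-- Find the colors that can be reached by alternating paths. The cell `(j, 0)` of array `34` becomes
`p + 1` if the color `j` is reached through the point with number `p`. -/
def reachCmd : Cmd :=
  .loop 42 .numColors (put 34 (var 42) (.const 0)) ;;
  .loop 43 .numColors (.loop 44 (var 2)
    (.cond (.conj (.neg (.eq (get 29 (var 44)) (.const 0)))
        (.conj (.eq (get 34 (.color (get 3 (var 44)))) (.const 0))
          (.neg (.conj (.neg (.eq (get 33 (get 29 (var 44))) (.const 0)))
            (.eq (get 34 (.color (get 3 (.minus (get 33 (get 29 (var 44))) (.const 1)))))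
              (.const 0))))))
      (put 34 (.color (get 3 (var 44))) (.plus (var 44) (.const 1))) .skip))

/-- Choose the color whose tally is increased, and write its number, plus `1`, into array `38`. -/
def selectCmd : Cmd :=
  setVar 38 (.const 0) ;;
  setVar 40 (.const 0) ;;
  .loop 45 .numColors
    (.cond (.eq (get 34 (var 45)) (.const 0)) .skip
      (.cond (.lt (get 35 (var 45)) (.lower (var 45))) (setVar 38 (.plus (var 45) (.const 1)))
        (.cond (.lt (get 35 (var 45)) (.upper (var 45))) (setVar 40 (.plus (var 45) (.const 1)))
          .skip))) ;;
  .cond (.conj (.eq (var 38) (.const 0)) (.lt (.plus (var 37) (var 50)) .solutionSize))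
    (setVar 38 (var 40)) .skip

/-- Change the matching along an alternating path. -/
def pathCmd : Cmd :=
  setVar 39 (var 38) ;;
  .loop 46 .numColors
    (.cond (.eq (var 39) (.const 0)) .skip
      (setVar 47 (.minus (get 34 (.minus (var 39) (.const 1))) (.const 1)) ;;
      setVar 48 (get 33 (get 29 (var 47))) ;;
      put 33 (get 29 (var 47)) (.plus (var 47) (.const 1)) ;;
      .cond (.eq (var 48) (.const 0)) (setVar 39 (.const 0))
        (setVar 39 (.plus (.color (get 3 (.minus (var 48) (.const 1)))) (.const 1)))))

/-- Increase the tally of the chosen color, if there is one. -/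
def augmentCmd : Cmd :=
  .cond (.eq (var 38) (.const 0)) .skip
    (pathCmd ;;
    .cond (.lt (get 35 (.minus (var 38) (.const 1))) (.lower (.minus (var 38) (.const 1)))) .skip
      (setVar 37 (.plus (var 37) (.const 1))) ;;
    put 35 (.minus (var 38) (.const 1))
      (.plus (get 35 (.minus (var 38) (.const 1))) (.const 1)) ;;
    setVar 36 (.plus (var 36) (.const 1)))

/-- Find a maximum matching. -/
def matchCmd : Cmd := .loop 41 .solutionSize (reachCmd ;; selectCmd ;; augmentCmd)

/-- The memory contains the clusters and the colors of the points. -/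
structure Setting (I : Input) (N : ℕ) (cl c : ℕ → ℕ) (M : Mem) : Prop where
  card : M (2, 0, 0) = N
  cluster : ∀ p, M (29, p, 0) = cl p
  color : ∀ p, I.color (M (3, p, 0)) = c p

variable {I : Input} {N : ℕ} {cl c f cnt : ℕ → ℕ} {M : Mem}

theorem Setting.congr (h : Setting I N cl c M) {M' : Mem} (h2 : M' (2, 0, 0) = M (2, 0, 0))
    (h3 : ∀ p, M' (3, p, 0) = M (3, p, 0)) (h29 : ∀ p, M' (29, p, 0) = M (29, p, 0)) :
    Setting I N cl c M' :=
  ⟨h2.trans h.card, fun p => (h29 p).trans (h.cluster p), fun p => by rw [h3, h.color]⟩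

theorem Setting.frame (h : Setting I N cl c M) {M' : Mem} {W : List ℕ} (hF : Frame W M M')
    (h2 : 2 ∉ W) (h3 : 3 ∉ W) (h29 : 29 ∉ W) : Setting I N cl c M' :=
  h.congr (hF _ _ _ h2) (fun _ => hF _ _ _ h3) fun _ => hF _ _ _ h29

theorem Setting.update (h : Setting I N cl c M) {a : ℕ} (h2 : 2 ≠ a) (h3 : 3 ≠ a) (h29 : 29 ≠ a)
    (i j x : ℕ) : Setting I N cl c (Function.update M (a, i, j) x) :=
  h.congr (Function.update_of_ne (by simp [h2]) _ _)
    (fun p => Function.update_of_ne (by simp [h3]) _ _)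
    fun p => Function.update_of_ne (by simp [h29]) _ _

theorem Reached.feeds_iff {m : ℕ} {par rk : ℕ → ℕ} {X : Finset ℕ}
    (h : Reached N m cl c f par rk X) (x : ℕ) :
    Feeds c f X x ↔ ¬ (f x ≠ 0 ∧ par (c (f x - 1)) = 0) := by
  constructor
  · rintro h1 ⟨h2, h3⟩
    obtain ⟨q, hq⟩ := Nat.exists_eq_succ_of_ne_zero h2
    rw [hq, Nat.succ_sub_one] at h3
    exact h.mem_iff.1 (h1 q hq) h3
  · intro h1 q hq
    rw [h.mem_iff]
    intro h2
    rw [hq, Nat.add_sub_cancel] at h1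
    exact h1 ⟨Nat.succ_ne_zero q, h2⟩

/-- A pass over all points adds a color or shows that the reached set is closed. After `m` passes it
is closed, or it contains all `m` colors and is closed for that reason. -/
theorem spec_reachCmd (hS : Setting I N cl c M) (hc : ∀ p < N, c p < I.m)
    (h33 : ∀ x, M (33, x, 0) = f x) (h34 : ∀ j, I.m ≤ j → M (34, j, 0) = 0) :
    Spec I reachCmd M (I.m * (N * 100 + 200) + 100) fun M' =>
      ∃ rk X, Reached N I.m cl c f (fun j => M' (34, j, 0)) rk X ∧ Closed N cl c f X := by
  refine Spec.seq (I.m * 20 + 10) (I.m * (N * 100 + 120) + 60) ?_ (by linarith)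
  refine Spec.loop 10 (fun q M' => ∀ j, j < q ∨ I.m ≤ j → M' (34, j, 0) = 0)
    (fun j hj => h34 j (by omega)) ?_ ?_ ?_
  · intro q M₁ hq h _
    refine Spec.store ?_ (by decide)
    intro j hj
    by_cases hjq : j = q
    · simp [NExpr.eval, hjq]
    · simpa [NExpr.eval, hjq, Function.update_apply] using h j (by omega)
  · intro M₁ h hF
    have hzero : (fun j => M₁ (34, j, 0)) = fun _ => 0 :=
      funext fun j => h j (lt_or_ge j I.m)
    replace hS := hS.frame hF (by decide) (by decide) (by decide)
    replace h33 : ∀ x, M₁ (33, x, 0) = f x := fun x => (hF _ _ _ (by decide)).trans (h33 x)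
    refine Spec.loop (N * 100 + 99) (fun s M' =>
      ∃ rk X, Reached N I.m cl c f (fun j => M' (34, j, 0)) rk X ∧
        (Closed N cl c f X ∨ s ≤ X.card)) ?_ ?_ ?_ ?_
    · exact ⟨fun _ => 0, ∅, by rw [hzero]; exact Reached.empty, Or.inr (Nat.zero_le _)⟩
    · intro s M₂ hs h₂ hF₂
      have hN : (var 2).eval I (Function.update M₂ (43, 0, 0) s) = N := by
        simpa [NExpr.eval, Function.update_apply] using (hF₂ _ _ _ (by decide)).trans hS.card
      -- As long as a pass has added nothing, the set is unchanged and the points before `q` satisfy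
      -- the closedness condition.
      refine Spec.loop 90 (fun q M' =>
        ∃ rk X, Reached N I.m cl c f (fun j => M' (34, j, 0)) rk X ∧
          (Closed N cl c f X ∨ s + 1 ≤ X.card ∨ (s ≤ X.card ∧
            ∀ p < q, cl p ≠ 0 → Feeds c f X (cl p) → c p ∈ X))) ?_ ?_ ?_ ?_
      · obtain ⟨rk, X, hX, hcl⟩ := h₂
        refine ⟨rk, X, by simpa [Function.update_apply] using hX, ?_⟩
        exact hcl.imp_right fun h => Or.inr ⟨h, fun p hp => absurd hp (Nat.not_lt_zero _)⟩
      · rintro q M₃ hq ⟨rk, X, hX, hinv⟩ hF₃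
        rw [hN] at hq
        have hS₃ := (hS.frame hF₂ (by decide) (by decide) (by decide)).update (a := 43) (by decide)
          (by decide) (by decide) 0 0 s |>.frame hF₃ (by decide) (by decide) (by decide)
        have h33₃ : ∀ x, M₃ (33, x, 0) = f x := fun x => by
          rw [hF₃ _ _ _ (by decide), ← h33, ← hF₂ 33 x 0 (by decide)]
          simp [Function.update_apply]
        have htest : (BExpr.conj (.neg (.eq (get 29 (var 44)) (.const 0)))
            (.conj (.eq (get 34 (.color (get 3 (var 44)))) (.const 0))
            (.neg (.conj (.neg (.eq (get 33 (get 29 (var 44))) (.const 0)))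
            (.eq (get 34 (.color (get 3 (.minus (get 33 (get 29 (var 44))) (.const 1)))))
              (.const 0)))))).holds I (Function.update M₃ (44, 0, 0) q) ↔
            cl q ≠ 0 ∧ c q ∉ X ∧ Feeds c f X (cl q) := by
          rw [hX.feeds_iff, hX.mem_iff, not_not]
          simp only [BExpr.holds, NExpr.eval, Function.update_apply, hS₃.cluster, hS₃.color, h33₃,
            Prod.mk.injEq, Nat.reduceEqDiff, false_and, if_false, and_self, if_true, ne_eq]
        refine Spec.cond 20 (fun h => ?_) (fun h => ?_) (by decide)
        · rw [htest] at h
          refine Spec.store ?_ (by decide)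
          have hpar : (fun j => (Function.update (Function.update M₃ (44, 0, 0) q)
              (34, c q, 0) (q + 1)) (34, j, 0)) =
              Function.update (fun j => M₃ (34, j, 0)) (c q) (q + 1) := by
            funext j
            simp [Function.update_apply]
          refine ⟨Function.update rk (c q) X.card, insert (c q) X, ?_, ?_⟩
          · have := hX.insert hq h.1 (hc q hq) h.2.1 h.2.2
            rw [← hpar] at this
            simpa [NExpr.eval, hS₃.color, Function.update_apply] using this
          · refine Or.inr (Or.inl ?_)
            rw [Finset.card_insert_of_notMem h.2.1]
            rcases hinv with h1 | h1 | h1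
            · exact absurd (h1 q hq h.1 h.2.2) h.2.1
            · omega
            · omega
        · rw [htest] at h
          refine Spec.skip ?_ (by decide)
          refine ⟨rk, X, by simpa [Function.update_apply] using hX, ?_⟩
          refine hinv.imp_right (Or.imp_right fun ⟨h1, h2⟩ => ⟨h1, fun p hp h3 h4 => ?_⟩)
          rcases Nat.lt_succ_iff_lt_or_eq.1 hp with hp | rfl
          · exact h2 p hp h3 h4
          · by_contra h5
            exact h ⟨h3, h5, h4⟩
      · rw [hN]
        rintro M₃ ⟨rk, X, hX, hinv⟩ _
        refine ⟨rk, X, hX, ?_⟩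
        rcases hinv with h1 | h1 | h1
        · exact Or.inl h1
        · exact Or.inr h1
        · exact Or.inl fun p hp => h1.2 p hp
      · rw [hN]
        simp only [NExpr.cost]
        omega
    · rintro M₂ ⟨rk, X, hX, hinv⟩ _
      refine ⟨rk, X, hX, hinv.elim id fun h1 => ?_⟩
      have h2 : X = Finset.range I.m := Finset.eq_of_subset_of_card_le
        (fun j hj => Finset.mem_range.2 (hX.lt j hj)) (by simpa [NExpr.eval] using h1)
      exact fun p hp _ _ => h2 ▸ Finset.mem_range.2 (hc p hp)
    · simp only [NExpr.eval, NExpr.cost]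
      linarith
  · simp only [NExpr.eval, NExpr.cost]
    omega

/-- Lower bounds have priority: a reached color above its lower bound is increased only if every
reached color meets its lower bound and slack capacity is left. The invariant `RoundInv.surplus`
relies on this order. Cells `38` and `40` hold the candidates of the two kinds. -/
theorem spec_selectCmd {par : ℕ → ℕ} {X : Finset ℕ} {ex L : ℕ} (hX : ∀ j, j ∈ X ↔ par j ≠ 0)
    (hXm : ∀ j ∈ X, j < I.m) (h34 : ∀ j, M (34, j, 0) = par j) (h35 : ∀ j, M (35, j, 0) = cnt j)
    (h37 : M (37, 0, 0) = ex) (h50 : M (50, 0, 0) = L) :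
    Spec I selectCmd M (I.m * 100 + 100) fun M' =>
      (M' (38, 0, 0) = 0 ∧ (∀ j ∈ X, I.lower j ≤ cnt j) ∧
        (I.k ≤ ex + L ∨ ∀ j ∈ X, I.upper j ≤ cnt j)) ∨
      ∃ t ∈ X, M' (38, 0, 0) = t + 1 ∧ (cnt t < I.lower t ∨ (∀ j ∈ X, I.lower j ≤ cnt j) ∧
        cnt t < I.upper t ∧ ex + L < I.k) := by
  refine Spec.seq 4 (I.m * 100 + 90) (Spec.store ?_ (by decide)) (by omega)
  refine Spec.seq 4 (I.m * 100 + 80) (Spec.store ?_ (by decide)) (by omega)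
  refine Spec.seq (I.m * 100 + 4) 70 ?_ (by omega)
  refine Spec.loop 99 (fun q M' =>
    ((M' (38, 0, 0) = 0 ∧ ∀ j ∈ X, j < q → I.lower j ≤ cnt j) ∨
      ∃ t ∈ X, M' (38, 0, 0) = t + 1 ∧ cnt t < I.lower t) ∧
    ((M' (40, 0, 0) = 0 ∧ ∀ j ∈ X, j < q → I.lower j ≤ cnt j → I.upper j ≤ cnt j) ∨
      ∃ t ∈ X, M' (40, 0, 0) = t + 1 ∧ cnt t < I.upper t)) ?_ ?_ ?_ ?_
  · refine ⟨Or.inl ⟨?_, fun j _ hj => by omega⟩, Or.inl ⟨?_, fun j _ hj => by omega⟩⟩ <;>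
      simp [NExpr.eval, Function.update_apply]
  · rintro q M₁ hq ⟨hl, hu⟩ hF
    have h34₁ : ∀ j, M₁ (34, j, 0) = par j := fun j => by
      rw [hF _ _ _ (by decide), ← h34]; simp [Function.update_apply]
    have h35₁ : ∀ j, M₁ (35, j, 0) = cnt j := fun j => by
      rw [hF _ _ _ (by decide), ← h35]; simp [Function.update_apply]
    refine Spec.cond 90 (fun h => ?_) (fun h => ?_) (by decide)
    · simp only [BExpr.holds, NExpr.eval, Function.update_apply, h34₁,
        Prod.mk.injEq, Nat.reduceEqDiff, false_and, if_false, and_self, if_true] at h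
      refine Spec.skip ?_ (by decide)
      have hqX : q ∉ X := fun hqX => (hX q).1 hqX h
      simp only [Function.update_apply, Prod.mk.injEq, Nat.reduceEqDiff, false_and, if_false]
      refine ⟨hl.imp_left fun ⟨h1, h2⟩ => ⟨h1, fun j hj hjq => ?_⟩,
        hu.imp_left fun ⟨h1, h2⟩ => ⟨h1, fun j hj hjq => ?_⟩⟩
      · exact h2 j hj (lt_of_le_of_ne (Nat.lt_succ_iff.1 hjq) fun h3 => hqX (h3 ▸ hj))
      · exact h2 j hj (lt_of_le_of_ne (Nat.lt_succ_iff.1 hjq) fun h3 => hqX (h3 ▸ hj))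
    · simp only [BExpr.holds, NExpr.eval, Function.update_apply, h34₁,
        Prod.mk.injEq, Nat.reduceEqDiff, false_and, if_false, and_self, if_true] at h
      have hqX : q ∈ X := (hX q).2 h
      refine Spec.cond 70 (fun h' => ?_) (fun h' => ?_) (by decide)
      · simp only [BExpr.holds, NExpr.eval, Function.update_apply, h35₁,
          Prod.mk.injEq, Nat.reduceEqDiff, false_and, if_false, and_self, if_true] at h'
        refine Spec.store ?_ (by decide)
        simp only [NExpr.eval, Function.update_apply, Prod.mk.injEq, Nat.reduceEqDiff, false_and,
          if_false, and_self, if_true]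
        refine ⟨Or.inr ⟨q, hqX, rfl, h'⟩, hu.imp_left fun ⟨h1, h2⟩ => ⟨h1, fun j hj hjq h3 => ?_⟩⟩
        rcases Nat.lt_succ_iff_lt_or_eq.1 hjq with hjq | rfl
        · exact h2 j hj hjq h3
        · omega
      · simp only [BExpr.holds, NExpr.eval, Function.update_apply, h35₁,
          Prod.mk.injEq, Nat.reduceEqDiff, false_and, if_false, and_self, if_true, not_lt] at h'
        have hl' : (M₁ (38, 0, 0) = 0 ∧ ∀ j ∈ X, j < q + 1 → I.lower j ≤ cnt j) ∨
            ∃ t ∈ X, M₁ (38, 0, 0) = t + 1 ∧ cnt t < I.lower t := by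
          refine hl.imp_left fun ⟨h1, h2⟩ => ⟨h1, fun j hj hjq => ?_⟩
          rcases Nat.lt_succ_iff_lt_or_eq.1 hjq with hjq | rfl
          exacts [h2 j hj hjq, h']
        refine Spec.cond 20 (fun h'' => ?_) (fun h'' => ?_) (by decide)
        · simp only [BExpr.holds, NExpr.eval, Function.update_apply, h35₁,
            Prod.mk.injEq, Nat.reduceEqDiff, false_and, if_false, and_self, if_true] at h''
          refine Spec.store ?_ (by decide)
          simp only [NExpr.eval, Function.update_apply, Prod.mk.injEq, Nat.reduceEqDiff, false_and,
            if_false, and_self, if_true]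
          exact ⟨hl', Or.inr ⟨q, hqX, rfl, h''⟩⟩
        · simp only [BExpr.holds, NExpr.eval, Function.update_apply, h35₁,
            Prod.mk.injEq, Nat.reduceEqDiff, false_and, if_false, and_self, if_true, not_lt] at h''
          refine Spec.skip ?_ (by decide)
          simp only [NExpr.eval, Function.update_apply, Prod.mk.injEq, Nat.reduceEqDiff, false_and,
            if_false, and_self, if_true]
          refine ⟨hl', hu.imp_left fun ⟨h1, h2⟩ => ⟨h1, fun j hj hjq h3 => ?_⟩⟩
          rcases Nat.lt_succ_iff_lt_or_eq.1 hjq with hjq | rfl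
          exacts [h2 j hj hjq h3, h'']
  · rintro M₁ ⟨hl, hu⟩ hF
    have h37₁ : M₁ (37, 0, 0) = ex := by
      rw [hF _ _ _ (by decide), ← h37]; simp [Function.update_apply]
    have h50₁ : M₁ (50, 0, 0) = L := by
      rw [hF _ _ _ (by decide), ← h50]; simp [Function.update_apply]
    refine Spec.cond 20 (fun h => ?_) (fun h => ?_) (by decide)
    · simp only [BExpr.holds, NExpr.eval, h37₁, h50₁] at h
      have hlow : ∀ j ∈ X, I.lower j ≤ cnt j := by
        rcases hl with ⟨-, h1⟩ | ⟨t, -, h1, -⟩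
        · exact fun j hj => h1 j hj (hXm j hj)
        · omega
      refine Spec.store ?_ (by decide)
      simp only [NExpr.eval, Function.update_self]
      rcases hu with ⟨h1, h2⟩ | ⟨t, ht, h1, h2⟩
      · exact Or.inl ⟨h1, hlow, Or.inr fun j hj => h2 j hj (hXm j hj) (hlow j hj)⟩
      · exact Or.inr ⟨t, ht, h1, Or.inr ⟨hlow, h2, h.2⟩⟩
    · simp only [BExpr.holds, NExpr.eval, h37₁, h50₁, not_and, not_lt] at h
      refine Spec.skip ?_ (by decide)
      rcases hl with ⟨h1, h2⟩ | ⟨t, ht, h1, h2⟩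
      · exact Or.inl ⟨h1, fun j hj => h2 j hj (hXm j hj), Or.inl (h h1)⟩
      · exact Or.inr ⟨t, ht, h1, Or.inl h2⟩
  · simp only [NExpr.eval, NExpr.cost]
    omega

theorem spec_pathCmd {par rk : ℕ → ℕ} {X : Finset ℕ} {t : ℕ} (hS : Setting I N cl c M)
    (hcl : ∀ p, cl p ≤ N) (hX : Reached N I.m cl c f par rk X) (hf : IsMatch N cl f) (ht : t ∈ X)
    (h33 : ∀ x, M (33, x, 0) = f x) (h34 : ∀ j, M (34, j, 0) = par j)
    (h38 : M (38, 0, 0) = t + 1) :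
    Spec I pathCmd M (I.m * 100 + 20) fun M' =>
      Augmenting N cl c par rk X f t I.m 0 fun x => M' (33, x, 0) := by
  refine Spec.seq 10 (I.m * 100 + 10) (Spec.store ?_ (by decide)) (by omega)
  simp only [NExpr.eval, h38]
  refine Spec.loop 99 (fun s M' =>
    Augmenting N cl c par rk X f t s (M' (39, 0, 0)) fun x => M' (33, x, 0)) ?_ ?_ ?_ ?_
  · simp only [Function.update_apply, Prod.mk.injEq, Nat.reduceEqDiff, false_and, if_false, if_true,
      h33]
    exact Augmenting.start hX hf ht
  · intro s M₁ hs ha hF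
    have hS₁ := (hS.update (a := 39) (by decide) (by decide) (by decide) 0 0 (t + 1)).frame hF
      (by decide) (by decide) (by decide)
    have h34₁ : ∀ j, M₁ (34, j, 0) = par j := fun j => by
      rw [hF _ _ _ (by decide), ← h34]; simp [Function.update_apply]
    refine Spec.cond 90 (fun h => ?_) (fun h => ?_) (by decide)
    · simp only [BExpr.holds, NExpr.eval, Function.update_apply, Prod.mk.injEq, Nat.reduceEqDiff,
        false_and, if_false] at h
      refine Spec.skip ?_ (by decide)
      simp only [Function.update_apply, Prod.mk.injEq, Nat.reduceEqDiff, false_and, if_false]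
      rw [h] at ha ⊢
      exact ha.idle
    · simp only [BExpr.holds, NExpr.eval, Function.update_apply, Prod.mk.injEq, Nat.reduceEqDiff,
        false_and, if_false] at h
      obtain ⟨j, hj⟩ := Nat.exists_eq_succ_of_ne_zero h
      rw [hj] at ha
      obtain ⟨p, hp⟩ := Nat.exists_eq_succ_of_ne_zero (hX.ne_zero j (ha.current j rfl).1)
      have hstep := ha.step hX hcl hp
      refine Spec.seq 20 70 (Spec.store ?_ (by decide)) (by decide)
      refine Spec.seq 20 50 (Spec.store ?_ (by decide)) (by decide)
      refine Spec.seq 20 30 (Spec.store ?_ (by decide)) (by decide)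
      simp only [NExpr.eval, Function.update_apply, hj, h34₁, hp, hS₁.cluster, Nat.succ_eq_add_one,
        Nat.add_sub_cancel, Prod.mk.injEq, Nat.reduceEqDiff, false_and, if_false, and_self, if_true]
      have hfun : Function.update (fun x => M₁ (33, x, 0)) (cl p) (p + 1) =
          fun x => if x = cl p then p + 1 else M₁ (33, x, 0) := by
        funext x
        rw [Function.update_apply]
      rw [hfun] at hstep
      refine Spec.cond 20 (fun h' => ?_) (fun h' => ?_) (by decide)
      · refine Spec.store ?_ (by decide)
        simp only [BExpr.holds, NExpr.eval, Function.update_apply, Prod.mk.injEq, Nat.reduceEqDiff,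
          false_and, if_false, and_self, if_true] at h'
        rw [if_pos h'] at hstep
        simpa [NExpr.eval, Function.update_apply] using hstep
      · refine Spec.store ?_ (by decide)
        simp only [BExpr.holds, NExpr.eval, Function.update_apply, Prod.mk.injEq, Nat.reduceEqDiff,
          false_and, if_false, and_self, if_true] at h'
        rw [if_neg h'] at hstep
        simpa [NExpr.eval, Function.update_apply, hS₁.color] using hstep
  · intro M₁ ha _
    have h0 := ha.eq_zero hX.lt
    rwa [h0] at ha
  · simp only [NExpr.eval, NExpr.cost]
    omega

/-- The memory contains the state of the assignment. -/
structure Stored (f cnt : ℕ → ℕ) (tot ex : ℕ) (M : Mem) : Prop where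
  mate : ∀ x, M (33, x, 0) = f x
  count : ∀ j, M (35, j, 0) = cnt j
  total : M (36, 0, 0) = tot
  excess : M (37, 0, 0) = ex

theorem Stored.frame {tot ex : ℕ} (h : Stored f cnt tot ex M) {M' : Mem} {W : List ℕ}
    (hF : Frame W M M') (h33 : 33 ∉ W) (h35 : 35 ∉ W) (h36 : 36 ∉ W) (h37 : 37 ∉ W) :
    Stored f cnt tot ex M' :=
  ⟨fun x => (hF _ _ _ h33).trans (h.mate x), fun j => (hF _ _ _ h35).trans (h.count j),
    (hF _ _ _ h36).trans h.total, (hF _ _ _ h37).trans h.excess⟩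

theorem spec_augmentCmd {par rk : ℕ → ℕ} {X : Finset ℕ} {r tot ex : ℕ} (hS : Setting I N cl c M)
    (hcl : ∀ p, cl p ≤ N) (hlu : ∀ j, I.lower j ≤ I.upper j)
    (hinv : RoundInv N I.m I.k cl c I.lower I.upper r f cnt tot ex) (hst : Stored f cnt tot ex M)
    (hX : Reached N I.m cl c f par rk X) (hclosed : Closed N cl c f X)
    (h34 : ∀ j, M (34, j, 0) = par j)
    (hsel : (M (38, 0, 0) = 0 ∧ (∀ j ∈ X, I.lower j ≤ cnt j) ∧
        (I.k ≤ ex + ∑ j ∈ Finset.range I.m, I.lower j ∨ ∀ j ∈ X, I.upper j ≤ cnt j)) ∨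
      ∃ t ∈ X, M (38, 0, 0) = t + 1 ∧ (cnt t < I.lower t ∨ (∀ j ∈ X, I.lower j ≤ cnt j) ∧
        cnt t < I.upper t ∧ ex + ∑ j ∈ Finset.range I.m, I.lower j < I.k)) :
    Spec I augmentCmd M (I.m * 100 + 100) fun M' => ∃ f cnt tot ex,
      RoundInv N I.m I.k cl c I.lower I.upper (r + 1) f cnt tot ex ∧ Stored f cnt tot ex M' := by
  refine Spec.cond (I.m * 100 + 90) (fun h => ?_) (fun h => ?_) (by simp [BExpr.cost, NExpr.cost]; omega)
  · refine Spec.skip ?_ (by omega)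
    rcases hsel with ⟨-, h1, h2⟩ | ⟨t, -, h1, -⟩
    · exact ⟨f, cnt, tot, ex, hinv.stay hclosed h1 h2, hst⟩
    · exact absurd (h.symm.trans h1) (by simp [NExpr.eval])
  · rcases hsel with ⟨h1, -⟩ | ⟨t, ht, h38, hroom⟩
    · exact absurd h1 h
    refine Spec.seq (I.m * 100 + 20) 70 ?_ (by omega)
    refine (spec_pathCmd hS hcl hX hinv.isMatch ht hst.mate h34 h38).frame.mono le_rfl ?_
    rintro M₁ ⟨ha, hF⟩
    have hnew := hinv.augment hlu hX hclosed ht hroom ha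
    have h38₁ : M₁ (38, 0, 0) = t + 1 := (hF _ _ _ (by decide)).trans h38
    have h35₁ : ∀ j, M₁ (35, j, 0) = cnt j := fun j => (hF _ _ _ (by decide)).trans (hst.count j)
    have h36₁ : M₁ (36, 0, 0) = tot := (hF _ _ _ (by decide)).trans hst.total
    have h37₁ : M₁ (37, 0, 0) = ex := (hF _ _ _ (by decide)).trans hst.excess
    have key : ∀ M₂, Frame [37] M₁ M₂ →
        M₂ (37, 0, 0) = (if cnt t < I.lower t then ex else ex + 1) →
        Spec I (put 35 (.minus (var 38) (.const 1))
            (.plus (get 35 (.minus (var 38) (.const 1))) (.const 1)) ;;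
          setVar 36 (.plus (var 36) (.const 1))) M₂ 40 fun M' => ∃ f cnt tot ex,
        RoundInv N I.m I.k cl c I.lower I.upper (r + 1) f cnt tot ex ∧ Stored f cnt tot ex M' := by
      intro M₂ hF₂ h37₂
      have h38₂ : M₂ (38, 0, 0) = t + 1 := (hF₂ _ _ _ (by decide)).trans h38₁
      have h35₂ : ∀ j, M₂ (35, j, 0) = cnt j := fun j => (hF₂ _ _ _ (by decide)).trans (h35₁ j)
      have h36₂ : M₂ (36, 0, 0) = tot := (hF₂ _ _ _ (by decide)).trans h36₁
      have h33₂ : ∀ x, M₂ (33, x, 0) = M₁ (33, x, 0) := fun x => hF₂ _ _ _ (by decide)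
      refine Spec.seq 20 20 (Spec.store ?_ (by decide)) (by decide)
      refine Spec.store ?_ (by decide)
      refine ⟨_, _, _, _, hnew, fun x => ?_, fun j => ?_, ?_, ?_⟩ <;>
        simp [NExpr.eval, Function.update_apply, h33₂, h35₂, h36₂, h37₂, h38₂]
    refine Spec.seq 30 40 (Spec.cond 10 (fun h' => ?_) (fun h' => ?_) (by decide)) (by omega)
    · simp only [BExpr.holds, NExpr.eval, h38₁, h35₁, Nat.add_sub_cancel] at h'
      exact Spec.skip (key M₁ (Frame.refl _ _) (by rw [if_pos h', h37₁])) (by decide)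
    · simp only [BExpr.holds, NExpr.eval, h38₁, h35₁, Nat.add_sub_cancel] at h'
      refine Spec.store (key _ ((Frame.refl _ _).update (by decide) _ _ _) ?_) (by decide)
      simp [NExpr.eval, h37₁, if_neg h']

/-- The memory after some rounds of the assignment. -/
def RoundState (I : Input) (N : ℕ) (cl c : ℕ → ℕ) (r : ℕ) (M : Mem) : Prop :=
  (∃ f cnt tot ex, RoundInv N I.m I.k cl c I.lower I.upper r f cnt tot ex ∧ Stored f cnt tot ex M) ∧
    ∀ j, I.m ≤ j → M (34, j, 0) = 0

/-- The rounds reach, select and augment, each in time `O(m N)`; `k` rounds are enough because the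
value of a flow is at most `k`. -/
theorem spec_matchCmd (hS : Setting I N cl c M) (hcl : ∀ p, cl p ≤ N) (hc : ∀ p < N, c p < I.m)
    (hlu : ∀ j, I.lower j ≤ I.upper j) (hk : ∑ j ∈ Finset.range I.m, I.lower j ≤ I.k)
    (h33 : ∀ x, M (33, x, 0) = 0) (h34 : ∀ j, M (34, j, 0) = 0) (h35 : ∀ j, M (35, j, 0) = 0)
    (h36 : M (36, 0, 0) = 0) (h37 : M (37, 0, 0) = 0)
    (h50 : M (50, 0, 0) = ∑ j ∈ Finset.range I.m, I.lower j) :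
    Spec I matchCmd M (I.k * (I.m * (N * 100 + 400) + 400) + 100) (RoundState I N cl c I.k) := by
  refine Spec.loop (I.m * (N * 100 + 400) + 300) (RoundState I N cl c)
    ⟨⟨_, _, _, _, RoundInv.zero hk, h33, h35, h36, h37⟩, fun j _ => h34 j⟩ ?_ ?_ ?_
  · rintro r M₁ hr ⟨⟨f, cnt, tot, ex, hinv, hst⟩, h34₁⟩ hF
    have hF' : Frame (41 :: (reachCmd ;; selectCmd ;; augmentCmd).writes) M
      (Function.update M₁ (41, 0, 0) r) := hF.update (by decide) _ _ _
    have hS₁ := hS.frame hF' (by decide) (by decide) (by decide)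
    have h50₁ := (hF' 50 0 0 (by decide)).trans h50
    have hF₁ : Frame [41] M₁ (Function.update M₁ (41, 0, 0) r) :=
      (Frame.refl _ _).update (by decide) _ _ _
    have hst₁ := hst.frame hF₁ (by decide) (by decide) (by decide) (by decide)
    replace h34₁ : ∀ j, I.m ≤ j → Function.update M₁ (41, 0, 0) r (34, j, 0) = 0 :=
      fun j hj => (hF₁ _ _ _ (by decide)).trans (h34₁ j hj)
    generalize Function.update M₁ (41, 0, 0) r = M₂ at *
    refine Spec.seq (I.m * (N * 100 + 200) + 100) (I.m * 200 + 200) ?_ (by linarith)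
    refine (spec_reachCmd hS₁ hc hst₁.mate h34₁).frame.mono le_rfl ?_
    rintro M₃ ⟨⟨rk, X, hX, hclosed⟩, hF₃⟩
    refine Spec.seq (I.m * 100 + 100) (I.m * 100 + 100) ?_ (by linarith)
    have hst₃ := hst₁.frame hF₃ (by decide) (by decide) (by decide) (by decide)
    refine (spec_selectCmd (fun j => hX.mem_iff) hX.lt (fun _ => rfl) hst₃.count hst₃.excess
      ((hF₃ _ _ _ (by decide)).trans h50₁)).frame.mono le_rfl ?_
    rintro M₄ ⟨hsel, hF₄⟩
    have hst₄ := hst₃.frame hF₄ (by decide) (by decide) (by decide) (by decide)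
    have hS₄ := (hS₁.frame hF₃ (by decide) (by decide) (by decide)).frame hF₄ (by decide) (by decide)
      (by decide)
    refine (spec_augmentCmd hS₄ hcl hlu hinv hst₄ hX hclosed (fun j => hF₄ _ _ _ (by decide))
      hsel).frame.mono le_rfl ?_
    rintro M₅ ⟨h, hF₅⟩
    refine ⟨h, fun j hj => ?_⟩
    rw [hF₅ _ _ _ (by decide), hF₄ _ _ _ (by decide)]
    by_contra h0
    exact absurd (hX.lt j (hX.mem_iff.2 h0)) (by omega)
  · exact fun M' h _ => h
  · simp only [NExpr.eval, NExpr.cost]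
    linarith

end AssignProgram

/-! ## The result of the assignment command -/

section AssignResult

variable {V : Type*} [Fintype V] {m k : ℕ} {color : V → Fin m} {ℓ u : Fin m → ℕ} {U : Finset V}
  {e : Fin U.card ≃ {x // x ∈ U}} {D : Fin U.card → Finset V}

/-- The matching that the final state of the assignment describes is an assignment, and it is fair if
and only if it has size `k`. -/
theorem RoundInv.isAssignment {cl c L L' f cnt : ℕ → ℕ} {tot ex : ℕ}
    (h : RoundInv U.card m k cl c L L' k f cnt tot ex) (hc : ∀ p : Fin U.card, c p = color (e p))
    (hcl : ∀ p, cl p ≤ U.card) (hlab : ∀ v j : Fin U.card, cl v = j + 1 ↔ (e v : V) ∈ D j)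
    (hD : ∀ i j, i ≠ j → Disjoint (D i) (D j)) (hDU : ∀ j, D j ⊆ U) (hL : ∀ j : Fin m, L j = ℓ j)
    (hL' : ∀ j : Fin m, L' j = u j) (hlu : ∀ j, ℓ j ≤ u j) (hk : ∑ j, ℓ j ≤ k) {S : Finset V}
    (hS : ∀ v, v ∈ S ↔ ∃ (x : ℕ) (p : Fin U.card), f x = p + 1 ∧ v = e p) :
    IsAssignment color ℓ u k D S ∧ (Fair color ℓ u k S ↔ tot = k) := by
  classical
  -- Cluster `i` of the network is cluster `i + 1` in memory, and number `0` stands for no cluster.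
  have hmate : ∀ i : Fin U.card, ∃ o : Option (Fin U.card),
      ∀ p : Fin U.card, o = some p ↔ f (i + 1) = p + 1 := by
    intro i
    by_cases h0 : f (i + 1) = 0
    · exact ⟨none, fun p => by simp [h0]⟩
    · obtain ⟨q, hq⟩ := Nat.exists_eq_succ_of_ne_zero h0
      refine ⟨some ⟨q, (h.isMatch _ q hq).1⟩, fun p => ?_⟩
      rw [hq, Option.some.injEq, Fin.ext_iff]
      simp
  choose mate hmate using hmate
  let sel : Fin U.card → Option (Fin m) := fun i => (mate i).map fun p => color (e p)
  have hsel : ∀ i j, sel i = some j ↔ ∃ p : Fin U.card, f (i + 1) = p + 1 ∧ color (e p) = j := by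
    intro i j
    simp only [sel, Option.map_eq_some_iff, hmate]
  have hmem : ∀ (i p : Fin U.card), f (i + 1) = p + 1 → (e p : V) ∈ D i := fun i p hp =>
    (hlab p i).1 (h.isMatch _ _ hp).2.1
  have hcount : ∀ j : Fin m, selCount sel j = cnt j := by
    intro j
    have h0 : f 0 = 0 := by
      by_contra h0
      obtain ⟨q, hq⟩ := Nat.exists_eq_succ_of_ne_zero h0
      exact (h.isMatch _ _ hq).2.2 rfl
    rw [h.cnt_eq, tally, Finset.sum_range_succ', selCount, Finset.card_filter, Finset.sum_range,
      if_neg (by simp [h0]), add_zero]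
    refine Finset.sum_congr rfl fun i _ => ?_
    congr 1
    rw [hsel, eq_iff_iff]
    constructor
    · rintro ⟨p, hp, hpj⟩
      rw [hp, Nat.add_sub_cancel, hc, hpj]
      simp
    · rintro ⟨h1, h2⟩
      obtain ⟨q, hq⟩ := Nat.exists_eq_succ_of_ne_zero h1
      refine ⟨⟨q, (h.isMatch _ _ hq).1⟩, hq, Fin.ext ?_⟩
      rw [hq, Nat.succ_sub_one] at h2
      rw [← h2, ← hc]
  have hsum : ∀ g : ℕ → ℕ, ∑ j ∈ Finset.range m, g j = ∑ j : Fin m, g j := fun g =>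
    Finset.sum_range g
  have hex : ∑ j, (selCount sel j - ℓ j) = ex := by
    rw [h.ex_eq, hsum]
    exact Finset.sum_congr rfl fun j _ => by rw [hcount, hL]
  have hLsum : ∑ j ∈ Finset.range m, L j = ∑ j, ℓ j := by
    rw [hsum]
    exact Finset.sum_congr rfl fun j _ => hL j
  have hle := h.ex_le
  rw [hLsum] at hle
  have hsel' : ∀ i j, sel i = some j → ∃ v ∈ D i, color v = j := by
    intro i j hij
    obtain ⟨p, hp, hpj⟩ := (hsel i j).1 hij
    exact ⟨e p, hmem i p hp, hpj⟩
  have hu : ∀ j, selCount sel j ≤ u j := fun j => by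
    rw [hcount, ← hL']
    exact h.cnt_le j
  have hkex : ∑ j, (selCount sel j - ℓ j) ≤ k - ∑ j, ℓ j := by omega
  have hmax : IsMaxFlow (capacity color ℓ u k D) .source .sink (selFlow ℓ sel) := by
    obtain ⟨Y, hY, hfull⟩ := h.exists_closed (m := m) fun p hp => by
      rw [hc ⟨p, hp⟩]
      exact (color _).2
    -- The closed set of the last round is the side of the cut that proves maximality.
    refine isMaxFlow_selFlow hsel' hlu hu hkex (Finset.univ.filter fun j => (j : ℕ) ∈ Y) ?_ ?_
    · intro i v hv hsub
      obtain ⟨p, hp⟩ := e.surjective ⟨v, hDU i hv⟩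
      have hpv : (e p : V) = v := by rw [hp]
      have hpi : cl p = i + 1 := (hlab p i).2 (hpv ▸ hv)
      have := hY p p.2 (by omega) fun q hq => ?_
      · rw [hc, hpv] at this
        simpa using this
      · rw [hpi] at hq
        have hq' := (h.isMatch _ _ hq).1
        have := hsub (color (e ⟨q, hq'⟩)) ((hsel _ _).2 ⟨⟨q, hq'⟩, hq, rfl⟩)
        rw [hc ⟨q, hq'⟩]
        simpa using this
    · refine hfull.imp (fun h1 j hj => ?_) fun ⟨h1, h2, h3⟩ => ⟨fun j hj => ?_, fun j hj => ?_, ?_⟩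
      · rw [hcount, ← hL']
        exact h1 j (by simpa using hj)
      · rw [hcount, ← hL]
        exact h1 j (by simpa using hj)
      · rw [hcount, ← hL]
        exact h2 j (by simpa using hj)
      · omega
  -- The default `i` is never used where the flow is positive.
  let pick : Fin U.card → Fin m → V := fun i _ => e ((mate i).getD i)
  have hpos : ∀ i j, 0 < selFlow ℓ sel (.clus i) (.col j) ↔
      ∃ p : Fin U.card, f (i + 1) = p + 1 ∧ color (e p) = j := by
    intro i j
    rw [← hsel]
    simp only [selFlow]
    split_ifs with h1 <;> simp [h1]
  have hpick : ∀ (i : Fin U.card) (j : Fin m) (p : Fin U.card), f (i + 1) = p + 1 →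
      pick i j = e p := by
    intro i j p hp
    simp only [pick, (hmate i p).2 hp, Option.getD_some]
  have hpick' : ∀ i j, 0 < selFlow ℓ sel (.clus i) (.col j) →
      pick i j ∈ D i ∧ color (pick i j) = j := by
    intro i j hij
    obtain ⟨p, hp, hpj⟩ := (hpos i j).1 hij
    rw [hpick i j p hp]
    exact ⟨hmem i p hp, hpj⟩
  have hS' : ∀ v, v ∈ S ↔ ∃ i j, 0 < selFlow ℓ sel (.clus i) (.col j) ∧ v = pick i j := by
    intro v
    rw [hS]
    constructor
    · rintro ⟨x, p, hp, rfl⟩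
      obtain ⟨h1, h2, h3⟩ := h.isMatch _ _ hp
      have h4 := hcl p
      obtain ⟨y, rfl⟩ := Nat.exists_eq_succ_of_ne_zero h3
      refine ⟨⟨y, by omega⟩, color (e p), (hpos _ _).2 ⟨p, hp, rfl⟩, (hpick _ (color (e p)) p hp).symm⟩
    · rintro ⟨i, j, hij, rfl⟩
      obtain ⟨p, hp, hpj⟩ := (hpos i j).1 hij
      exact ⟨i + 1, p, hp, hpick i j p hp⟩
  refine ⟨⟨_, hmax, pick, hpick', Finset.ext fun v => by simp [hS' v]⟩, ?_⟩
  rw [fair_iff_flowValue_eq hD hlu hk hmax.1 hpick' hS', flowValue_selFlow, Nat.cast_inj, h.tot_eq,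
    hsum, Finset.sum_congr rfl fun j _ => hcount j]

end AssignResult

/-! ### Clearing the work space and writing the output -/

section ResetProgram

/-- Set the cells `(0, 0)` of the given arrays to `0`. -/
def zeroCmd : List ℕ → Cmd
  | [] => .skip
  | a :: l => setVar a (.const 0) ;; zeroCmd l

/-- The scalar variables of the assignment. -/
def scratch : List ℕ := [36, 37, 38, 39, 40, 41, 42, 43, 44, 45, 46, 47, 48]

/-- Prepare the assignment. -/
def resetCmd : Cmd :=
  .loop 41 (.plus (var 2) (.const 1)) (put 33 (var 41) (.const 0)) ;;
  .loop 42 .numColors (put 34 (var 42) (.const 0) ;; put 35 (var 42) (.const 0)) ;;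
  zeroCmd scratch

/-- Write the points of the matching into array `1` and their number into array `0`, and set array `23`
to `1` if the matching has the required size. -/
def outputCmd : Cmd :=
  setVar 0 (.const 0) ;;
  .loop 49 (.plus (var 2) (.const 1))
    (.cond (.eq (get 33 (var 49)) (.const 0)) .skip
      (put 1 (var 0) (get 3 (.minus (get 33 (var 49)) (.const 1))) ;;
      setVar 0 (.plus (var 0) (.const 1)))) ;;
  .cond (.eq (var 36) .solutionSize) (setVar 23 (.const 1)) .skip

variable {I : Input} {N : ℕ} {M : Mem}

theorem spec_zeroCmd (I : Input) (l : List ℕ) (M : Mem) : Spec I (zeroCmd l) M (l.length * 10 + 1)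
    fun M' => ∀ a, (a ∈ l ∨ M (a, 0, 0) = 0) → M' (a, 0, 0) = 0 := by
  induction l generalizing M with
  | nil => exact Spec.skip (fun a ha => by simpa using ha) (by simp)
  | cons b l ih =>
    refine Spec.seq 10 (l.length * 10 + 1) (Spec.store ?_ (by decide)) (by simp; omega)
    refine (ih _).mono le_rfl fun M' h a ha => h a ?_
    by_cases hab : a = b
    · right
      simp [NExpr.eval, hab]
    · refine ha.imp (fun h => ?_) fun h => ?_
      · simpa [hab] using h
      · simpa [NExpr.eval, Function.update_apply, hab] using h

/-- Only the ranges in use are cleared, to stay within the time bound; that the cells beyond them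
are zero is an invariant of the main loop. -/
theorem spec_resetCmd (h2 : M (2, 0, 0) = N) (h33 : ∀ x, N < x → M (33, x, 0) = 0)
    (h34 : ∀ j, I.m ≤ j → M (34, j, 0) = 0) (h35 : ∀ j, I.m ≤ j → M (35, j, 0) = 0) :
    Spec I resetCmd M (N * 20 + I.m * 30 + 300) fun M' => (∀ x, M' (33, x, 0) = 0) ∧
      (∀ j, M' (34, j, 0) = 0) ∧ (∀ j, M' (35, j, 0) = 0) ∧ ∀ a ∈ scratch, M' (a, 0, 0) = 0 := by
  have hN : (NExpr.plus (var 2) (.const 1)).eval I M = N + 1 := by simp [NExpr.eval, h2]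
  refine Spec.seq (N * 20 + 40) (I.m * 30 + 220) ?_ (by omega)
  refine Spec.loop 19 (fun q M' => ∀ x, x < q ∨ N < x → M' (33, x, 0) = 0)
    (fun x hx => h33 x (by omega)) ?_ ?_ ?_
  · intro q M₁ hq h _
    refine Spec.store ?_ (by decide)
    intro x hx
    by_cases hxq : x = q
    · simp [NExpr.eval, hxq]
    · simpa [NExpr.eval, hxq, Function.update_apply] using h x (by omega)
  · rw [hN]
    intro M₁ hM₁ hF
    refine Spec.seq (I.m * 30 + 10) 200 ?_ (by omega)
    refine Spec.loop 29 (fun q M' => ∀ j, j < q ∨ I.m ≤ j →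
      M' (34, j, 0) = 0 ∧ M' (35, j, 0) = 0) (fun j hj => ?_) ?_ ?_ ?_
    · rw [hF _ _ _ (by decide), hF _ _ _ (by decide)]
      exact ⟨h34 j (by omega), h35 j (by omega)⟩
    · intro q M₂ hq h _
      refine Spec.seq 10 10 (Spec.store ?_ (by decide)) (by decide)
      refine Spec.store ?_ (by decide)
      intro j hj
      by_cases hjq : j = q
      · simp [NExpr.eval, hjq, Function.update_apply]
      · simpa [NExpr.eval, hjq, Function.update_apply] using h j (by omega)
    · intro M₂ hM₂ hF₂
      refine (spec_zeroCmd I scratch M₂).frame.mono (by decide) fun M₃ ⟨hM₃, hF₃⟩ =>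
        ⟨fun x => ?_, fun j => ?_, fun j => ?_, fun a ha => hM₃ a (Or.inl ha)⟩
      · rw [hF₃ _ _ _ (by decide), hF₂ _ _ _ (by decide)]
        exact hM₁ x (by omega)
      · rw [hF₃ _ _ _ (by decide)]
        exact (hM₂ j (lt_or_ge j I.m)).1
      · rw [hF₃ _ _ _ (by decide)]
        exact (hM₂ j (lt_or_ge j I.m)).2
    · simp only [NExpr.eval, NExpr.cost]
      omega
  · rw [hN]
    simp only [NExpr.cost]
    omega

theorem spec_outputCmd (h2 : M (2, 0, 0) = N) : Spec I outputCmd M (N * 60 + 200) fun M' =>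
    (∀ q, (∃ i < M' (0, 0, 0), M' (1, i, 0) = q) ↔
      ∃ x ≤ N, ∃ p, M (33, x, 0) = p + 1 ∧ M (3, p, 0) = q) ∧
    M' (23, 0, 0) = if M (36, 0, 0) = I.k then 1 else M (23, 0, 0) := by
  refine Spec.seq 4 (N * 60 + 190) (Spec.store ?_ (by decide)) (by omega)
  have hN : (NExpr.plus (var 2) (.const 1)).eval I (Function.update M (0, 0, 0) 0) = N + 1 := by
    simp [NExpr.eval, h2]
  show Spec I _ (Function.update M (0, 0, 0) 0) _ _
  refine Spec.seq (N * 60 + 100) 20 ?_ (by omega)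
  refine Spec.loop 59 (fun r M' => ∀ q, (∃ i < M' (0, 0, 0), M' (1, i, 0) = q) ↔
      ∃ x < r, ∃ p, M (33, x, 0) = p + 1 ∧ M (3, p, 0) = q) ?_ ?_ ?_ ?_
  · intro q
    simp [NExpr.eval]
  · intro r M₁ hr h hF
    have h33 : ∀ x, M₁ (33, x, 0) = M (33, x, 0) := fun x => by
      rw [hF _ _ _ (by decide)]; simp [NExpr.eval, Function.update_apply]
    have h3 : ∀ x, M₁ (3, x, 0) = M (3, x, 0) := fun x => by
      rw [hF _ _ _ (by decide)]; simp [NExpr.eval, Function.update_apply]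
    refine Spec.cond 40 (fun h' => ?_) (fun h' => ?_) (by decide)
    · simp only [BExpr.holds, NExpr.eval, Function.update_apply, h33, Prod.mk.injEq,
        Nat.reduceEqDiff, false_and, if_false, and_self, if_true] at h'
      refine Spec.skip ?_ (by decide)
      intro q
      simp only [Function.update_apply, Prod.mk.injEq, Nat.reduceEqDiff, false_and, if_false, h q]
      refine ⟨fun ⟨x, hx, h1⟩ => ⟨x, by omega, h1⟩, fun ⟨x, hx, p, h1, h2⟩ => ⟨x, ?_, p, h1, h2⟩⟩
      refine lt_of_le_of_ne (Nat.lt_succ_iff.1 hx) ?_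
      rintro rfl
      omega
    · simp only [BExpr.holds, NExpr.eval, Function.update_apply, h33, Prod.mk.injEq,
        Nat.reduceEqDiff, false_and, if_false, and_self, if_true] at h'
      obtain ⟨p, hp⟩ := Nat.exists_eq_succ_of_ne_zero h'
      refine Spec.seq 20 20 (Spec.store ?_ (by decide)) (by decide)
      refine Spec.store ?_ (by decide)
      intro q
      simp only [NExpr.eval, Function.update_apply, h33, h3, hp, Prod.mk.injEq, Nat.reduceEqDiff,
        false_and, if_false, and_self, if_true, Nat.succ_eq_add_one, Nat.add_sub_cancel, true_and,
        and_true]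
      constructor
      · rintro ⟨i, hi, hiq⟩
        by_cases hi' : i = M₁ (0, 0, 0)
        · rw [if_pos hi'] at hiq
          exact ⟨r, Nat.lt_succ_self r, p, hp, hiq⟩
        · rw [if_neg hi'] at hiq
          obtain ⟨x, hx, h1⟩ := (h q).1 ⟨i, by omega, hiq⟩
          exact ⟨x, by omega, h1⟩
      · rintro ⟨x, hx, p', hp', hq⟩
        rcases Nat.lt_succ_iff_lt_or_eq.1 hx with hx | rfl
        · obtain ⟨i, hi, hiq⟩ := (h q).2 ⟨x, hx, p', hp', hq⟩
          exact ⟨i, by omega, by rw [if_neg hi.ne]; exact hiq⟩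
        · obtain rfl : p = p' := by omega
          exact ⟨M₁ (0, 0, 0), Nat.lt_succ_self _, by rw [if_pos rfl]; exact hq⟩
  · rw [hN]
    intro M₁ h hF
    have h36 : M₁ (36, 0, 0) = M (36, 0, 0) := by
      rw [hF _ _ _ (by decide)]; simp [NExpr.eval, Function.update_apply]
    have h23 : M₁ (23, 0, 0) = M (23, 0, 0) := by
      rw [hF _ _ _ (by decide)]; simp [NExpr.eval, Function.update_apply]
    simp only [Nat.lt_succ_iff] at h
    refine Spec.cond 10 (fun h' => ?_) (fun h' => ?_) (by decide)
    · simp only [BExpr.holds, NExpr.eval, h36] at h'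
      refine Spec.store ?_ (by decide)
      simp only [NExpr.eval, Function.update_apply, Prod.mk.injEq, Nat.reduceEqDiff, false_and,
        if_false, and_self, if_true, if_pos h']
      exact ⟨h, trivial⟩
    · simp only [BExpr.holds, NExpr.eval, h36] at h'
      exact Spec.skip ⟨h, by rw [if_neg h', h23]⟩ (by decide)
  · rw [hN]
    simp only [NExpr.cost]
    omega

end ResetProgram

/-! ## One repetition -/

section RoundProgram

/-- One repetition, after the random choices. -/
def roundCmd : Cmd := clusterCmd ;; resetCmd ;; matchCmd ;; outputCmd

variable {V : Type*} [Fintype V] [MetricSpace V] {n m k T : ℕ} {pt : Fin n ≃ V}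
  {color : V → Fin m} {ℓ u : Fin m → ℕ} {τ r : ℝ} {U : Finset V} {e : Fin U.card ≃ {x // x ∈ U}}
  {D : Fin U.card → Finset V} {M₀ M M' : Mem}

/-- The memory is ready for the assignment to the clusters `D`. -/
structure Ready (e : Fin U.card ≃ {x // x ∈ U}) (D : Fin U.card → Finset V) (M₀ M : Mem) : Prop where
  static : Agree [3] [2, 50] M₀ M
  labels : Labels e D M
  mate : ∀ x, M (33, x, 0) = 0
  parent : ∀ j, M (34, j, 0) = 0
  count : ∀ j, M (35, j, 0) = 0
  scratch : ∀ a ∈ scratch, M (a, 0, 0) = 0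

/-- The clusters determine the whole array `29`: a nonzero entry is at most `U.card` and therefore
names a cluster. -/
theorem Labels.eq (h : Labels e D M) (h' : Labels e D M') (v : ℕ) :
    M (29, v, 0) = M' (29, v, 0) := by
  rcases lt_or_ge v U.card with hv | hv
  · have key : ∀ {M M' : Mem}, Labels e D M → Labels e D M' → M (29, v, 0) ≠ 0 →
        M (29, v, 0) = M' (29, v, 0) := by
      intro M M' h h' h0
      obtain ⟨j, hj⟩ := Nat.exists_eq_succ_of_ne_zero h0
      have hjU : j < U.card := by have := h.le v; omega
      rw [hj]
      exact ((h'.label ⟨v, hv⟩ ⟨j, hjU⟩).2 ((h.label ⟨v, hv⟩ ⟨j, hjU⟩).1 hj)).symm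
    by_cases h0 : M (29, v, 0) = 0
    · by_contra h1
      exact h1 (key h' h fun h2 => h1 (h0.trans h2.symm)).symm
    · exact key h h' h0
  · rw [h.high v hv, h'.high v hv]

/-- After the reset, every cell that `matchCmd` reads is determined by `M₀` and `D`. Hence the
matching depends on the random choices only through the clusters, as the function `solve` in
`IsOutputLaw` requires. -/
theorem Ready.agree (h : Ready e D M₀ M) (h' : Ready e D M₀ M') :
    Agree [3, 29, 33, 34, 35] (2 :: 50 :: FMMD.scratch) M M' := by
  refine ⟨fun a ha i => ?_, fun b hb => ?_⟩
  · simp only [List.mem_cons, List.not_mem_nil, or_false] at ha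
    rcases ha with rfl | rfl | rfl | rfl | rfl
    · exact (h.static.1 3 (by simp) i).symm.trans (h'.static.1 3 (by simp) i)
    · exact h.labels.eq h'.labels i
    · rw [h.mate, h'.mate]
    · rw [h.parent, h'.parent]
    · rw [h.count, h'.count]
  · rw [List.mem_cons, List.mem_cons] at hb
    rcases hb with rfl | rfl | hb
    · exact (h.static.2 2 (by simp)).symm.trans (h'.static.2 2 (by simp))
    · exact (h.static.2 50 (by simp)).symm.trans (h'.static.2 50 (by simp))
    · rw [h.scratch b hb, h'.scratch b hb]

open Classical in
/-- The points of the matching in array `33`. -/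
def resultSet (e : Fin U.card ≃ {x // x ∈ U}) (M : Mem) : Finset V :=
  Finset.univ.filter fun v => ∃ (x : ℕ) (p : Fin U.card), M (33, x, 0) = p + 1 ∧ v = e p

theorem resultSet_congr (h : ∀ x, M (33, x, 0) = M' (33, x, 0)) :
    resultSet e M = resultSet e M' := by
  ext v
  simp [resultSet, h]

/-- The contents of the arrays `29`, `33`, `34` and `35` outside of their ranges. -/
structure Padded (N m : ℕ) (M : Mem) : Prop where
  label : ∀ v, N ≤ v → M (29, v, 0) = 0
  mate : ∀ x, N < x → M (33, x, 0) = 0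
  parent : ∀ j, m ≤ j → M (34, j, 0) = 0
  count : ∀ j, m ≤ j → M (35, j, 0) = 0

theorem spec_matchCmd_of_ready (hP : Points pt e M₀) (h50 : M₀ (50, 0, 0) = ∑ j, ℓ j)
    (hlu : ∀ j, ℓ j ≤ u j) (hk : ∑ j, ℓ j ≤ k) (hD : ∀ i j, i ≠ j → Disjoint (D i) (D j))
    (hDU : ∀ j, D j ⊆ U) (h : Ready e D M₀ M) :
    Spec (encode pt color ℓ u k T τ) matchCmd M (k * (m * (U.card * 100 + 400) + 400) + 100)
      fun M' => Padded U.card m M' ∧ (∀ x p, M' (33, x, 0) = p + 1 → p < U.card ∧ x ≤ U.card) ∧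
        IsAssignment color ℓ u k D (resultSet e M') ∧
        (Fair color ℓ u k (resultSet e M') ↔ M' (36, 0, 0) = k) := by
  set I := encode pt color ℓ u k T τ with hI
  have hlow : ∀ j : Fin m, I.lower j = ℓ j := fun j => by simp [hI, encode]
  have hupp : ∀ j : Fin m, I.upper j = u j := fun j => by simp [hI, encode]
  have hlu' : ∀ j, I.lower j ≤ I.upper j := fun j => by
    by_cases hj : j < m
    · rw [hlow ⟨j, hj⟩, hupp ⟨j, hj⟩]
      exact hlu _
    · simp [hI, encode, hj]
  have hsum : ∑ j ∈ Finset.range I.m, I.lower j = ∑ j, ℓ j := by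
    rw [show I.m = m from rfl, Finset.sum_range]
    exact Finset.sum_congr rfl fun j _ => hlow j
  have hM2 : M (2, 0, 0) = U.card := (h.static.2 2 (by simp)).symm.trans hP.1
  have hc : ∀ p : Fin U.card, I.color (M (3, p, 0)) = color (e p) := fun p => by
    rw [← h.static.1 3 (by simp), hP.2, encode_color]
  have hcl : ∀ p, M (29, p, 0) ≤ U.card := h.labels.le
  refine (spec_matchCmd (cl := fun p => M (29, p, 0)) (c := fun p => I.color (M (3, p, 0)))
    ⟨hM2, fun _ => rfl, fun _ => rfl⟩ hcl
    (fun p hp => by rw [hc ⟨p, hp⟩]; exact (color _).2) hlu' (hsum ▸ hk) h.mate h.parent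
    h.count (h.scratch 36 (by decide)) (h.scratch 37 (by decide))
    (by rw [hsum, ← h50, h.static.2 50 (by simp)])).frame.mono le_rfl ?_
  rintro M' ⟨⟨⟨f, cnt, tot, ex, hinv, hst⟩, h34⟩, hF⟩
  have hmate : ∀ x p, M' (33, x, 0) = p + 1 → p < U.card ∧ x ≤ U.card := fun x p hp => by
    rw [hst.mate] at hp
    obtain ⟨h1, h2, -⟩ := hinv.isMatch x p hp
    exact ⟨h1, h2 ▸ hcl p⟩
  refine ⟨⟨fun v hv => ?_, fun x hx => ?_, h34, fun j hj => ?_⟩, hmate, ?_⟩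
  · rw [hF _ _ _ (by decide)]
    exact h.labels.high v hv
  · by_contra h0
    obtain ⟨p, hp⟩ := Nat.exists_eq_succ_of_ne_zero h0
    have := (hmate x p hp).2
    omega
  · rw [hst.count, hinv.cnt_eq]
    exact hinv.isMatch.tally_eq_zero
      (fun p hp => by rw [hc ⟨p, hp⟩]; exact (color _).2) hj
  · rw [hst.total]
    exact hinv.isAssignment hc hcl h.labels.label hD hDU hlow hupp hlu hk fun v => by
      simp [resultSet, hst.mate]

open Classical in
/-- The assignment that the program computes for the clusters `D`. -/
def assignOf [Nonempty V] (I : Input) (color : V → Fin m) (ℓ u : Fin m → ℕ) (k : ℕ)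
    (e : Fin U.card ≃ {x // x ∈ U}) (M₀ : Mem) (D : Fin U.card → Finset V) : Finset V :=
  -- All ready memories lead to the same matching, so the choice among them is harmless. The other
  -- branch makes the function an assignment also for families `D` that never arise.
  if h : ∃ M, Ready e D M₀ M ∧ IsAssignment color ℓ u k D (resultSet e (matchCmd.det I M).1) then
    resultSet e (matchCmd.det I h.choose).1
  else (exists_isAssignment color ℓ u k D).choose

theorem isAssignment_assignOf [Nonempty V] (I : Input) (D : Fin U.card → Finset V) :
    IsAssignment color ℓ u k D (assignOf I color ℓ u k e M₀ D) := by
  unfold assignOf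
  split_ifs with h
  · exact h.choose_spec.2
  · exact (exists_isAssignment color ℓ u k D).choose_spec

theorem assignOf_eq [Nonempty V] {I : Input} (h : Ready e D M₀ M)
    (hA : IsAssignment color ℓ u k D (resultSet e (matchCmd.det I M).1)) :
    assignOf I color ℓ u k e M₀ D = resultSet e (matchCmd.det I M).1 := by
  have hex : ∃ M, Ready e D M₀ M ∧
    IsAssignment color ℓ u k D (resultSet e (matchCmd.det I M).1) := ⟨M, h, hA⟩
  rw [assignOf, dif_pos hex]
  exact resultSet_congr fun x =>
    (Cmd.det_agree I matchCmd (by decide) (hex.choose_spec.1.agree h)).1 33 (by decide) x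

/-- The arrays that a repetition may change. -/
def roundWrites : List ℕ := 24 :: 28 :: 27 :: 26 :: 25 :: roundCmd.writes

theorem spec_roundCmd [Nonempty V] {π : Fin U.card ≃ {x // x ∈ U}} {R : ℕ} (hP : Points pt e M₀)
    (h12 : DistanceTable r e M₀) (h50 : M₀ (50, 0, 0) = ∑ j, ℓ j) (hlu : ∀ j, ℓ j ≤ u j)
    (hk : ∑ j, ℓ j ≤ k) (hR : 1 ≤ R) (hF : Frame roundWrites M₀ M) (hpad : Padded U.card m M)
    (h25 : ∀ j : Fin U.card, M (25, j, 0) = (e.symm (π j) : ℕ)) (h28 : M (28, 0, 0) = R)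
    (h23 : M (23, 0, 0) = 0) :
    Spec (encode pt color ℓ u k T τ) roundCmd M
      (U.card * (U.card * 100 + 100) + k * (m * (U.card * 100 + 400) + 400) + U.card * 80 +
        m * 30 + 800)
      fun M' => Padded U.card m M' ∧
        (∀ t, outputSet pt ⟨M', t⟩ = assignOf (encode pt color ℓ u k T τ) color ℓ u k e M₀
          (cluster U r π R)) ∧
        (M' (23, 0, 0) ≠ 0 ↔ Fair color ℓ u k (assignOf (encode pt color ℓ u k T τ) color ℓ u k e M₀
          (cluster U r π R))) := by
  set I := encode pt color ℓ u k T τ with hI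
  set D := cluster U r π R with hDdef
  have hD : ∀ i j, i ≠ j → Disjoint (D i) (D j) := fun i j hij => cluster_disjoint hij
  have hDU : ∀ j, D j ⊆ U := fun j v hv => (mem_cluster.1 hv).1
  have hP₁ := hP.frame hF (by decide) (by decide)
  have h12₁ : DistanceTable r e M := fun p q t => by
    rw [hF _ _ _ (by decide)]
    exact h12 p q t
  refine Spec.seq (U.card * (U.card * 100 + 100) + 100) (k * (m * (U.card * 100 + 400) + 400) +
    U.card * 80 + m * 30 + 700) ?_ (by omega)
  refine (spec_clusterCmd I hR hP₁.1 h25 h28 h12₁ hpad.label).frame.mono le_rfl ?_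
  rintro M₁ ⟨hlab, hF₁⟩
  refine Spec.seq (U.card * 20 + m * 30 + 300) (k * (m * (U.card * 100 + 400) + 400) +
    U.card * 60 + 300) ?_ (by omega)
  refine (spec_resetCmd (I := I) (N := U.card) ((hF₁ _ _ _ (by decide)).trans hP₁.1)
    (fun x hx => (hF₁ _ _ _ (by decide)).trans (hpad.mate x hx))
    (fun j hj => (hF₁ _ _ _ (by decide)).trans (hpad.parent j hj))
    (fun j hj => (hF₁ _ _ _ (by decide)).trans (hpad.count j hj))).frame.mono le_rfl ?_
  rintro M₂ ⟨⟨h33, h34, h35, hscr⟩, hF₂⟩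
  have hF₁₂ : Frame roundWrites M₀ M₂ :=
    (hF.trans (hF₁.mono (by decide))).trans (hF₂.mono (by decide))
  have hready : Ready e D M₀ M₂ := by
    refine ⟨⟨fun a ha i => ?_, fun b hb => ?_⟩, ⟨fun v j => ?_, fun v => ?_, fun v hv => ?_⟩, h33,
      h34, h35, hscr⟩
    · obtain rfl : a = 3 := by simpa using ha
      exact (hF₁₂ _ _ _ (by decide)).symm
    · rcases (by simpa using hb : b = 2 ∨ b = 50) with rfl | rfl
      · exact (hF₁₂ _ _ _ (by decide)).symm
      · exact (hF₁₂ _ _ _ (by decide)).symm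
    · rw [hF₂ _ _ _ (by decide)]; exact hlab.label v j
    · rw [hF₂ _ _ _ (by decide)]; exact hlab.le v
    · rw [hF₂ _ _ _ (by decide)]; exact hlab.high v hv
  have hmatch := spec_matchCmd_of_ready (color := color) (T := T) (τ := τ) (u := u) hP h50 hlu hk hD
    hDU hready
  rw [← hI] at hmatch
  -- The memory at hand is one of the ready memories, so what it computes is the chosen assignment.
  have hassign := assignOf_eq (I := I) hready hmatch.2.2.2.1
  refine Spec.seq (k * (m * (U.card * 100 + 400) + 400) + 100) (U.card * 60 + 200) ?_ (by omega)
  refine ⟨hmatch.1, ?_⟩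
  obtain ⟨hpad₃, hmate, -, hfair⟩ := hmatch.2
  have hF₃ := matchCmd.det_frame I M₂
  rw [← hassign] at hfair
  generalize (matchCmd.det I M₂).1 = M₃ at *
  have hF₁₃ : Frame roundWrites M₀ M₃ := hF₁₂.trans (hF₃.mono (by decide))
  have hP₃ := hP.frame hF₁₃ (by decide) (by decide)
  have h23₃ : M₃ (23, 0, 0) = 0 := by
    rw [hF₃ _ _ _ (by decide), hF₂ _ _ _ (by decide), hF₁ _ _ _ (by decide), h23]
  refine (spec_outputCmd (I := I) hP₃.1).frame.mono le_rfl ?_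
  rintro M₄ ⟨⟨hout, hdone⟩, hF₄⟩
  refine ⟨⟨fun v hv => ?_, fun x hx => ?_, fun j hj => ?_, fun j hj => ?_⟩, fun t => ?_, ?_⟩
  · rw [hF₄ _ _ _ (by decide)]; exact hpad₃.label v hv
  · rw [hF₄ _ _ _ (by decide)]; exact hpad₃.mate x hx
  · rw [hF₄ _ _ _ (by decide)]; exact hpad₃.parent j hj
  · rw [hF₄ _ _ _ (by decide)]; exact hpad₃.count j hj
  · rw [hassign]
    ext v
    simp only [outputSet, resultSet, Finset.mem_filter, Finset.mem_univ, true_and, hout]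
    constructor
    · rintro ⟨x, -, p, hp, hpv⟩
      have hpU := (hmate x p hp).1
      refine ⟨x, ⟨p, hpU⟩, hp, ?_⟩
      rw [hP₃.2 ⟨p, hpU⟩] at hpv
      exact (pt.symm.injective (Fin.ext hpv)).symm
    · rintro ⟨x, p, hp, rfl⟩
      exact ⟨x, (hmate x p hp).2, p, hp, hP₃.2 p⟩
  · rw [hdone, hfair, h23₃, show I.k = k from rfl]
    split_ifs with h1 <;> simp [h1]

end RoundProgram

/-! ## The main loop -/

section MainLoop

theorem bind_congr_support {α β : Type*} (p : PMF α) {f g : α → PMF β}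
    (h : ∀ a ∈ p.support, f a = g a) : p.bind f = p.bind g := by
  ext b
  simp only [PMF.bind_apply]
  refine tsum_congr fun a => ?_
  by_cases ha : p a = 0
  · simp [ha]
  · rw [h a ((PMF.mem_support_iff _ _).2 ha)]

/-- `iterate` splits off the last pass while `repeatUntil` splits off the first round; this moves
the first pass to the front. -/
theorem iterate_succ_eq (step : ℕ → Config → PMF Config) (r : ℕ) (s : Config) :
    iterate step (r + 1) s = (step 0 s).bind (iterate (fun i => step (i + 1)) r) := by
  induction r with
  | zero =>
    rw [iterate, iterate, PMF.pure_bind]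
    exact (PMF.bind_pure _).symm
  | succ r ih =>
    rw [iterate, ih, PMF.bind_bind]
    rfl

variable {V : Type*} [Fintype V] {Δ Ω : Type*} {good : Finset V → Prop} {law : PMF Ω} {D : Ω → Δ}
  {solve : Δ → Finset V} {step : ℕ → Config → PMF Config} {Inv done : Config → Prop}
  {out : Config → Finset V} {B : ℕ}

open Classical in
/-- A loop that draws and solves until the result is good implements `repeatUntil`. -/
theorem iterate_map_eq_repeatUntil
    (hdone : ∀ i s, Inv s → done s → ∃ s', step i s = PMF.pure s' ∧ Inv s' ∧ done s' ∧
      out s' = out s)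
    (hstep : ∀ i s, Inv s → ¬ done s → ∃ F : Ω → Config, step i s = law.map F ∧
      ∀ q ∈ law.support, Inv (F q) ∧ out (F q) = solve (D q) ∧ (done (F q) ↔ good (solve (D q))))
    (r j : ℕ) (s : Config) (hs : Inv s) :
    (iterate (fun i => step (i + j)) r s).map out =
      if done s then PMF.pure (out s)
      else repeatUntil good (law.map D) (fun _ => solve) r (out s) := by
  induction r generalizing j s with
  | zero => simp [iterate, repeatUntil, PMF.pure_map]
  | succ r ih =>
    -- The passes know their number, so the induction runs over loops that start at an arbitrary
    -- number `j`.
    have hshift : (fun i => step (i + 1 + j)) = fun i => step (i + (j + 1)) :=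
      funext fun i => by rw [add_right_comm, add_assoc]
    rw [iterate_succ_eq, hshift, Nat.zero_add, PMF.map_bind]
    split_ifs with h
    · obtain ⟨s', h1, h2, h3, h4⟩ := hdone j s hs h
      rw [h1, PMF.pure_bind, ih _ _ h2, if_pos h3, h4]
    · obtain ⟨F, h1, h2⟩ := hstep j s hs h
      rw [h1, PMF.bind_map, repeatUntil, PMF.bind_map]
      refine bind_congr_support _ fun q hq => ?_
      obtain ⟨h3, h4, h5⟩ := h2 q hq
      simp only [Function.comp]
      rw [ih _ _ h3, h4]
      simp only [h5]

theorem time_le_of_mem_support_iterate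
    (hstep : ∀ i s, Inv s → ∀ s' ∈ (step i s).support, Inv s' ∧ s'.time ≤ s.time + B)
    (r : ℕ) (s : Config) (hs : Inv s) :
    ∀ s' ∈ (iterate step r s).support, Inv s' ∧ s'.time ≤ s.time + r * B := by
  induction r with
  | zero =>
    intro s' hs'
    rw [iterate, PMF.mem_support_pure_iff] at hs'
    subst hs'
    exact ⟨hs, by omega⟩
  | succ r ih =>
    intro s' hs'
    rw [iterate, PMF.mem_support_bind_iff] at hs'
    obtain ⟨s₁, h1, h2⟩ := hs'
    obtain ⟨h3, h4⟩ := ih s₁ h1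
    obtain ⟨h5, h6⟩ := hstep r s₁ h3 s' h2
    exact ⟨h5, by rw [Nat.succ_mul]; omega⟩

end MainLoop

/-! ## The program -/

section Program

/-- The preparation of the main loop. -/
def setupCmd : Cmd :=
  pruneCmd ;; neighborCmd ;; searchCmd ;; radiusCmd ;; roundsCmd ;; lowerSumCmd

/-- One pass through the main loop. -/
def passCmd : Cmd :=
  .cond (.eq (var 23) (.const 0)) ((shuffleCmd ;; drawRadiusCmd) ;; roundCmd) .skip

/-- The algorithm. -/
def mainCmd : Cmd := setupCmd ;; .loop 24 (var 21) passCmd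

/-- A bound on the number of selected points. -/
def sizeBound (m k : ℕ) : ℕ := m * (k + 1)

/-- A bound on the time of the preparation. -/
def setupTime (n m k T : ℕ) : ℕ :=
  n * (sizeBound m k * 100 + 200) + sizeBound m k * (sizeBound m k * 100 + 100) +
    sizeBound m k * (sizeBound m k * (m * 100 + 100) + 100) + m * 200 + T * 100 + 600

/-- A bound on the time of one pass through the main loop. -/
def passTime (m k : ℕ) : ℕ :=
  sizeBound m k * (sizeBound m k * 100 + 100) + k * (m * (sizeBound m k * 100 + 400) + 400) +
    sizeBound m k * 130 + m * 30 + 900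

/-- In terms of `a = m * k` the target is `n a + T m a²`, and the number of kept points is at most
`2 a`. Then pruning is `O(n a)`, the search `O(a² m)` and a pass `O(a²)`. -/
theorem time_bound {n m k T : ℕ} (hm : 1 ≤ m) (hk : 1 ≤ k) (hT : 1 ≤ T) (hn : 1 ≤ n) :
    setupTime n m k T + 4 + T * m * passTime m k ≤
      10000 * (k * m * n + T * m ^ 3 * k ^ 2) := by
  have hK : sizeBound m k ≤ 2 * (m * k) := by unfold sizeBound; nlinarith
  unfold setupTime passTime
  generalize sizeBound m k = K at *
  set a := m * k with ha
  have hma : m ≤ a := Nat.le_mul_of_pos_right m hk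
  have hka : k ≤ a := Nat.le_mul_of_pos_left k hm
  have ha1 : 1 ≤ a := hm.trans hma
  have haa : a ≤ a * a := Nat.le_mul_of_pos_right a ha1
  have hKa : K * a ≤ 2 * (a * a) := by nlinarith
  have hKK : K * K ≤ 4 * (a * a) := by nlinarith
  have hKKm : K * K * m ≤ 4 * (a * a * m) := by nlinarith
  have hTm : 1 ≤ T * m := Nat.mul_pos hT hm
  have hQ : T * m ^ 3 * k ^ 2 = T * m * (a * a) := by rw [ha]; ring
  have hX : k * m * n = n * a := by rw [ha]; ring
  rw [hQ, hX]
  have h1 : a * a ≤ T * m * (a * a) := Nat.le_mul_of_pos_left _ hTm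
  have h2 : a * a * m ≤ T * m * (a * a) := by
    rw [mul_comm (a * a) m, mul_assoc T]
    exact Nat.le_mul_of_pos_left _ hT
  have h3 : T ≤ T * m * (a * a) := by
    rw [mul_assoc]
    exact Nat.le_mul_of_pos_right _ (Nat.mul_pos hm (Nat.mul_pos ha1 ha1))
  have h4 : n * K ≤ 2 * (n * a) := by nlinarith
  have h5 : n ≤ n * a := Nat.le_mul_of_pos_right _ ha1
  have hpass : K * (K * 100 + 100) + k * (m * (K * 100 + 400) + 400) + K * 130 + m * 30 + 900 ≤
      2800 * (a * a) := by
    have h6 : k * (m * (K * 100 + 400) + 400) = 100 * (K * a) + 400 * a + 400 * k := by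
      rw [ha]; ring
    rw [h6]
    have h7 : K * (K * 100 + 100) = 100 * (K * K) + 100 * K := by ring
    rw [h7]
    omega
  have hpass' := Nat.mul_le_mul_left (T * m) hpass
  have h8 : T * m * (2800 * (a * a)) = 2800 * (T * m * (a * a)) := by ring
  rw [h8] at hpass'
  have h9 : n * (K * 100 + 200) = 100 * (n * K) + 200 * n := by ring
  have h10 : K * (K * 100 + 100) = 100 * (K * K) + 100 * K := by ring
  have h11 : K * (K * (m * 100 + 100) + 100) = 100 * (K * K * m) + 100 * (K * K) + 100 * K := by
    ring
  rw [h9, h11]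
  rw [h10] at hpass' ⊢
  omega

variable {V : Type*} [Fintype V] [MetricSpace V] {n m k T : ℕ} {pt : Fin n ≃ V}
  {color : V → Fin m} {ℓ u : Fin m → ℕ} {τ r : ℝ} {U : Finset V} {e : Fin U.card ≃ {x // x ∈ U}}
  {M₀ : Mem}

/-- The memory at the beginning of the main loop. -/
structure Prepared (pt : Fin n ≃ V) (ℓ : Fin m → ℕ) (T : ℕ) (r : ℝ)
    (e : Fin U.card ≃ {x // x ∈ U}) (M : Mem) : Prop where
  points : Points pt e M
  table : DistanceTable r e M
  radiusMin : M (18, 0, 0) = radiusMin m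
  radiusMax : M (19, 0, 0) = radiusMax m
  rounds : M (21, 0, 0) = T * m
  lowerSum : M (50, 0, 0) = ∑ j, ℓ j
  length : M (0, 0, 0) = 0
  fresh : M (23, 0, 0) = 0
  padded : Padded U.card m M

theorem Lists.exists_points [DecidableEq V] {L : List V} {M : Mem} (hL : L.Nodup)
    (h : Lists pt L M) : ∃ e : Fin L.toFinset.card ≃ {x // x ∈ L.toFinset}, Points pt e M := by
  have hcard : L.toFinset.card = L.length := List.toFinset_card_of_nodup hL
  refine ⟨(finCongr hcard).trans ((hL.getEquiv L).trans
    (Equiv.subtypeEquivRight fun x => List.mem_toFinset.symm)), h.1.trans hcard.symm, fun p => ?_⟩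
  exact h.2 p (hcard ▸ p.2)

open Classical in
theorem spec_setupCmd (hm : 2 ≤ m) (hτ : 0 < τ) :
    Spec (encode pt color ℓ u k T τ) setupCmd (fun _ => 0) (setupTime n m k T) fun M =>
      ∃ (U : Finset V) (e : Fin U.card ≃ {x // x ∈ U}), IsPruning color (2 * τ / 5) k U ∧
        Prepared pt ℓ T (τ / 5 * alpha m) e M := by
  set I := encode pt color ℓ u k T τ with hI
  refine Spec.seq (n * (sizeBound m k * 100 + 200) + 2)
    (sizeBound m k * (sizeBound m k * 100 + 100) +
    sizeBound m k * (sizeBound m k * (m * 100 + 100) + 100) + m * 200 + T * 100 + 500) ?_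
    (by unfold setupTime; omega)
  refine (spec_pruneCmd hτ).frame.mono le_rfl ?_
  rintro M₁ ⟨⟨L, hL, hlist, hprune⟩, hF₁⟩
  obtain ⟨e, hP₁⟩ := hlist.exists_points hL
  have hcard : L.toFinset.card ≤ sizeBound m k := hprune.card_le
  generalize L.toFinset = U at e hP₁ hprune hcard
  have hmul : U.card * (U.card * 100 + 100) ≤ sizeBound m k * (sizeBound m k * 100 + 100) := by
    gcongr
  have hmul' : U.card * (U.card * (m * 100 + 100) + 100) ≤
      sizeBound m k * (sizeBound m k * (m * 100 + 100) + 100) := by gcongr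
  refine Spec.seq (sizeBound m k * (sizeBound m k * 100 + 100) + 100)
    (sizeBound m k * (sizeBound m k * (m * 100 + 100) + 100) + m * 200 + T * 100 + 400) ?_
    (by omega)
  refine (spec_neighborCmd hm hτ (fun x hx y hy hxy hc => ?_) hP₁
    fun p c => hF₁ _ _ _ (by decide)).frame.mono (Nat.add_le_add_right hmul 100) ?_
  · rw [← mul_div_assoc]
    exact hprune.separated hx hy hxy hc
  rintro M₂ ⟨h9, hF₂⟩
  have hP₂ := hP₁.frame hF₂ (by decide) (by decide)
  refine Spec.seq (sizeBound m k * (sizeBound m k * (m * 100 + 100) + 100) + 100)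
    (m * 200 + T * 100 + 300) ?_ (by linarith)
  refine (spec_searchCmd hP₂ h9 fun p q => by
    rw [hF₂ _ _ _ (by decide), hF₁ _ _ _ (by decide)]).frame.mono
      (Nat.add_le_add_right hmul' 100) ?_
  rintro M₃ ⟨h12, hF₃⟩
  refine Spec.seq (m * 100 + 100) (m * 100 + T * 100 + 200) ?_ (by linarith)
  have hF₁₃ : ∀ a i j, a ∉ pruneCmd.writes → a ∉ neighborCmd.writes → a ∉ searchCmd.writes →
      M₃ (a, i, j) = 0 := fun a i j h1 h2 h3 => by
    rw [hF₃ _ _ _ h3, hF₂ _ _ _ h2, hF₁ _ _ _ h1]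
  refine (spec_radiusCmd hm (hF₁₃ _ _ _ (by decide) (by decide) (by decide))).frame.mono le_rfl ?_
  rintro M₄ ⟨⟨h18, h19⟩, hF₄⟩
  refine Spec.seq (T * 100 + 100) (m * 100 + 100) ?_ (by linarith)
  have h21₄ : M₄ (21, 0, 0) = 0 :=
    (hF₄ _ _ _ (by decide)).trans (hF₁₃ _ _ _ (by decide) (by decide) (by decide))
  refine (spec_roundsCmd h21₄).frame.mono le_rfl ?_
  rintro M₅ ⟨h21, hF₅⟩
  have h50₅ : M₅ (50, 0, 0) = 0 := (hF₅ _ _ _ (by decide)).trans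
    ((hF₄ _ _ _ (by decide)).trans (hF₁₃ _ _ _ (by decide) (by decide) (by decide)))
  refine (spec_lowerSumCmd h50₅).frame.mono le_rfl ?_
  rintro M₆ ⟨h50, hF₆⟩
  -- Arrays that the preparation never touches still hold their initial zeros; this includes the
  -- output length and the success flag.
  have hzero : ∀ a i j, a ∉ setupCmd.writes → M₆ (a, i, j) = 0 := by
    intro a i j ha
    rw [hF₆ _ _ _ fun h => ha ?_, hF₅ _ _ _ fun h => ha ?_, hF₄ _ _ _ fun h => ha ?_,
      hF₁₃ _ _ _ (fun h => ha ?_) (fun h => ha ?_) fun h => ha ?_] <;>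
      simp only [setupCmd, Cmd.writes.eq_4, List.mem_append, h, true_or, or_true]
  refine ⟨U, e, hprune, ?_, fun p q t => ?_, ?_, ?_, ?_, h50, hzero _ _ _ (by decide),
    hzero _ _ _ (by decide), fun _ _ => hzero _ _ _ (by decide), fun _ _ => hzero _ _ _ (by decide),
    fun _ _ => hzero _ _ _ (by decide), fun _ _ => hzero _ _ _ (by decide)⟩
  · exact (((hP₂.frame hF₃ (by decide) (by decide)).frame hF₄ (by decide) (by decide)).frame hF₅
      (by decide) (by decide)).frame hF₆ (by decide) (by decide)
  · rw [hF₆ _ _ _ (by decide), hF₅ _ _ _ (by decide), hF₄ _ _ _ (by decide)]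
    exact h12 p q t
  · rw [hF₆ _ _ _ (by decide), hF₅ _ _ _ (by decide), h18]
  · rw [hF₆ _ _ _ (by decide), hF₅ _ _ _ (by decide), h19]
  · rw [hF₆ _ _ _ (by decide), h21]

/-- The invariant of the main loop. -/
def MainInv (m : ℕ) (U : Finset V) (M₀ : Mem) (s : Config) : Prop :=
  Frame roundWrites M₀ s.mem ∧ Padded U.card m s.mem

theorem Padded.frame {N : ℕ} {M M' : Mem} {W : List ℕ} (h : Padded N m M) (hF : Frame W M M')
    (h29 : 29 ∉ W) (h33 : 33 ∉ W) (h34 : 34 ∉ W) (h35 : 35 ∉ W) : Padded N m M' :=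
  ⟨fun v hv => (hF _ _ _ h29).trans (h.label v hv), fun v hv => (hF _ _ _ h33).trans (h.mate v hv),
    fun v hv => (hF _ _ _ h34).trans (h.parent v hv),
    fun v hv => (hF _ _ _ h35).trans (h.count v hv)⟩

/-- A counting loop cannot be left early. After a success the remaining passes only test the flag
and keep the output. -/
theorem exec_passCmd_of_done (I : Input) (i : ℕ) {s : Config} (hs : MainInv m U M₀ s)
    (hdone : s.mem (23, 0, 0) ≠ 0) :
    ∃ s', passCmd.exec I ((s.write 24 0 0 i).tick 1) = PMF.pure s' ∧ MainInv m U M₀ s' ∧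
      s'.mem (23, 0, 0) ≠ 0 ∧ outputSet pt s' = outputSet pt s ∧ s'.time ≤ s.time + 20 := by
  refine ⟨(((s.write 24 0 0 i).tick 1).tick 6).tick 1, ?_, ⟨?_, ?_⟩, ?_, ?_, ?_⟩
  · have h : ¬ (BExpr.eq (var 23) (.const 0)).holds I ((s.write 24 0 0 i).tick 1).mem := by
      simpa [BExpr.holds, NExpr.eval, Config.write, Config.tick, Function.update_apply] using hdone
    exact if_neg h
  · exact hs.1.update (by decide) _ _ _
  · exact hs.2.frame (W := [24]) ((Frame.refl _ _).update (by decide) _ _ _) (by decide) (by decide)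
      (by decide) (by decide)
  · simpa [Config.write, Config.tick, Function.update_apply] using hdone
  · simp [outputSet, Config.write, Config.tick, Function.update_apply]
  · simp only [Config.write, Config.tick]
    omega

theorem exec_passCmd_of_not_done [Nonempty V] (hm : 2 ≤ m) (hlu : ∀ j, ℓ j ≤ u j)
    (hk : ∑ j, ℓ j ≤ k) (hU : U.card ≤ sizeBound m k) (hM₀ : Prepared pt ℓ T r e M₀) (i : ℕ)
    {s : Config} (hs : MainInv m U M₀ s) (hdone : ¬ s.mem (23, 0, 0) ≠ 0) :
    ∃ F : (Fin U.card ≃ {x // x ∈ U}) × ℕ → Config,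
      passCmd.exec (encode pt color ℓ u k T τ) ((s.write 24 0 0 i).tick 1) =
        (randomChoice m U).map F ∧
      ∀ q ∈ (randomChoice m U).support, MainInv m U M₀ (F q) ∧
        outputSet pt (F q) = assignOf (encode pt color ℓ u k T τ) color ℓ u k e M₀
          (cluster U r q.1 q.2) ∧
        ((F q).mem (23, 0, 0) ≠ 0 ↔ Fair color ℓ u k
          (assignOf (encode pt color ℓ u k T τ) color ℓ u k e M₀ (cluster U r q.1 q.2))) ∧
        (F q).time ≤ s.time + passTime m k := by
  set I := encode pt color ℓ u k T τ with hI
  have hcond : (BExpr.eq (var 23) (.const 0)).holds I ((s.write 24 0 0 i).tick 1).mem := by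
    simpa [BExpr.holds, NExpr.eval, Config.write, Config.tick, Function.update_apply] using hdone
  obtain ⟨s₁, hs₁⟩ : ∃ s₁, s₁ = ((s.write 24 0 0 i).tick 1).tick 6 := ⟨_, rfl⟩
  have hexec : passCmd.exec I ((s.write 24 0 0 i).tick 1) =
      ((shuffleCmd ;; drawRadiusCmd).exec I s₁).bind (roundCmd.exec I) := by
    rw [hs₁]
    exact if_pos hcond
  have hF₁ : Frame [24] s.mem s₁.mem := by
    rw [hs₁]
    exact (Frame.refl _ _).update (by decide) _ _ _
  have hF₀₁ : Frame roundWrites M₀ s₁.mem := hs.1.trans (hF₁.mono (by decide))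
  obtain ⟨F, hF, hprops⟩ := exec_draws (e := e) hm I (s := s₁)
    (hM₀.points.frame hF₀₁ (by decide) (by decide))
    ((hF₀₁ _ _ _ (by decide)).trans hM₀.radiusMin) ((hF₀₁ _ _ _ (by decide)).trans hM₀.radiusMax)
  refine ⟨fun q => ⟨(roundCmd.det I (F q).mem).1, (F q).time + (roundCmd.det I (F q).mem).2⟩,
    ?_, fun q hq => ?_⟩
  · rw [hexec, hF, PMF.bind_map, PMF.map]
    refine congrArg _ (funext fun q => ?_)
    exact Cmd.exec_eq_pure I roundCmd (by decide) (F q)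
  · have hR := mem_support_randomChoice hm hq
    obtain ⟨h25, h28, hF₂, htime⟩ := hprops q hR
    have hF₀₂ : Frame roundWrites M₀ (F q).mem := hF₀₁.trans (hF₂.mono (by decide))
    have hspec := spec_roundCmd (color := color) (k := k) (T := T) (u := u) (τ := τ) hM₀.points
      hM₀.table hM₀.lowerSum hlu hk ((one_le_radiusMin m).trans hR) hF₀₂
      ((hs.2.frame hF₁ (by decide) (by decide) (by decide) (by decide)).frame hF₂ (by decide)
        (by decide) (by decide) (by decide)) h25 h28
      (by rw [hF₂ _ _ _ (by decide), hF₁ _ _ _ (by decide)]; exact not_not.1 hdone)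
    rw [← hI] at hspec
    obtain ⟨h1, h2, h3⟩ := hspec.2
    refine ⟨⟨hF₀₂.trans ((roundCmd.det_frame I _).mono (by decide)), h1⟩, h2 _, h3, ?_⟩
    have h4 := hspec.1
    have h5 : s₁.time = s.time + 7 := by rw [hs₁]; rfl
    have hmul : U.card * (U.card * 100 + 100) ≤ sizeBound m k * (sizeBound m k * 100 + 100) := by
      gcongr
    have hmul' : k * (m * (U.card * 100 + 400) + 400) ≤
      k * (m * (sizeBound m k * 100 + 400) + 400) := by gcongr
    simp only [passTime]
    omega

open Classical in
/-- The program implements the algorithm. -/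
theorem mainCmd_correct [Nonempty V] (hm : 2 ≤ m) (hτ : 0 < τ) (hlu : ∀ j, ℓ j ≤ u j)
    (hk : ∑ j, ℓ j ≤ k) :
    IsOutputLaw color ℓ u k (2 * τ / 5) (τ / 5) k T
        ((mainCmd.run (encode pt color ℓ u k T τ)).map (outputSet pt)) ∧
      ∀ s ∈ (mainCmd.run (encode pt color ℓ u k T τ)).support,
        s.time ≤ setupTime n m k T + 4 + T * m * passTime m k := by
  set I := encode pt color ℓ u k T τ with hI
  obtain ⟨htime, U, e, hprune, hM₀⟩ := spec_setupCmd (pt := pt) (color := color) (ℓ := ℓ) (u := u)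
    (k := k) (T := T) hm hτ
  rw [← hI] at htime hM₀
  set M₀ := (setupCmd.det I fun _ => 0).1 with hM₀def
  have hU : U.card ≤ sizeBound m k := hprune.card_le
  obtain ⟨s₀, hs₀⟩ : ∃ s₀ : Config, s₀ = ⟨M₀, (setupCmd.det I fun _ => 0).2 + 4⟩ := ⟨_, rfl⟩
  have hrun : mainCmd.run I =
      iterate (fun i s => passCmd.exec I ((s.write 24 0 0 i).tick 1)) (T * m) s₀ := by
    have h1 : mainCmd.run I = (setupCmd.exec I ⟨fun _ => 0, 0⟩).bind
      ((Cmd.loop 24 (var 21) passCmd).exec I) := rfl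
    rw [h1, Cmd.exec_eq_pure I setupCmd (by decide), PMF.pure_bind]
    have h2 : (Cmd.loop 24 (var 21) passCmd).exec I
        ⟨(setupCmd.det I fun _ => 0).1, 0 + (setupCmd.det I fun _ => 0).2⟩ =
        iterate (fun i s => passCmd.exec I ((s.write 24 0 0 i).tick 1)) (M₀ (21, 0, 0))
          ⟨M₀, 0 + (setupCmd.det I fun _ => 0).2 + 4⟩ := rfl
    rw [h2, hM₀.rounds, Nat.zero_add, hs₀]
  have hs₀inv : MainInv m U M₀ s₀ := by
    rw [hs₀]
    exact ⟨Frame.refl _ _, hM₀.padded⟩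
  have hstep := fun i s (hs : MainInv m U M₀ s) hd =>
    exec_passCmd_of_not_done (color := color) (τ := τ) (u := u) hm hlu hk hU hM₀ i hs hd
  rw [hrun]
  constructor
  -- The program resolves the arbitrary choices in the same way in every round, so its `solve`
  -- ignores the number of the repetition.
  · refine ⟨U, hprune, fun _ => assignOf I color ℓ u k e M₀,
      fun _ D => isAssignment_assignOf I D, ?_⟩
    have h := iterate_map_eq_repeatUntil (good := Fair color ℓ u k) (law := randomChoice m U)
      (D := fun q => cluster U (τ / 5 * alpha m) q.1 q.2) (solve := assignOf I color ℓ u k e M₀)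
      (step := fun i s => passCmd.exec I ((s.write 24 0 0 i).tick 1)) (Inv := MainInv m U M₀)
      (done := fun s => s.mem (23, 0, 0) ≠ 0) (out := outputSet pt)
      (fun i s hs hd => by
        obtain ⟨s', h1, h2, h3, h4, -⟩ := exec_passCmd_of_done (pt := pt) I i hs hd
        exact ⟨s', h1, h2, h3, h4⟩)
      (fun i s hs hd => by
        obtain ⟨F, h1, h2⟩ := hstep i s hs hd
        exact ⟨F, h1, fun q hq => ⟨(h2 q hq).1, (h2 q hq).2.1, (h2 q hq).2.2.1⟩⟩)
      (T * m) 0 s₀ hs₀inv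
    simp only [Nat.add_zero] at h
    have hout : outputSet pt s₀ = ∅ := by
      simp [outputSet, hs₀, hM₀.length]
    rw [h, if_neg (by simp [hs₀, hM₀.fresh]), decompose_eq_map, hout]
  · intro s hs
    have h := (time_le_of_mem_support_iterate (Inv := MainInv m U M₀) (B := passTime m k)
      (fun i s hs s' hs' => ?_) (T * m) s₀ hs₀inv s hs).2
    · have h1 : s₀.time ≤ setupTime n m k T + 4 := by
        rw [hs₀]
        exact Nat.add_le_add_right htime 4
      omega
    · by_cases hd : s.mem (23, 0, 0) ≠ 0
      · obtain ⟨s₁, h1, h2, -, -, h3⟩ := exec_passCmd_of_done (pt := pt) I i hs hd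
        rw [h1, PMF.mem_support_pure_iff] at hs'
        subst hs'
        refine ⟨h2, h3.trans ?_⟩
        unfold passTime
        omega
      · obtain ⟨F, h1, h2⟩ := hstep i s hs hd
        rw [h1, PMF.mem_support_map_iff] at hs'
        obtain ⟨q, hq, rfl⟩ := hs'
        exact ⟨(h2 q hq).1, (h2 q hq).2.2.2⟩

end Program

end

end FMMD

theorem proposition7 :
    ∃ (c : ℝ) (P : FMMD.Cmd) (C : ℕ), 0 < c ∧
      ∀ (V : Type*) [Fintype V] [MetricSpace V] (n m k T : ℕ) (pt : Fin n ≃ V)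
        (color : V → Fin m) (ℓ u : Fin m → ℕ) (τ : ℝ),
        2 ≤ m → 1 ≤ k → k ≤ m → 1 ≤ T → 0 < τ →
        (∃ O : Finset V, FMMD.Fair color ℓ u k O ∧ ENNReal.ofReal τ ≤ FMMD.diversity O) →
        -- the guarantee, whatever the arbitrary choices of the algorithm are
        (∀ μ : PMF (Finset V), FMMD.IsOutputLaw color ℓ u k (2 * τ / 5) (τ / 5) k T μ →
          ENNReal.ofReal (1 - (2 : ℝ) ^ (-(c * (T : ℝ)))) ≤
            μ.toOuterMeasure {S | FMMD.Fair color ℓ u k S ∧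
              ENNReal.ofReal (Real.sqrt (Real.log m) * τ / (5 * m)) ≤ FMMD.diversity S}) ∧
        -- the program `P` is an implementation of the algorithm
        FMMD.IsOutputLaw color ℓ u k (2 * τ / 5) (τ / 5) k T
          ((P.run (FMMD.encode pt color ℓ u k T τ)).map (FMMD.outputSet pt)) ∧
        -- the running time of the program
        ∀ s ∈ (P.run (FMMD.encode pt color ℓ u k T τ)).support,
          s.time ≤ C * (k * m * n + T * m ^ 3 * k ^ 2) := by
  refine ⟨FMMD.successConstant, FMMD.mainCmd, 10000, Real.exp_pos _, ?_⟩
  intro V _ _ n m k T pt color ℓ u τ hm hk hkm hT hτ ⟨O, hO, hdiv⟩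
  have hV : Nonempty V := by
    obtain ⟨v, -⟩ := Finset.card_pos.1 (hk.trans_eq hO.1.symm)
    exact ⟨v⟩
  have hn : 1 ≤ n := (pt.symm hV.some).pos
  have hcorrect := FMMD.mainCmd_correct (pt := pt) (color := color) (T := T) hm hτ
    hO.lower_le_upper hO.sum_lower_le
  exact ⟨fun μ hμ => FMMD.guarantee hm hk hkm hτ hO hdiv hμ, hcorrect.1,
    fun s hs => (hcorrect.2 s hs).trans (FMMD.time_bound (by omega) hk hT hn)⟩
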